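/- Let $q>2$ be a prime, let $p$ be an integer that is not a multiple of $q$, and put (this is the kicked rotor with $\tau=2\pi p/q$ and $\beta=\tfrac12$) $$a_r=e^{-i\pi p(r-\frac12)^2/q}\quad(1\le r\le q),\qquad G_{jk}=\frac1q\sum_{s=0}^{q-1}e^{2\pi i s(j-k)/q}\,a_{s+1},\qquad S_{jk}(\vartheta,\mu)=e^{-i\mu\cos(\vartheta+2\pi(j-1)/q)}\,G_{jk}\quad(1\le j,k\le q).$$ The numbers $a_1,\dots,a_q$ are the eigenvalues of $G=S(\vartheta,0)$. For $1\le j\le\frac{q+1}2$ let $\alpha_j=\max\{2j-1,\,q-2j+1\}$ and $\alpha_{q-j+1}=\alpha_j$. There are complex numbers $s_j(p,q)$, $1\le j\le q$, defined for all such $p,q$ and depending only on $j,p,q$, such that the following holds. (a) $a_r=a_{q-r+1}$ for $1\le r\le q$, and every eigenvalue of $G$ has multiplicity two, except $a_{(q+1)/2}$, which is simple. Moreover $\tfrac q2<\alpha_j\le q$ for $1\le j\le q$. (b) For some $\delta>0$ (depending on $p,q$) the eigenvalues of $S(\vartheta,\mu)$, repeated according to multiplicity, can be numbered $w_1(\vartheta,\mu),\dots,w_q(\vartheta,\mu)$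 for $\vartheta\in\mathbb R$, $|\mu|<\delta$, so that each $w_j$ is continuous in $(\vartheta,\mu)$ and differentiable in $\vartheta$, $w_j(\vartheta,0)=a_j$, and, for every $j$ and every $\vartheta\in\mathbb R$, $$\frac{d}{d\vartheta}\,w_j\!\left(\tfrac{\vartheta}{q},\mu\right)\;\sim\;\mu^{\alpha_j}\,s_j(p,q)\,\sin\vartheta\qquad(\mu\to0).$$ Here $f\sim g$ means $f-g=o(g)$. (c) There are constants $C,\gamma>0$ and real numbers $A_j(q)$ with $A_j(q)=O\big(\sqrt{q\log^3 q}\big)$ as $q\to\infty$, uniformly in $j$, such that for all sufficiently large primes $q$, all integers $p$ that are not multiples of $q$ and all $1\le j\le q$, $$|s_j(p,q)|\le C\,e^{-\gamma q+A_j(q)}.$$ -/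

import Mathlib

namespace KickedRotor

/-- The phases `a_r = exp (-i π p (r + β - 1)² / q)`, for `1 ≤ r ≤ q`. -/
noncomputable def phase (q : ℕ) (p : ℤ) (β : ℝ) (r : ℕ) : ℂ :=
  Complex.exp (-(Complex.I * Real.pi * p * ((r : ℂ) + β - 1) ^ 2 / q))

/-- The unperturbed matrix `G`. Rows and columns are indexed by `0, …, q - 1`, so that the
differences `j - k` are the same as for indices `1, …, q`. -/
noncomputable def freeMatrix (q : ℕ) (p : ℤ) (β : ℝ) : Matrix (Fin q) (Fin q) ℂ :=
  Matrix.of fun j k =>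
    (1 / (q : ℂ)) * ∑ s ∈ Finset.range q,
      Complex.exp (2 * Real.pi * Complex.I * (s : ℂ) * (((j : ℕ) : ℂ) - ((k : ℕ) : ℂ)) / q) *
        phase q p β (s + 1)

/-- The Bloch fibre `S(ϑ, μ)` of the kicked rotor propagator at the resonance `τ = 2πp/q`
of length `q`. Since the row index starts at `0`, the angle in row `j` is `ϑ + 2πj/q`. -/
noncomputable def blochMatrix (q : ℕ) (p : ℤ) (β ϑ μ : ℝ) : Matrix (Fin q) (Fin q) ℂ :=
  Matrix.of fun j k =>
    Complex.exp (-(Complex.I * μ * (Real.cos (ϑ + 2 * Real.pi * ((j : ℕ) : ℝ) / q) : ℂ))) *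
      freeMatrix q p β j k

/-- `w_1, …, w_q` enumerate the eigenvalues of `S(ϑ, μ)` with multiplicity, for all real `ϑ` and
`|μ| < δ`, continuously in `(ϑ, μ)` and so that `w_j(ϑ, 0) = a_j`. -/
structure IsEigenvalueNumbering (q : ℕ) (p : ℤ) (β δ : ℝ) (w : ℕ → ℝ → ℝ → ℂ) : Prop where
  continuousOn : ∀ j ∈ Finset.Icc 1 q,
    ContinuousOn (fun x : ℝ × ℝ => w j x.1 x.2) (Set.univ ×ˢ Set.Ioo (-δ) δ)
  charpoly_eq : ∀ ϑ : ℝ, ∀ μ ∈ Set.Ioo (-δ) δ,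
    (blochMatrix q p β ϑ μ).charpoly =
      ∏ j ∈ Finset.Icc 1 q, (Polynomial.X - Polynomial.C (w j ϑ μ))
  at_zero : ∀ j ∈ Finset.Icc 1 q, ∀ ϑ : ℝ, w j ϑ 0 = phase q p β j

/-- The exponent `α_j = max {2j - 1, q - 2j + 1}` for `1 ≤ j ≤ (q + 1)/2`, extended to
`1 ≤ j ≤ q` by `α_{q-j+1} = α_j`. On this range the subtractions do not truncate. -/
def exponent (q j : ℕ) : ℕ :=
  max (2 * min j (q + 1 - j) - 1) (q + 1 - 2 * min j (q + 1 - j))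

end KickedRotor

/-! Let `h` be the inverse of 2 modulo `q` and `e` the standard additive character of `ZMod q`.
Completing the square gives `a_r = θ e(u t²)` with `t = r - h`, `|θ| = 1` and `u ≠ 0`. Hence the
degenerate pairs are `{t, -t}`, and `t = 0` is simple. In the eigenbasis of `G` (momentum space
`ZMod q`) the kick is a convolution matrix; its entry for a hop of cyclic length `k < q/2` is
`(iμ/2)^k / k!` to leading order.

Two effects determine the exponents. At `ϑ = 0` the partners `t, -t`, at cyclic distance `d < q/2`,
are connected by monotone hops along the shorter arc and split at order `μ^d`. The coefficient is
governed by `transmission` for a ladder of length `d` (`exists_splitting`). The angle enters much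
later. The coefficients of the characteristic polynomial are sums over subsets `J` of `ZMod q` of
`exp(μ kick J)`, with weights invariant under the dihedral group. So their moments of order below
`q` do not depend on `ϑ`, and order `q` contributes only `cos(qϑ)` (`norm_kickSumDeriv_sub_le`). The
coefficient of this harmonic needs only hops in one direction. It is therefore a Hessenberg
determinant, which factors at the second degenerate site into the transmissions of the two arcs `d`
and `q - d`, times the gaps to all other eigenvalues (`norm_leadingHarmonic`, `det_hessenberg_add`).

Implicit differentiation divides the `μ^q` term by the product of all gaps at the eigenvalue, which
is of order `μ^d`. This yields the exponent `q - d = α_j`. The gaps and the transmission of the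
short arc cancel, and up to a factor 2 at `t = 0` the leading coefficient has modulus `2^(-(q-d))
|transmission (q-d)|` (`exists_eigenvalues`). The roots collide at `μ = 0`, so the implicit function
theorem is run in a quantitative form: the angle moves a root by `O(μ^(q-d))`, which is smaller than
the gap of order `μ^d` because `2d < q` (`SeparatedFamily`).

Two arithmetic facts about transmissions remain. They do not vanish (`transmission_ne_zero`): at the
prime of `ℚ(ζ_q)` above `q`, the path of unit steps has the strictly largest pole, except for length
`q`, where the single hop of length `q` ties with it and the residues add to 2. They are at most `(2
/ log 3)^n exp(O(√(q log³ q)))` (`norm_transmission_ratio_le`): a majorant argument gives the power,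
and Weyl's bound for quadratic exponential sums controls the product of small denominators. Since
`log 3 > 1` and `α_j > q/2`, the product with `2^(-α_j)` decays exponentially. -/

namespace KickedRotor

open Finset ZMod

/-! ### Ladders of amplitudes between degenerate sites. -/

/-- The amplitudes `ψ_l` obtained by solving `∑ k ≤ l, ψ_k / (l - k)! = R_l ψ_l` upwards from
`ψ_0 = 1`. -/
noncomputable def ladder (R : ℕ → ℂ) : ℕ → ℂ
  | 0 => 1
  | l + 1 => (R (l + 1) - 1)⁻¹ * ∑ k : Fin (l + 1), ladder R k / ((l + 1 - k).factorial : ℂ)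

/-- The residual amplitude that the ladder started at `0` transmits to the site `n`. -/
noncomputable def transmission (R : ℕ → ℂ) (n : ℕ) : ℂ :=
  ∑ k ∈ range n, ladder R k / ((n - k).factorial : ℂ)

lemma ladder_zero (R : ℕ → ℂ) : ladder R 0 = 1 := by rw [ladder]

lemma ladder_of_pos (R : ℕ → ℂ) {l : ℕ} (hl : 0 < l) :
    ladder R l = (R l - 1)⁻¹ * transmission R l := by
  obtain ⟨l, rfl⟩ : ∃ k, l = k + 1 := ⟨l - 1, by omega⟩
  rw [ladder, transmission, Finset.sum_range]

/-- The ratios `a_{m + l} / a_m` of the phases on a ladder of length `n` that connects two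
degenerate sites. -/
noncomputable def ratio {q : ℕ} [NeZero q] (u : ZMod q) (n l : ℕ) : ℂ :=
  stdAddChar (u * ((l : ZMod q) * ((l : ZMod q) - (n : ZMod q))))

/-! ### Nonvanishing of transmissions by reduction at the prime above `q`. -/

section Reduction

variable {q : ℕ} [Fact q.Prime]

/-- `z` is a `q`-integral element of `ℚ(ζ_q)` with residue `c` at the prime above `q`. -/
def HasResidue (z : ℂ) (c : ZMod q) : Prop :=
  ∃ (P : Polynomial ℤ) (N : ℤ), (N : ZMod q) ≠ 0 ∧
    (N : ℂ) * z = Polynomial.aeval (stdAddChar (1 : ZMod q)) P ∧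
    ((P.eval 1 : ℤ) : ZMod q) = c * N

lemma stdAddChar_eq_pow (x : ZMod q) (k : ℕ) :
    stdAddChar (x * (k : ZMod q)) = stdAddChar x ^ k := by
  rw [← AddChar.map_nsmul_eq_pow, nsmul_eq_mul, mul_comm]

lemma stdAddChar_eq_pow_val (x : ZMod q) :
    stdAddChar x = stdAddChar (1 : ZMod q) ^ x.val := by
  rw [← stdAddChar_eq_pow, one_mul, ZMod.natCast_zmod_val]

lemma isPrimitiveRoot_stdAddChar_one : IsPrimitiveRoot (stdAddChar (1 : ZMod q)) q := by
  have h := Complex.isPrimitiveRoot_exp q (NeZero.ne q)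
  have h2 := stdAddChar_coe (N := q) 1
  rw [Int.cast_one, Int.cast_one, mul_one] at h2
  rwa [h2]

/-- This is the only place where the residue is shown to be well defined. A polynomial over `ℤ` that
vanishes at `ζ_q` is a multiple of the cyclotomic polynomial, whose value at 1 is `q`. -/
lemma HasResidue.eq_zero {c : ZMod q} (h : HasResidue 0 c) : c = 0 := by
  obtain ⟨P, N, hN, hP, hc⟩ := h
  have hp : q.Prime := Fact.out
  have h1 : Polynomial.aeval (stdAddChar (1 : ZMod q)) P = 0 := by rw [← hP, mul_zero]
  have hprim := isPrimitiveRoot_stdAddChar_one (q := q)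
  have hdvd := minpoly.isIntegrallyClosed_dvd (hprim.isIntegral hp.pos) h1
  rw [← Polynomial.cyclotomic_eq_minpoly hprim hp.pos] at hdvd
  obtain ⟨Q, rfl⟩ := hdvd
  rw [Polynomial.eval_mul, Polynomial.eval_one_cyclotomic_prime] at hc
  push_cast at hc
  rw [ZMod.natCast_self, zero_mul] at hc
  exact (mul_eq_zero.mp hc.symm).resolve_right hN

lemma HasResidue.add {z w : ℂ} {c d : ZMod q} (hz : HasResidue z c) (hw : HasResidue w d) :
    HasResidue (z + w) (c + d) := by
  obtain ⟨P, N, hN, hP, hc⟩ := hz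
  obtain ⟨P', N', hN', hP', hc'⟩ := hw
  refine ⟨Polynomial.C N' * P + Polynomial.C N * P', N * N', ?_, ?_, ?_⟩
  · push_cast; exact mul_ne_zero hN hN'
  · simp only [map_add, map_mul, ← hP, ← hP', Polynomial.aeval_C]
    simp; ring
  · simp [hc, hc']; ring

lemma HasResidue.mul {z w : ℂ} {c d : ZMod q} (hz : HasResidue z c) (hw : HasResidue w d) :
    HasResidue (z * w) (c * d) := by
  obtain ⟨P, N, hN, hP, hc⟩ := hz
  obtain ⟨P', N', hN', hP', hc'⟩ := hw
  refine ⟨P * P', N * N', ?_, ?_, ?_⟩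
  · push_cast; exact mul_ne_zero hN hN'
  · simp only [map_mul, ← hP, ← hP']
    push_cast; ring
  · simp [hc, hc']; ring

lemma HasResidue.intCast (k : ℤ) : HasResidue (q := q) k k :=
  ⟨Polynomial.C k, 1, by simp, by simp, by simp⟩

lemma HasResidue.one : HasResidue (q := q) 1 1 := by simpa using HasResidue.intCast (q := q) 1

lemma HasResidue.zero : HasResidue (q := q) 0 0 := by simpa using HasResidue.intCast (q := q) 0

lemma HasResidue.neg_one : HasResidue (q := q) (-1) (-1) := by
  simpa using HasResidue.intCast (q := q) (-1)

lemma HasResidue.natCast_inv {k : ℕ} (hk : (k : ZMod q) ≠ 0) :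
    HasResidue (q := q) (k : ℂ)⁻¹ (k : ZMod q)⁻¹ := by
  refine ⟨1, k, by simpa using hk, ?_, ?_⟩
  · have : (k : ℂ) ≠ 0 := by
      rintro h
      exact hk (by rw [Nat.cast_eq_zero.mp h, Nat.cast_zero])
    simp [this]
  · simp [hk]

lemma HasResidue.stdAddChar (x : ZMod q) : HasResidue (stdAddChar x) (1 : ZMod q) :=
  ⟨Polynomial.X ^ x.val, 1, by simp, by simp [stdAddChar_eq_pow_val x], by simp⟩

lemma HasResidue.pow {z : ℂ} {c : ZMod q} (hz : HasResidue z c) (k : ℕ) :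
    HasResidue (z ^ k) (c ^ k) := by
  induction k with
  | zero => simpa using HasResidue.one
  | succ k ih => simpa [pow_succ] using ih.mul hz

lemma HasResidue.sum {ι : Type*} (s : Finset ι) {f : ι → ℂ} {g : ι → ZMod q}
    (h : ∀ i ∈ s, HasResidue (f i) (g i)) : HasResidue (∑ i ∈ s, f i) (∑ i ∈ s, g i) := by
  classical
  induction s using Finset.induction_on with
  | empty => simpa using HasResidue.zero
  | insert a s ha ih =>
    rw [sum_insert ha, sum_insert ha]
    exact (h a (mem_insert_self a s)).add (ih fun i hi => h i (mem_insert_of_mem hi))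

lemma HasResidue.prod {ι : Type*} (s : Finset ι) {f : ι → ℂ} {g : ι → ZMod q}
    (h : ∀ i ∈ s, HasResidue (f i) (g i)) : HasResidue (∏ i ∈ s, f i) (∏ i ∈ s, g i) := by
  classical
  induction s using Finset.induction_on with
  | empty => simpa using HasResidue.one
  | insert a s ha ih =>
    rw [prod_insert ha, prod_insert ha]
    exact (h a (mem_insert_self a s)).mul (ih fun i hi => h i (mem_insert_of_mem hi))

lemma stdAddChar_ne_one {x : ZMod q} (hx : x ≠ 0) : stdAddChar x ≠ 1 := by
  rw [← AddChar.map_zero_eq_one (stdAddChar (N := q))]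
  exact fun h => hx (injective_stdAddChar h)

lemma HasResidue.uniformizer : HasResidue (q := q) (ZMod.stdAddChar (1 : ZMod q) - 1) 0 := by
  simpa [sub_eq_add_neg] using (HasResidue.stdAddChar (1 : ZMod q)).add HasResidue.neg_one

/-- With `y` the inverse of `x`, `ζ = (ζ^x)^y`, so the quotient is a geometric sum of `y` roots of
unity, each of residue 1. -/
lemma HasResidue.uniformizer_mul_inv {x : ZMod q} (hx : x ≠ 0) :
    HasResidue ((ZMod.stdAddChar (1 : ZMod q) - 1) * (ZMod.stdAddChar x - 1)⁻¹) x⁻¹ := by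
  have h1 : ZMod.stdAddChar (1 : ZMod q) = ZMod.stdAddChar x ^ (x⁻¹).val := by
    rw [← stdAddChar_eq_pow, ZMod.natCast_zmod_val, mul_inv_cancel₀ hx]
  have h2 : ZMod.stdAddChar x - 1 ≠ 0 := sub_ne_zero.mpr (stdAddChar_ne_one hx)
  have h3 : (ZMod.stdAddChar (1 : ZMod q) - 1) * (ZMod.stdAddChar x - 1)⁻¹ =
      ∑ i ∈ range (x⁻¹).val, ZMod.stdAddChar x ^ i := by
    rw [geom_sum_eq (stdAddChar_ne_one hx), ← h1, div_eq_mul_inv]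
  rw [h3]
  have := HasResidue.sum (range (x⁻¹).val) (f := fun i => ZMod.stdAddChar x ^ i)
    (g := fun _ => (1 : ZMod q)) (fun i _ => by simpa using (HasResidue.stdAddChar x).pow i)
  simpa using this

lemma factorial_ne_zero_zmod {k : ℕ} (hk : k < q) : ((k.factorial : ℕ) : ZMod q) ≠ 0 := by
  rw [Ne, ZMod.natCast_eq_zero_iff, (Fact.out : q.Prime).dvd_factorial]
  omega

lemma natCast_ne_zero_zmod {k : ℕ} (h0 : 0 < k) (hk : k < q) : (k : ZMod q) ≠ 0 := by
  rw [Ne, ZMod.natCast_eq_zero_iff]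
  exact Nat.not_dvd_of_pos_of_lt h0 hk

lemma mul_sub_ne_zero_zmod {u : ZMod q} (hu : u ≠ 0) {n l : ℕ} (hn : n ≤ q) (h0 : 0 < l)
    (hl : l < n) : u * ((l : ZMod q) * ((l : ZMod q) - (n : ZMod q))) ≠ 0 := by
  refine mul_ne_zero hu (mul_ne_zero (natCast_ne_zero_zmod h0 (by omega)) ?_)
  have h := natCast_ne_zero_zmod (q := q) (k := n - l) (by omega) (by omega)
  rw [Nat.cast_sub hl.le] at h
  rw [← neg_ne_zero, neg_sub]
  exact h

lemma ratio_ne_one {u : ZMod q} (hu : u ≠ 0) {n l : ℕ} (hn : n ≤ q) (h0 : 0 < l)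
    (hl : l < n) : ratio u n l ≠ 1 :=
  stdAddChar_ne_one (mul_sub_ne_zero_zmod hu hn h0 hl)

/-- Only the path with unit steps survives modulo the uniformizer. -/
lemma HasResidue.sum_ladder {u : ZMod q} {n l : ℕ} (hl : 0 < l) (c : ℕ → ZMod q)
    (h : ∀ k < l, HasResidue ((ZMod.stdAddChar (1 : ZMod q) - 1) ^ k * ladder (ratio u n) k) (c k))
    (s : Finset ℕ) (hs : s ⊆ range l) (hs' : l - 1 ∈ s)
    (hfac : ∀ k ∈ s, (((l - k).factorial : ℕ) : ZMod q) ≠ 0) :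
    HasResidue ((ZMod.stdAddChar (1 : ZMod q) - 1) ^ (l - 1) *
      ∑ k ∈ s, ladder (ratio u n) k / ((l - k).factorial : ℂ)) (c (l - 1)) := by
  rw [mul_sum]
  have hsum : ∑ k ∈ s, (if k = l - 1 then c k else 0) = c (l - 1) := by
    rw [sum_ite_eq' s (l - 1) c, if_pos hs']
  rw [← hsum]
  refine HasResidue.sum _ fun k hk => ?_
  have hkl : k < l := mem_range.mp (hs hk)
  have h1 : (ZMod.stdAddChar (1 : ZMod q) - 1) ^ (l - 1) *
      (ladder (ratio u n) k / ((l - k).factorial : ℂ)) =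
      (ZMod.stdAddChar (1 : ZMod q) - 1) ^ (l - 1 - k) * ((l - k).factorial : ℂ)⁻¹ *
      ((ZMod.stdAddChar (1 : ZMod q) - 1) ^ k * ladder (ratio u n) k) := by
    have : (ZMod.stdAddChar (1 : ZMod q) - 1) ^ (l - 1) =
        (ZMod.stdAddChar (1 : ZMod q) - 1) ^ (l - 1 - k) *
        (ZMod.stdAddChar (1 : ZMod q) - 1) ^ k := by
      rw [← pow_add]; congr 1; omega
    rw [this, div_eq_mul_inv]; ring
  rw [h1]
  have h2 := ((HasResidue.uniformizer (q := q).pow (l - 1 - k)).mul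
    (HasResidue.natCast_inv (hfac k hk))).mul (h k hkl)
  -- The residue contains the factor `0 ^ (l - 1 - k)`, which survives only for `k = l - 1`.
  split_ifs with hk1
  · subst hk1
    have h3 : l - (l - 1) = 1 := by omega
    simpa [h3] using h2
  · have h3 : l - 1 - k ≠ 0 := by omega
    simpa [h3] using h2

/-- Each rung divides by some `ζ^x - 1`, a simple pole, so `(ζ - 1)^l` clears the poles of the
`l`-th amplitude. A longer step skips rungs and leaves spare factors of the uniformizer. -/
lemma hasResidue_ladder {u : ZMod q} (hu : u ≠ 0) {n : ℕ} (hn : n ≤ q) {l : ℕ} (hl : l < n) :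
    HasResidue ((ZMod.stdAddChar (1 : ZMod q) - 1) ^ l * ladder (ratio u n) l)
      (∏ m ∈ range l, (u * (((m + 1 : ℕ) : ZMod q) * (((m + 1 : ℕ) : ZMod q) - (n : ZMod q))))⁻¹) := by
  induction l using Nat.strong_induction_on with
  | _ l ih =>
    rcases Nat.eq_zero_or_pos l with rfl | h0
    · simpa [ladder_zero] using HasResidue.one
    obtain ⟨l, rfl⟩ : ∃ k, l = k + 1 := ⟨l - 1, by omega⟩
    rw [ladder_of_pos _ h0, prod_range_succ]
    have h1 := HasResidue.sum_ladder (u := u) (n := n) h0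
      (fun l => ∏ m ∈ range l, (u * (((m + 1 : ℕ) : ZMod q) * (((m + 1 : ℕ) : ZMod q) - (n : ZMod q))))⁻¹)
      (fun k hk => ih k hk (hk.trans hl)) (range (l + 1)) subset_rfl (by simp)
      (fun k _ => factorial_ne_zero_zmod (by omega))
    have h2 := h1.mul (HasResidue.uniformizer_mul_inv (mul_sub_ne_zero_zmod hu hn h0 hl))
    simp only [Nat.add_sub_cancel] at h2
    convert h2 using 1
    rw [transmission, ratio, pow_succ]
    ring

/-- For `n < q` all factorials are units modulo `q`, so the residue is that of the unit-step path, a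
product of inverses of nonzero elements. -/
lemma transmission_ne_zero_of_lt {u : ZMod q} (hu : u ≠ 0) {n : ℕ} (h0 : 0 < n) (hn : n < q) :
    transmission (ratio u n) n ≠ 0 := by
  intro h
  have h1 := HasResidue.sum_ladder (u := u) (n := n) h0 _
    (fun k hk => hasResidue_ladder hu hn.le hk) (range n) subset_rfl (by simp [h0])
    (fun k _ => factorial_ne_zero_zmod (by omega))
  rw [← transmission, h, mul_zero] at h1
  refine prod_ne_zero_iff.mpr (fun m hm => ?_) h1.eq_zero
  have := mem_range.mp hm
  exact inv_ne_zero (mul_sub_ne_zero_zmod hu hn.le (by omega) (by omega))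

lemma prod_range_natCast_zmod : ∏ m ∈ range (q - 1), ((m + 1 : ℕ) : ZMod q) = -1 := by
  rw [← Nat.cast_prod, prod_range_add_one_eq_factorial, ZMod.wilsons_lemma]

/-- The total is `2` modulo the uniformizer: the unit-step path and the single step of length `q`
contribute `1` each. -/
lemma transmission_ne_zero_self {u : ZMod q} (hu : u ≠ 0) (hq : 2 < q) :
    transmission (ratio u q) q ≠ 0 := by
  intro h
  have hp : q.Prime := Fact.out
  have h0 : 0 < q := hp.pos
  have hodd : Even (q - 1) := hp.even_sub_one (by omega)
  set π : ℂ := ZMod.stdAddChar (1 : ZMod q) - 1 with hπ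
  have hprim := isPrimitiveRoot_stdAddChar_one (q := q)
  -- The term `k = 0` is set apart because `q!` is not invertible modulo `q`. The others give `∏ (u
  -- m²)⁻¹ = 1` by Fermat and Wilson.
  have h1 : HasResidue (π ^ (q - 1) * ∑ k ∈ (range q).erase 0,
      ladder (ratio u q) k / ((q - k).factorial : ℂ)) (1 : ZMod q) := by
    have h2 := HasResidue.sum_ladder (u := u) (n := q) h0 _
      (fun k hk => hasResidue_ladder hu le_rfl hk) ((range q).erase 0) (erase_subset _ _)
      (by simp; omega) (fun k hk => factorial_ne_zero_zmod (by simp at hk; omega))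
    convert h2 using 1
    have h3 : ∀ m ∈ range (q - 1),
        (u * (((m + 1 : ℕ) : ZMod q) * (((m + 1 : ℕ) : ZMod q) - (q : ZMod q))))⁻¹ =
        u⁻¹ * ((((m + 1 : ℕ) : ZMod q)) ^ 2)⁻¹ := by
      intro m _
      rw [ZMod.natCast_self, sub_zero, mul_inv, sq]
    rw [prod_congr rfl h3, prod_mul_distrib, prod_const, prod_inv_distrib, prod_pow,
      prod_range_natCast_zmod, card_range, ZMod.pow_card_sub_one_eq_one (inv_ne_zero hu)]
    simp
  -- The single hop contributes `1 / q!`. Since `q = ∏ (ζ^m - 1)`, its pole also has order `q - 1`.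
  -- Its residue is `1 / ((q-1)!)² = 1` by Wilson.
  have h4 : HasResidue (π ^ (q - 1) * (ladder (ratio u q) 0 / ((q - 0).factorial : ℂ)))
      (1 : ZMod q) := by
    have hprod : (q : ℂ) = ∏ m ∈ range (q - 1), (ZMod.stdAddChar ((m + 1 : ℕ) : ZMod q) - 1) := by
      obtain ⟨n, hn⟩ : ∃ n, q = n + 1 := ⟨q - 1, by omega⟩
      have hprim' : IsPrimitiveRoot (ZMod.stdAddChar (1 : ZMod q)) (n + 1) := by
        rw [← hn]; exact hprim
      have h5 := hprim'.prod_one_sub_pow_eq_order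
      have h6 : (q : ℂ) = ∏ m ∈ range (q - 1), (1 - ZMod.stdAddChar (1 : ZMod q) ^ (m + 1)) := by
        rw [show q - 1 = n by omega, h5, hn]; push_cast; ring
      rw [h6]
      have h7 : ∀ m ∈ range (q - 1), (ZMod.stdAddChar ((m + 1 : ℕ) : ZMod q) - 1) =
          -1 * (1 - ZMod.stdAddChar (1 : ZMod q) ^ (m + 1)) := by
        intro m _
        rw [← stdAddChar_eq_pow, one_mul]; ring
      rw [prod_congr rfl h7, prod_mul_distrib, prod_const, card_range, hodd.neg_one_pow, one_mul]
    have h6 : π ^ (q - 1) * (ladder (ratio u q) 0 / ((q - 0).factorial : ℂ)) =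
        (∏ m ∈ range (q - 1), (π * (ZMod.stdAddChar ((m + 1 : ℕ) : ZMod q) - 1)⁻¹)) *
        ((q - 1).factorial : ℂ)⁻¹ := by
      rw [prod_mul_distrib, prod_inv_distrib, ← hprod, prod_const, card_range, ladder_zero,
        Nat.sub_zero, ← Nat.mul_factorial_pred h0.ne']
      push_cast
      rw [one_div, mul_inv]
      ring
    rw [h6]
    have h7 := (HasResidue.prod (range (q - 1)) fun m hm =>
      HasResidue.uniformizer_mul_inv (natCast_ne_zero_zmod (q := q) (k := m + 1) (by omega)
        (by have := mem_range.mp hm; omega))).mul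
      (HasResidue.natCast_inv (q := q) (factorial_ne_zero_zmod (k := q - 1) (by omega)))
    convert h7 using 1
    rw [prod_inv_distrib, prod_range_natCast_zmod, ZMod.wilsons_lemma]
    simp
  have h8 := h1.add h4
  rw [← mul_add, sum_erase_add _ _ (mem_range.mpr h0), ← transmission, h, mul_zero] at h8
  have h9 : ((2 : ℕ) : ZMod q) = 0 := by
    have := h8.eq_zero
    rw [one_add_one_eq_two] at this
    exact_mod_cast this
  exact natCast_ne_zero_zmod (q := q) (k := 2) (by norm_num) hq h9

lemma transmission_ne_zero {u : ZMod q} (hu : u ≠ 0) (hq : 2 < q) {n : ℕ} (h0 : 0 < n)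
    (hn : n ≤ q) : transmission (ratio u n) n ≠ 0 := by
  rcases hn.lt_or_eq with h | rfl
  · exact transmission_ne_zero_of_lt hu h0 h
  · exact transmission_ne_zero_self hu hq

end Reduction

end KickedRotor

/-! ### Majorants for the ladder, and the truncated logarithm on the unit circle. -/

namespace KickedRotor

open Finset ZMod

/-- Induction step for `norm_ladder_le`. A hop over several rungs omits factors `‖R - 1‖⁻¹`; as `‖R
- 1‖ ≤ 2`, reinstating each costs at most 2. The base `2 / log 3` is chosen so that the hops then
sum to `∑ (log 3)^k / k!` over `k ≥ 1`, which is at most `e^(log 3) - 1 = 2`, and the bound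
reproduces itself. -/
lemma norm_transmission_le_of_norm_ladder_le {R : ℕ → ℂ} {l : ℕ} (h0 : 0 < l)
    (hR : ∀ m, 0 < m → m < l → R m ≠ 1) (hR' : ∀ m, ‖R m‖ ≤ 1)
    (h : ∀ k < l, ‖ladder R k‖ ≤
      (2 / Real.log 3) ^ k * ∏ m ∈ range k, ‖R (m + 1) - 1‖⁻¹) :
    ‖transmission R l‖ ≤
      (2 / Real.log 3) ^ l * ∏ m ∈ range (l - 1), ‖R (m + 1) - 1‖⁻¹ := by
  have hlog : 0 < Real.log 3 := Real.log_pos (by norm_num)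
  have hstep : ∀ k < l, ∏ m ∈ range k, ‖R (m + 1) - 1‖⁻¹ ≤
      2 ^ (l - 1 - k) * ∏ m ∈ range (l - 1), ‖R (m + 1) - 1‖⁻¹ := by
    intro k hk
    have h1 : ∏ m ∈ range (l - 1), ‖R (m + 1) - 1‖⁻¹ = (∏ m ∈ range k, ‖R (m + 1) - 1‖⁻¹) *
        ∏ m ∈ Ico k (l - 1), ‖R (m + 1) - 1‖⁻¹ :=
      (prod_range_mul_prod_Ico _ (by omega)).symm
    have h2 : ((2 : ℝ)⁻¹) ^ (l - 1 - k) ≤ ∏ m ∈ Ico k (l - 1), ‖R (m + 1) - 1‖⁻¹ := by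
      rw [← Nat.card_Ico, ← prod_const]
      refine prod_le_prod (fun _ _ => by norm_num) fun m hm => ?_
      rw [mem_Ico] at hm
      have h3 : 0 < ‖R (m + 1) - 1‖ :=
        norm_pos_iff.mpr (sub_ne_zero.mpr (hR _ (by omega) (by omega)))
      refine inv_anti₀ h3 ?_
      calc ‖R (m + 1) - 1‖ ≤ ‖R (m + 1)‖ + ‖(1 : ℂ)‖ := norm_sub_le _ _
        _ ≤ 2 := by rw [norm_one]; linarith [hR' (m + 1)]
    have h4 : 0 ≤ ∏ m ∈ range k, ‖R (m + 1) - 1‖⁻¹ :=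
      prod_nonneg fun _ _ => inv_nonneg.mpr (norm_nonneg _)
    rw [h1]
    calc ∏ m ∈ range k, ‖R (m + 1) - 1‖⁻¹
        = 2 ^ (l - 1 - k) * ((∏ m ∈ range k, ‖R (m + 1) - 1‖⁻¹) * (2 : ℝ)⁻¹ ^ (l - 1 - k)) := by
          rw [inv_pow]; field_simp
      _ ≤ _ := by gcongr
  set Q : ℝ := ∏ m ∈ range (l - 1), ‖R (m + 1) - 1‖⁻¹ with hQ
  have hQ0 : 0 ≤ Q := prod_nonneg fun _ _ => inv_nonneg.mpr (norm_nonneg _)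
  have hterm : ∀ k ∈ range l, ‖ladder R k / ((l - k).factorial : ℂ)‖ ≤
      (2 / Real.log 3) ^ l * Q / 2 * (Real.log 3 ^ (l - k) / (l - k).factorial) := by
    intro k hk
    have hk := mem_range.mp hk
    rw [norm_div, Complex.norm_natCast]
    have h5 : (2 / Real.log 3) ^ l = (2 / Real.log 3) ^ k * (2 / Real.log 3) ^ (l - k) := by
      rw [← pow_add]; congr 1; omega
    have h6 : (2 : ℝ) ^ (l - k) = 2 ^ (l - 1 - k) * 2 := by
      rw [← pow_succ]; congr 1; omega
    calc ‖ladder R k‖ / (l - k).factorial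
        ≤ ((2 / Real.log 3) ^ k * (2 ^ (l - 1 - k) * Q)) / (l - k).factorial := by
          gcongr
          exact (h k hk).trans (by gcongr; exact hstep k hk)
      _ = _ := by
          rw [h5, div_pow 2 _ (l - k), h6]
          field_simp
  calc ‖transmission R l‖ ≤ ∑ k ∈ range l, ‖ladder R k / ((l - k).factorial : ℂ)‖ :=
        norm_sum_le _ _
    _ ≤ ∑ k ∈ range l, (2 / Real.log 3) ^ l * Q / 2 *
        (Real.log 3 ^ (l - k) / (l - k).factorial) := sum_le_sum hterm
    _ = (2 / Real.log 3) ^ l * Q / 2 *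
        ∑ k ∈ range l, (Real.log 3 ^ (l - k) / (l - k).factorial) := by rw [mul_sum]
    _ ≤ (2 / Real.log 3) ^ l * Q / 2 * 2 := by
        gcongr
        -- Dropping the zeroth term from the series of `exp (log 3) = 3` leaves at most 2.
        have h7 := Real.sum_le_exp_of_nonneg hlog.le (l + 1)
        rw [Real.exp_log (by norm_num), sum_range_succ'] at h7
        have h8 := sum_range_reflect (fun k => Real.log 3 ^ (k + 1) / ((k + 1).factorial : ℝ)) l
        have h9 : ∀ k ∈ range l, Real.log 3 ^ (l - k) / ((l - k).factorial : ℝ) =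
            Real.log 3 ^ (l - 1 - k + 1) / ((l - 1 - k + 1).factorial : ℝ) := by
          intro k hk
          have := mem_range.mp hk
          rw [show l - 1 - k + 1 = l - k by omega]
        rw [sum_congr rfl h9, h8]
        simp at h7
        linarith
    _ = _ := by ring

lemma norm_ladder_le {R : ℕ → ℂ} {n : ℕ} (hR : ∀ m, 0 < m → m < n → R m ≠ 1)
    (hR' : ∀ m, ‖R m‖ ≤ 1) {l : ℕ} (hl : l < n) :
    ‖ladder R l‖ ≤ (2 / Real.log 3) ^ l * ∏ m ∈ range l, ‖R (m + 1) - 1‖⁻¹ := by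
  induction l using Nat.strong_induction_on with
  | _ l ih =>
    rcases Nat.eq_zero_or_pos l with rfl | h0
    · simp [ladder_zero]
    have h1 := norm_transmission_le_of_norm_ladder_le h0
      (fun m hm hml => hR m hm (hml.trans hl)) hR' (fun k hk => ih k hk (hk.trans hl))
    obtain ⟨l, rfl⟩ : ∃ k, l = k + 1 := ⟨l - 1, by omega⟩
    rw [ladder_of_pos _ h0, norm_mul, norm_inv, prod_range_succ]
    calc ‖R (l + 1) - 1‖⁻¹ * ‖transmission R (l + 1)‖
        ≤ ‖R (l + 1) - 1‖⁻¹ * ((2 / Real.log 3) ^ (l + 1) *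
          ∏ m ∈ range (l + 1 - 1), ‖R (m + 1) - 1‖⁻¹) := by gcongr
      _ = _ := by rw [Nat.add_sub_cancel]; ring

lemma norm_transmission_le {R : ℕ → ℂ} {n : ℕ} (h0 : 0 < n)
    (hR : ∀ m, 0 < m → m < n → R m ≠ 1) (hR' : ∀ m, ‖R m‖ ≤ 1) :
    ‖transmission R n‖ ≤
      (2 / Real.log 3) ^ n * ∏ m ∈ range (n - 1), ‖R (m + 1) - 1‖⁻¹ :=
  norm_transmission_le_of_norm_ladder_le h0 hR hR' fun _ hk => norm_ladder_le hR hR' hk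

/-- Keeps the segment from 1 to `1 - z` in the right half-plane, where `Complex.log` is
differentiable. -/
lemma re_one_sub_mul_pos {z : ℂ} (hz : ‖z‖ = 1) (hz1 : z ≠ 1) {t : ℝ} (ht : t ∈ Set.Icc (0 : ℝ) 1) :
    0 < (1 - t * z).re := by
  have h1 : z.re ≤ 1 := hz ▸ Complex.re_le_norm z
  have h2 : z.re ≠ 1 := by
    intro h
    refine hz1 (Complex.ext h ?_)
    have h3 := Complex.sq_norm z
    rw [Complex.normSq_apply, hz, h] at h3
    simp only [Complex.one_im]
    nlinarith
  have h3 : z.re < 1 := lt_of_le_of_ne h1 h2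
  simp only [Complex.sub_re, Complex.one_re, Complex.mul_re, Complex.ofReal_re,
    Complex.ofReal_im, zero_mul, sub_zero]
  rcases ht.1.eq_or_lt with rfl | h4
  · simp
  · nlinarith [ht.2, mul_pos h4 (sub_pos.mpr h3)]

/-- Controls the denominator along the radius: `1 - z = (1 - tz) - (1 - t)z`, and `1 - t ≤ ‖1 -
tz‖`. -/
lemma norm_one_sub_le_two_mul {z : ℂ} (hz : ‖z‖ = 1) {t : ℝ} (ht : t ∈ Set.Icc (0 : ℝ) 1) :
    ‖1 - z‖ ≤ 2 * ‖1 - t * z‖ := by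
  have h1 : ‖1 - z‖ ≤ ‖1 - t * z‖ + ‖((1 - t : ℝ) : ℂ) * z‖ := by
    rw [show 1 - z = (1 - t * z) - ((1 - t : ℝ) : ℂ) * z by push_cast; ring]
    exact norm_sub_le _ _
  have h2 : 1 - t ≤ ‖1 - t * z‖ := by
    have h3 := norm_sub_norm_le (1 : ℂ) (t * z)
    rwa [norm_one, norm_mul, hz, mul_one, Complex.norm_real, Real.norm_of_nonneg ht.1] at h3
  rw [norm_mul, hz, mul_one, Complex.norm_real, Real.norm_of_nonneg (by linarith [ht.2])] at h1
  linarith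

/-- Truncation of the Fourier series of `log |1 - z|` on the unit circle. -/
lemma neg_log_norm_one_sub_le {z : ℂ} (hz : ‖z‖ = 1) (hz1 : z ≠ 1) (H : ℕ) :
    -Real.log ‖1 - z‖ ≤ (∑ h ∈ range H, z ^ (h + 1) / ((h + 1 : ℕ) : ℂ)).re +
      2 / ((H + 1 : ℕ) * ‖1 - z‖) := by
  -- `f` is the remainder of the series of `-log (1 - tz)` along the radius. Its derivative `f'` is
  -- at most `2 t^H / ‖1 - z‖`, which has the primitive `B`.
  set f : ℝ → ℂ := fun t => -Complex.log (1 - t * z) -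
    ∑ h ∈ range H, (t * z) ^ (h + 1) / ((h + 1 : ℕ) : ℂ) with hf
  set f' : ℝ → ℂ := fun t => z * (t * z) ^ H / (1 - t * z) with hf'
  set B : ℝ → ℝ := fun t => 2 / ((H + 1 : ℕ) * ‖1 - z‖) * t ^ (H + 1) with hB
  have hpos : 0 < ‖1 - z‖ := norm_pos_iff.mpr (sub_ne_zero.mpr (Ne.symm hz1))
  have hderiv : ∀ t ∈ Set.Icc (0 : ℝ) 1, HasDerivAt f (f' t) t := by
    intro t ht
    have hre := re_one_sub_mul_pos hz hz1 ht
    have hne : 1 - t * z ≠ 0 := fun h => by simp [h] at hre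
    have h1 : HasDerivAt (fun t : ℝ => (t : ℂ) * z) z t := by
      simpa using (Complex.ofRealCLM.hasDerivAt (x := t)).mul_const z
    have h2 : HasDerivAt (fun t : ℝ => Complex.log (1 - t * z)) (-z / (1 - t * z)) t :=
      (h1.const_sub 1).clog_real (Or.inl hre)
    have h3 : HasDerivAt (fun t : ℝ => ∑ h ∈ range H, ((t : ℂ) * z) ^ (h + 1) / ((h + 1 : ℕ) : ℂ))
        (∑ h ∈ range H, ((t : ℂ) * z) ^ h * z) t := by
      refine HasDerivAt.fun_sum fun h _ => ?_
      have h4 := (h1.pow (h + 1)).div_const ((h + 1 : ℕ) : ℂ)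
      refine h4.congr_deriv ?_
      have : ((h + 1 : ℕ) : ℂ) ≠ 0 := Nat.cast_ne_zero.mpr (Nat.succ_ne_zero h)
      rw [Nat.add_sub_cancel, mul_assoc, mul_div_cancel_left₀ _ this]
    refine (h2.neg.sub h3).congr_deriv ?_
    rw [← sum_mul]
    have h5 := mul_neg_geom_sum ((t : ℂ) * z) H
    simp only [hf']
    generalize ∑ i ∈ range H, ((t : ℂ) * z) ^ i = G at h5 ⊢
    rw [eq_div_iff hne, sub_mul, neg_div, neg_neg, div_mul_cancel₀ _ hne]
    linear_combination (-z) * h5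
  have h0 : ‖f 0‖ ≤ B 0 := by simp [hf, hB]
  have hB' : ∀ t, HasDerivAt B (2 / ‖1 - z‖ * t ^ H) t := by
    intro t
    have h1 := ((hasDerivAt_id t).pow (H + 1)).const_mul (2 / ((H + 1 : ℕ) * ‖1 - z‖))
    refine h1.congr_deriv ?_
    have : ((H + 1 : ℕ) : ℝ) ≠ 0 := Nat.cast_ne_zero.mpr (Nat.succ_ne_zero H)
    rw [Nat.add_sub_cancel, id, mul_one]
    field_simp
  have hmain := image_norm_le_of_norm_deriv_right_le_deriv_boundary (f := f) (f' := f')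
    (B := B) (a := 0) (b := 1)
    (fun t ht => (hderiv t ht).continuousAt.continuousWithinAt)
    (fun t ht => (hderiv t ⟨ht.1, ht.2.le⟩).hasDerivWithinAt) h0 hB'
    (fun t ht => by
      have ht' : t ∈ Set.Icc (0 : ℝ) 1 := ⟨ht.1, ht.2.le⟩
      have h1 := norm_one_sub_le_two_mul hz ht'
      have h2 : 0 < ‖1 - t * z‖ := by linarith
      rw [hf', norm_div, norm_mul, norm_pow, norm_mul, hz, Complex.norm_real,
        Real.norm_of_nonneg ht.1, one_mul, mul_one, div_le_iff₀ h2]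
      have h3 : 0 ≤ t ^ H := pow_nonneg ht.1 _
      rw [div_mul_eq_mul_div, div_mul_eq_mul_div, le_div_iff₀ hpos]
      nlinarith)
    (Set.right_mem_Icc.mpr zero_le_one)
  have h1 := (Complex.re_le_norm (f 1)).trans hmain
  simp only [hf, hB, Complex.ofReal_one, one_mul, one_pow, mul_one, Complex.sub_re,
    Complex.neg_re, Complex.log_re] at h1
  linarith

/-! ### Weyl sums and the product of small denominators. -/

section Characters

variable {q : ℕ} [Fact q.Prime]

lemma norm_stdAddChar (x : ZMod q) : ‖stdAddChar x‖ = 1 := by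
  rw [stdAddChar_apply, Circle.norm_coe]

/-- The chord has length `2 sin(πk/q)`, and Jordan's inequality applies because `k ≤ q/2`. -/
lemma le_norm_one_sub_stdAddChar {k : ℕ} (hk : 2 * k ≤ q) :
    4 * (k : ℝ) / q ≤ ‖1 - stdAddChar (k : ZMod q)‖ := by
  have hq : (0 : ℝ) < q := Nat.cast_pos.mpr (Fact.out : q.Prime).pos
  have h1 : stdAddChar (k : ZMod q) = Complex.exp (Complex.I * ((2 * Real.pi * k / q : ℝ) : ℂ)) := by
    have := stdAddChar_coe (N := q) k
    rw [Int.cast_natCast, Int.cast_natCast] at this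
    rw [this]; congr 1; push_cast; ring
  rw [h1, norm_sub_rev, Complex.norm_exp_I_mul_ofReal_sub_one]
  have hk' : (k : ℝ) ≤ q / 2 := by
    rw [le_div_iff₀ two_pos]; exact_mod_cast (by omega : k * 2 ≤ q)
  have h2 : 2 / Real.pi * (2 * Real.pi * k / q / 2) ≤ Real.sin (2 * Real.pi * k / q / 2) := by
    refine Real.mul_le_sin (by positivity) ?_
    rw [div_le_div_iff_of_pos_right two_pos, div_le_iff₀ hq]
    nlinarith [Real.pi_pos]
  have h3 : 2 / Real.pi * (2 * Real.pi * k / q / 2) = 2 * k / q := by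
    field_simp
  rw [h3] at h2
  rw [norm_mul, Real.norm_of_nonneg zero_le_two, Real.norm_eq_abs]
  calc 4 * (k : ℝ) / q = 2 * (2 * k / q) := by ring
    _ ≤ _ := by gcongr; exact h2.trans (le_abs_self _)

lemma inv_norm_one_sub_stdAddChar_le {k : ℕ} (h0 : 0 < k) (hk : k < q) :
    ‖1 - stdAddChar (k : ZMod q)‖⁻¹ ≤ q / 4 * ((k : ℝ)⁻¹ + ((q - k : ℕ) : ℝ)⁻¹) := by
  have hq : (0 : ℝ) < q := Nat.cast_pos.mpr (Fact.out : q.Prime).pos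
  have key : ∀ m : ℕ, 0 < m → 2 * m ≤ q → ‖1 - stdAddChar (m : ZMod q)‖⁻¹ ≤ q / 4 * (m : ℝ)⁻¹ := by
    intro m hm hmq
    have hm' : (0 : ℝ) < m := Nat.cast_pos.mpr hm
    have := inv_anti₀ (by positivity) (le_norm_one_sub_stdAddChar hmq)
    refine this.trans (le_of_eq ?_)
    field_simp
  rcases le_total (2 * k) q with h | h
  · refine (key k h0 h).trans ?_
    gcongr
    exact le_add_of_nonneg_right (by positivity)
  · have h1 : ‖1 - stdAddChar (k : ZMod q)‖ = ‖1 - stdAddChar ((q - k : ℕ) : ZMod q)‖ := by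
      rw [Nat.cast_sub hk.le, ZMod.natCast_self, zero_sub, AddChar.map_neg_eq_inv]
      have hn := norm_stdAddChar (k : ZMod q)
      have hne : stdAddChar (k : ZMod q) ≠ 0 := norm_ne_zero_iff.mp (by rw [hn]; exact one_ne_zero)
      rw [show 1 - (stdAddChar (k : ZMod q))⁻¹ =
        -((1 - stdAddChar (k : ZMod q)) * (stdAddChar (k : ZMod q))⁻¹) by field_simp; ring,
        norm_neg, norm_mul, norm_inv, hn, inv_one, mul_one]
    rw [h1]
    refine (key (q - k) (by omega) (by omega)).trans ?_
    gcongr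
    exact le_add_of_nonneg_left (by positivity)

lemma sum_inv_norm_one_sub_stdAddChar_le :
    ∑ x ∈ univ.erase (0 : ZMod q), ‖1 - stdAddChar x‖⁻¹ ≤ q / 2 * (1 + Real.log q) := by
  have hq := (Fact.out : q.Prime).pos
  have h1 : ∑ x ∈ univ.erase (0 : ZMod q), ‖1 - stdAddChar x‖⁻¹ =
      ∑ k ∈ range (q - 1), ‖1 - stdAddChar ((k + 1 : ℕ) : ZMod q)‖⁻¹ := by
    refine sum_nbij' (fun x => x.val - 1) (fun k => ((k + 1 : ℕ) : ZMod q)) ?_ ?_ ?_ ?_ ?_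
    · intro x hx
      have := x.val_lt
      have : x.val ≠ 0 := by simpa using hx
      simp; omega
    · intro k hk
      have := mem_range.mp hk
      simpa using natCast_ne_zero_zmod (q := q) (k := k + 1) (by omega) (by omega)
    · intro x hx
      have : x.val ≠ 0 := by simpa using hx
      rw [show x.val - 1 + 1 = x.val by omega, ZMod.natCast_zmod_val]
    · intro k hk
      have := mem_range.mp hk
      rw [ZMod.val_natCast_of_lt (by omega)]; omega
    · intro x hx
      have : x.val ≠ 0 := by simpa using hx
      rw [show x.val - 1 + 1 = x.val by omega, ZMod.natCast_zmod_val]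
  have hharm : ∑ k ∈ range (q - 1), ((k + 1 : ℕ) : ℝ)⁻¹ ≤ 1 + Real.log q := by
    have h2 := harmonic_le_one_add_log (q - 1)
    rw [harmonic] at h2
    push_cast at h2 ⊢
    refine h2.trans ?_
    rcases Nat.eq_zero_or_pos (q - 1) with h | h
    · rw [h]; simp; exact Real.log_natCast_nonneg q
    · gcongr
      exact_mod_cast Nat.sub_le q 1
  rw [h1]
  calc _ ≤ ∑ k ∈ range (q - 1), (q : ℝ) / 4 *
        (((k + 1 : ℕ) : ℝ)⁻¹ + ((q - (k + 1) : ℕ) : ℝ)⁻¹) :=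
        sum_le_sum fun k hk => inv_norm_one_sub_stdAddChar_le (by omega)
          (by have := mem_range.mp hk; omega)
    _ = (q : ℝ) / 4 * (∑ k ∈ range (q - 1), ((k + 1 : ℕ) : ℝ)⁻¹ +
        ∑ k ∈ range (q - 1), ((k + 1 : ℕ) : ℝ)⁻¹) := by
        rw [← mul_sum, sum_add_distrib]
        congr 2
        rw [← sum_range_reflect (fun k => ((k + 1 : ℕ) : ℝ)⁻¹)]
        refine sum_congr rfl fun k hk => ?_
        have := mem_range.mp hk
        rw [show q - (k + 1) = q - 1 - 1 - k + 1 by omega]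
    _ ≤ (q : ℝ) / 4 * ((1 + Real.log q) + (1 + Real.log q)) := by gcongr
    _ = _ := by ring

lemma sum_inv_norm_le_of_injOn {ι : Type*} (s : Finset ι) (f : ι → ZMod q)
    (hf : Set.InjOn f s) (h0 : ∀ i ∈ s, f i ≠ 0) :
    ∑ i ∈ s, ‖1 - stdAddChar (f i)‖⁻¹ ≤ q / 2 * (1 + Real.log q) := by
  classical
  rw [← sum_image (f := fun x => ‖1 - stdAddChar x‖⁻¹) hf]
  refine (sum_le_sum_of_subset_of_nonneg (fun x hx => ?_) fun _ _ _ => by positivity).trans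
    sum_inv_norm_one_sub_stdAddChar_le
  obtain ⟨i, hi, rfl⟩ := mem_image.mp hx
  exact mem_erase.mpr ⟨h0 i hi, mem_univ _⟩

lemma norm_geom_sum_le {w : ℂ} (hw : ‖w‖ = 1) (hw1 : w ≠ 1) (M : ℕ) :
    ‖∑ i ∈ range M, w ^ i‖ ≤ 2 * ‖1 - w‖⁻¹ := by
  rw [geom_sum_eq hw1, norm_div, norm_sub_rev w 1, div_eq_mul_inv]
  gcongr
  calc ‖w ^ M - 1‖ ≤ ‖w ^ M‖ + ‖(1 : ℂ)‖ := norm_sub_le _ _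
    _ = 2 := by rw [norm_pow, hw, one_pow, norm_one]; norm_num

/-- Weyl differencing: the off-diagonal pairs of the squared sum are grouped by their difference `k
+ 1`. -/
lemma norm_sq_sum_le (f : ℕ → ℂ) (hf : ∀ l, ‖f l‖ = 1) (N : ℕ) :
    ‖∑ l ∈ range N, f l‖ ^ 2 ≤ N + 2 * ∑ k ∈ range N,
      ‖∑ m ∈ range (N - 1 - k), f (m + (k + 1)) * (starRingEnd ℂ) (f m)‖ := by
  have h1 : ∀ N : ℕ, ‖∑ l ∈ range N, f l‖ ^ 2 =
      N + 2 * (∑ l ∈ range N, ∑ m ∈ range l, f l * (starRingEnd ℂ) (f m)).re := by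
    intro N
    induction N with
    | zero => simp
    | succ N ih =>
      rw [sum_range_succ, sum_range_succ, Complex.add_re, mul_add, ← add_assoc]
      have h2 : ‖∑ l ∈ range N, f l + f N‖ ^ 2 = ‖∑ l ∈ range N, f l‖ ^ 2 + ‖f N‖ ^ 2 +
          2 * (f N * (starRingEnd ℂ) (∑ l ∈ range N, f l)).re := by
        rw [Complex.sq_norm, Complex.sq_norm, Complex.sq_norm, Complex.normSq_add]
        congr 2
        simp only [Complex.mul_re, Complex.conj_re, Complex.conj_im]
        ring
      rw [h2, ih, hf, map_sum, mul_sum]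
      push_cast
      ring
  have h3 : ∑ l ∈ range N, ∑ m ∈ range l, f l * (starRingEnd ℂ) (f m) =
      ∑ k ∈ range N, ∑ m ∈ range (N - 1 - k), f (m + (k + 1)) * (starRingEnd ℂ) (f m) := by
    rw [sum_sigma', sum_sigma']
    refine sum_nbij' (fun x => ⟨x.1 - x.2 - 1, x.2⟩) (fun x => ⟨x.2 + (x.1 + 1), x.2⟩)
      ?_ ?_ ?_ ?_ ?_
    · rintro ⟨a, b⟩ h; simp at h ⊢; omega
    · rintro ⟨a, b⟩ h; simp at h ⊢; omega
    · rintro ⟨a, b⟩ h; simp at h ⊢; omega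
    · rintro ⟨a, b⟩ h; simp at h ⊢
    · rintro ⟨a, b⟩ h
      have h' : b < a := by simp at h; omega
      simp only
      rw [show b + (a - b - 1 + 1) = a by omega]
  rw [h1, h3]
  gcongr
  exact (Complex.re_le_norm _).trans (norm_sum_le _ _)

/-- Weyl's bound for incomplete quadratic exponential sums. -/
lemma norm_sq_quadratic_sum_le (hq : 2 < q) {v b c : ZMod q} (hv : v ≠ 0) {N : ℕ} (hN : N ≤ q) :
    ‖∑ l ∈ range N, stdAddChar (v * (l : ZMod q) ^ 2 + b * (l : ZMod q) + c)‖ ^ 2 ≤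
      q + 2 * q * (1 + Real.log q) := by
  refine (norm_sq_sum_le _ (fun l => norm_stdAddChar _) N).trans ?_
  have h2 : ((2 : ℕ) : ZMod q) ≠ 0 := natCast_ne_zero_zmod (by norm_num) hq
  have hinner : ∀ k ∈ range (N - 1), ‖∑ m ∈ range (N - 1 - k),
      stdAddChar (v * ((m + (k + 1) : ℕ) : ZMod q) ^ 2 + b * ((m + (k + 1) : ℕ) : ZMod q) + c) *
      (starRingEnd ℂ) (stdAddChar (v * (m : ZMod q) ^ 2 + b * (m : ZMod q) + c))‖ ≤
      2 * ‖1 - stdAddChar (((2 : ℕ) : ZMod q) * v * ((k + 1 : ℕ) : ZMod q))‖⁻¹ := by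
    intro k hk
    have hk := mem_range.mp hk
    have hne : ((2 : ℕ) : ZMod q) * v * ((k + 1 : ℕ) : ZMod q) ≠ 0 :=
      mul_ne_zero (mul_ne_zero h2 hv) (natCast_ne_zero_zmod (by omega) (by omega))
    -- Differencing a quadratic phase leaves a geometric progression of ratio `e(2v(k+1))`.
    have h3 : ∀ m ∈ range (N - 1 - k),
        stdAddChar (v * ((m + (k + 1) : ℕ) : ZMod q) ^ 2 + b * ((m + (k + 1) : ℕ) : ZMod q) + c) *
        (starRingEnd ℂ) (stdAddChar (v * (m : ZMod q) ^ 2 + b * (m : ZMod q) + c)) =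
        stdAddChar (v * ((k + 1 : ℕ) : ZMod q) ^ 2 + b * ((k + 1 : ℕ) : ZMod q)) *
        stdAddChar (((2 : ℕ) : ZMod q) * v * ((k + 1 : ℕ) : ZMod q)) ^ m := by
      intro m _
      rw [← AddChar.map_neg_eq_conj, ← stdAddChar_eq_pow, ← AddChar.map_add_eq_mul,
        ← AddChar.map_add_eq_mul]
      congr 1
      push_cast; ring
    rw [sum_congr rfl h3, ← mul_sum, norm_mul, norm_stdAddChar, one_mul]
    exact norm_geom_sum_le (norm_stdAddChar _) (stdAddChar_ne_one hne) _
  have h4 : ∑ k ∈ range N, ‖∑ m ∈ range (N - 1 - k),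
      stdAddChar (v * ((m + (k + 1) : ℕ) : ZMod q) ^ 2 + b * ((m + (k + 1) : ℕ) : ZMod q) + c) *
      (starRingEnd ℂ) (stdAddChar (v * (m : ZMod q) ^ 2 + b * (m : ZMod q) + c))‖ ≤
      q * (1 + Real.log q) := by
    rcases Nat.eq_zero_or_pos N with rfl | hN0
    · have := Real.log_natCast_nonneg q
      simp; positivity
    -- The last difference `N` could be `q`, hence zero modulo `q`, but its inner sum is empty.
    rw [show range N = range (N - 1 + 1) by rw [Nat.sub_add_cancel hN0], sum_range_succ,
      Nat.sub_self]
    simp only [range_zero, sum_empty, norm_zero, add_zero]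
    refine (sum_le_sum hinner).trans ?_
    rw [← mul_sum]
    have h5 := sum_inv_norm_le_of_injOn (q := q) (range (N - 1))
      (fun k => ((2 : ℕ) : ZMod q) * v * ((k + 1 : ℕ) : ZMod q)) ?_ ?_
    · linarith
    · intro x hx y hy hxy
      have hx := mem_range.mp hx
      have hy := mem_range.mp hy
      have h6 := mul_left_cancel₀ (mul_ne_zero h2 hv) hxy
      have h7 := congrArg ZMod.val h6
      rw [ZMod.val_natCast_of_lt (by omega), ZMod.val_natCast_of_lt (by omega)] at h7
      omega
    · intro k hk
      have hk := mem_range.mp hk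
      exact mul_ne_zero (mul_ne_zero h2 hv) (natCast_ne_zero_zmod (by omega) (by omega))
  have h5 : (N : ℝ) ≤ q := Nat.cast_le.mpr hN
  linarith

/-- The exponent `u l (l - n)` is symmetric under `l ↦ n - l` and injective on each half of the
ladder. Each half is thus bounded by the sum over all nonzero residues. -/
lemma sum_inv_norm_ratio_le {u : ZMod q} (hu : u ≠ 0) {n : ℕ} (hn : n ≤ q) :
    ∑ l ∈ range (n - 1), ‖1 - ratio u n (l + 1)‖⁻¹ ≤ q * (1 + Real.log q) := by
  classical
  set f : ℕ → ZMod q := fun l =>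
    u * (((l + 1 : ℕ) : ZMod q) * (((l + 1 : ℕ) : ZMod q) - (n : ZMod q))) with hf
  have hcast : ∀ a b : ℕ, a < b → b < a + q → (a : ZMod q) ≠ b := by
    intro a b hab hba h
    rw [ZMod.natCast_eq_natCast_iff'] at h
    have h1 : q ∣ b - a := (Nat.modEq_iff_dvd' hab.le).mp h
    exact absurd (Nat.le_of_dvd (by omega) h1) (by omega)
  have hinj : ∀ a b : ℕ, a < n - 1 → b < n - 1 → a + b + 2 ≤ n → f a = f b → a ≤ b → a = b ∨ a + b + 2 = n := by
    intro a b ha hb hab h hle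
    by_contra hcon
    push Not at hcon
    have h1 := mul_left_cancel₀ hu h
    have h2 : (((a + 1 : ℕ) : ZMod q) - ((b + 1 : ℕ) : ZMod q)) *
        (((a + b + 2 : ℕ) : ZMod q) - (n : ZMod q)) = 0 := by
      push_cast at h1 ⊢; linear_combination h1
    rcases mul_eq_zero.mp h2 with h3 | h3
    · exact hcast (a + 1) (b + 1) (by omega) (by omega) (sub_eq_zero.mp h3)
    · exact hcast (a + b + 2) n (by omega) (by omega) (sub_eq_zero.mp h3)
  have h0 : ∀ l ∈ range (n - 1), f l ≠ 0 := fun l hl => by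
    have := mem_range.mp hl
    exact mul_sub_ne_zero_zmod hu hn (by omega) (by omega)
  rw [← sum_filter_add_sum_filter_not (range (n - 1)) (fun l => 2 * l + 2 ≤ n)]
  have hA := sum_inv_norm_le_of_injOn (q := q) ((range (n - 1)).filter fun l => 2 * l + 2 ≤ n) f
    (fun x hx y hy hxy => by
      simp only [coe_filter, mem_range, Set.mem_ofPred_eq] at hx hy
      rcases le_total x y with h | h
      · rcases hinj x y hx.1 hy.1 (by omega) hxy h with h | h <;> omega
      · rcases hinj y x hy.1 hx.1 (by omega) hxy.symm h with h | h <;> omega)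
    (fun l hl => h0 l (mem_filter.mp hl).1)
  have hsymm : ∀ l, l < n - 1 → f l = f (n - 2 - l) := by
    intro l hl
    simp only [hf]
    rw [show n - 2 - l + 1 = n - (l + 1) by omega, Nat.cast_sub (by omega)]
    ring
  have hB := sum_inv_norm_le_of_injOn (q := q) ((range (n - 1)).filter fun l => ¬ 2 * l + 2 ≤ n) f
    (fun x hx y hy hxy => by
      simp only [coe_filter, mem_range, Set.mem_ofPred_eq] at hx hy
      rw [hsymm x hx.1, hsymm y hy.1] at hxy
      rcases le_total x y with h | h
      · rcases hinj (n - 2 - y) (n - 2 - x) (by omega) (by omega) (by omega) hxy.symm (by omega)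
          with h | h <;> omega
      · rcases hinj (n - 2 - x) (n - 2 - y) (by omega) (by omega) (by omega) hxy (by omega)
          with h | h <;> omega)
    (fun l hl => h0 l (mem_filter.mp hl).1)
  simp only [ratio]
  simp only [hf] at hA hB
  linarith

/-- The truncated Fourier series of `-log |1 - z|` converts the logarithm of the product into
quadratic exponential sums weighted by `1/h`. The truncation error is paid for by
`sum_inv_norm_ratio_le`. -/
lemma prod_inv_norm_ratio_le (hq : 2 < q) {u : ZMod q} (hu : u ≠ 0) {n : ℕ} (h0 : 0 < n)
    (hn : n ≤ q) :
    ∏ l ∈ range (n - 1), ‖ratio u n (l + 1) - 1‖⁻¹ ≤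
      Real.exp (9 * Real.sqrt (q * Real.log q ^ 3)) := by
  have hq3 : (3 : ℝ) ≤ q := by exact_mod_cast hq
  have hlog : 1 ≤ Real.log q := by
    rw [Real.le_log_iff_exp_le (by linarith)]
    linarith [Real.exp_one_lt_d9]
  have hne : ∀ l ∈ range (n - 1), ratio u n (l + 1) ≠ 1 := fun l hl => by
    have := mem_range.mp hl
    exact ratio_ne_one hu hn (by omega) (by omega)
  have hpos : ∀ l ∈ range (n - 1), 0 < ‖ratio u n (l + 1) - 1‖⁻¹ := fun l hl =>
    inv_pos.mpr (norm_pos_iff.mpr (sub_ne_zero.mpr (hne l hl)))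
  rw [← Real.log_le_iff_le_exp (prod_pos hpos), Real.log_prod (fun l hl => (hpos l hl).ne')]
  set L := Real.log q with hL
  -- Truncation at `q - 1` keeps every frequency `h + 1` prime to `q`, so that the sums stay
  -- genuinely quadratic.
  have hweyl : ∀ h ∈ range (q - 1), ‖∑ l ∈ range (n - 1), ratio u n (l + 1) ^ (h + 1)‖ ≤
      Real.sqrt (5 * q * L) := by
    intro h hh
    have hh := mem_range.mp hh
    refine Real.le_sqrt_of_sq_le ?_
    have hv : u * ((h + 1 : ℕ) : ZMod q) ≠ 0 :=
      mul_ne_zero hu (natCast_ne_zero_zmod (by omega) (by omega))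
    have h1 := norm_sq_quadratic_sum_le hq (b := u * ((h + 1 : ℕ) : ZMod q) * (2 - (n : ZMod q)))
      (c := u * ((h + 1 : ℕ) : ZMod q) * (1 - (n : ZMod q))) hv (N := n - 1) (by omega)
    have h2 : ∀ l ∈ range (n - 1), ratio u n (l + 1) ^ (h + 1) =
        stdAddChar (u * ((h + 1 : ℕ) : ZMod q) * (l : ZMod q) ^ 2 +
          u * ((h + 1 : ℕ) : ZMod q) * (2 - (n : ZMod q)) * (l : ZMod q) +
          u * ((h + 1 : ℕ) : ZMod q) * (1 - (n : ZMod q))) := by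
      intro l _
      rw [ratio, ← stdAddChar_eq_pow]
      congr 1; push_cast; ring
    rw [sum_congr rfl h2]
    refine h1.trans ?_
    nlinarith
  have hterm : ∀ l ∈ range (n - 1), Real.log (‖ratio u n (l + 1) - 1‖⁻¹) ≤
      (∑ h ∈ range (q - 1), ratio u n (l + 1) ^ (h + 1) / ((h + 1 : ℕ) : ℂ)).re +
      2 / q * ‖1 - ratio u n (l + 1)‖⁻¹ := by
    intro l hl
    rw [Real.log_inv, norm_sub_rev]
    refine (neg_log_norm_one_sub_le (z := ratio u n (l + 1)) (norm_stdAddChar _) (hne l hl)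
      (q - 1)).trans (le_of_eq ?_)
    rw [Nat.sub_add_cancel (by omega), div_mul_eq_div_div, div_eq_mul_inv (2 / (q : ℝ))]
  have hharm : ∑ k ∈ range (q - 1), ((k + 1 : ℕ) : ℝ)⁻¹ ≤ 1 + L := by
    have h2 := harmonic_le_one_add_log (q - 1)
    rw [harmonic] at h2
    push_cast at h2 ⊢
    refine h2.trans ?_
    rw [hL]
    gcongr
    · exact_mod_cast (by omega : 0 < q - 1)
    · omega
  have h1 : (∑ l ∈ range (n - 1), ∑ h ∈ range (q - 1),
      ratio u n (l + 1) ^ (h + 1) / ((h + 1 : ℕ) : ℂ)).re ≤ Real.sqrt (5 * q * L) * (1 + L) := by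
    refine (Complex.re_le_norm _).trans ?_
    rw [sum_comm]
    refine (norm_sum_le _ _).trans ?_
    calc _ ≤ ∑ h ∈ range (q - 1), Real.sqrt (5 * q * L) * ((h + 1 : ℕ) : ℝ)⁻¹ := by
          refine sum_le_sum fun h hh => ?_
          rw [← sum_div, norm_div, Complex.norm_natCast, div_eq_mul_inv]
          gcongr
          exact hweyl h hh
      _ ≤ _ := by rw [← mul_sum]; gcongr
  have h2 := sum_inv_norm_ratio_le hu hn
  have h3 : ∑ l ∈ range (n - 1), Real.log (‖ratio u n (l + 1) - 1‖⁻¹) ≤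
      Real.sqrt (5 * q * L) * (1 + L) + 2 * (1 + L) := by
    refine (sum_le_sum hterm).trans ?_
    rw [sum_add_distrib, ← mul_sum, ← Complex.re_sum]
    refine add_le_add h1 ?_
    calc _ ≤ 2 / (q : ℝ) * (q * (1 + L)) := by gcongr
      _ = _ := by field_simp
  refine h3.trans ?_
  have h4 : Real.sqrt (q * L ^ 3) = Real.sqrt (q * L) * L := by
    rw [show (q : ℝ) * L ^ 3 = (q * L) * L ^ 2 by ring, Real.sqrt_mul (by positivity),
      Real.sqrt_sq (by linarith)]
  have h5 : Real.sqrt (5 * q * L) ≤ 5 / 2 * Real.sqrt (q * L) := by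
    rw [Real.sqrt_le_left (by positivity), mul_pow, Real.sq_sqrt (by positivity)]
    nlinarith
  have h6 : 1 ≤ Real.sqrt (q * L) := by
    rw [Real.one_le_sqrt]; nlinarith
  -- With `√5 ≤ 5/2`, `1 + L ≤ 2L` and `1 ≤ √(qL)`, the two terms give `5 + 4 = 9`.
  rw [h4]
  nlinarith [mul_nonneg (Real.sqrt_nonneg (q * L)) (by linarith : (0 : ℝ) ≤ L - 1),
    mul_le_mul_of_nonneg_right h5 (by linarith : (0 : ℝ) ≤ 1 + L),
    mul_le_mul_of_nonneg_right h6 (by linarith : (0 : ℝ) ≤ L)]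

lemma norm_transmission_ratio_le (hq : 2 < q) {u : ZMod q} (hu : u ≠ 0) {n : ℕ} (h0 : 0 < n)
    (hn : n ≤ q) :
    ‖transmission (ratio u n) n‖ ≤
      (2 / Real.log 3) ^ n * Real.exp (9 * Real.sqrt (q * Real.log q ^ 3)) := by
  have hlog : 0 < Real.log 3 := Real.log_pos (by norm_num)
  refine (norm_transmission_le h0 (fun m hm hmn => ratio_ne_one hu hn hm hmn)
    fun m => (norm_stdAddChar _).le).trans ?_
  gcongr
  exact prod_inv_norm_ratio_le hq hu h0 hn

end Characters

end KickedRotor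

/-! ### Dihedral exponential sums and their dependence on the angle. -/

namespace KickedRotor

open Finset ZMod

section ExpSums

variable {q : ℕ} [Fact q.Prime]

/-- The sum of the `q`-th roots of unity with exponents in `J`. -/
noncomputable def charSum (J : Finset (ZMod q)) : ℂ := ∑ j ∈ J, stdAddChar j

/-- The sum of the inverses of the `q`-th roots of unity with exponents in `J`. -/
noncomputable def charSumNeg (J : Finset (ZMod q)) : ℂ := ∑ j ∈ J, stdAddChar (-j)

/-- `i ∑ j ∈ J, cos (ϑ + 2πj/q)`, in exponential form. -/
noncomputable def kick (J : Finset (ZMod q)) (ϑ : ℝ) : ℂ :=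
  Complex.I / 2 * (Complex.exp (ϑ * Complex.I) * charSum J +
    Complex.exp (-(ϑ * Complex.I)) * charSumNeg J)

/-- The derivative of `kick J`. -/
noncomputable def kickDeriv (J : Finset (ZMod q)) (ϑ : ℝ) : ℂ :=
  Complex.I / 2 * (Complex.exp (ϑ * Complex.I) * Complex.I * charSum J -
    Complex.exp (-(ϑ * Complex.I)) * Complex.I * charSumNeg J)

/-- A weighted sum of the exponentials `exp (iμ ∑ j ∈ J, cos (ϑ + 2πj/q))`. -/
noncomputable def kickSum (g : Finset (ZMod q) → ℂ) (ϑ μ : ℝ) : ℂ :=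
  ∑ J, g J * Complex.exp (μ * kick J ϑ)

/-- Invariance of weights under the rotations and the reflection of `ZMod q`. -/
structure IsDihedral (g : Finset (ZMod q) → ℂ) : Prop where
  shift : ∀ J, g ((Equiv.addRight (1 : ZMod q)).finsetCongr J) = g J
  neg : ∀ J, g ((Equiv.neg (ZMod q)).finsetCongr J) = g J

lemma charSum_shift (J : Finset (ZMod q)) :
    charSum ((Equiv.addRight (1 : ZMod q)).finsetCongr J) = stdAddChar (1 : ZMod q) * charSum J := by
  simp [charSum, mul_sum, AddChar.map_add_eq_mul, mul_comm]

lemma charSumNeg_shift (J : Finset (ZMod q)) :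
    charSumNeg ((Equiv.addRight (1 : ZMod q)).finsetCongr J) =
      stdAddChar (-1 : ZMod q) * charSumNeg J := by
  simp [charSumNeg, mul_sum, AddChar.map_add_eq_mul, mul_comm]

lemma charSum_neg (J : Finset (ZMod q)) :
    charSum ((Equiv.neg (ZMod q)).finsetCongr J) = charSumNeg J := by
  simp [charSum, charSumNeg]

lemma charSumNeg_neg (J : Finset (ZMod q)) :
    charSumNeg ((Equiv.neg (ZMod q)).finsetCongr J) = charSum J := by
  simp [charSum, charSumNeg]

lemma hasDerivAt_kick (J : Finset (ZMod q)) (ϑ : ℝ) : HasDerivAt (kick J) (kickDeriv J ϑ) ϑ := by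
  have h1 : HasDerivAt (fun t : ℝ => (t : ℂ) * Complex.I) Complex.I ϑ := by
    simpa using (Complex.ofRealCLM.hasDerivAt (x := ϑ)).mul_const Complex.I
  have h2 := ((h1.cexp.mul_const (charSum J)).add (h1.neg.cexp.mul_const (charSumNeg J))).const_mul
    (Complex.I / 2)
  refine h2.congr_deriv ?_
  rw [kickDeriv]
  simp only [Pi.neg_apply]
  ring

lemma continuous_kick (J : Finset (ZMod q)) : Continuous (kick J) :=
  continuous_iff_continuousAt.mpr fun ϑ => (hasDerivAt_kick J ϑ).continuousAt

lemma norm_charSum_le (J : Finset (ZMod q)) : ‖charSum J‖ ≤ q := by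
  refine (norm_sum_le _ _).trans ?_
  simp only [norm_stdAddChar, sum_const, nsmul_eq_mul, mul_one]
  exact_mod_cast (card_le_univ J).trans (ZMod.card q).le

lemma norm_charSumNeg_le (J : Finset (ZMod q)) : ‖charSumNeg J‖ ≤ q := by
  refine (norm_sum_le _ _).trans ?_
  simp only [norm_stdAddChar, sum_const, nsmul_eq_mul, mul_one]
  exact_mod_cast (card_le_univ J).trans (ZMod.card q).le

lemma norm_exp_neg_ofReal_mul_I (ϑ : ℝ) : ‖Complex.exp (-(ϑ * Complex.I))‖ = 1 := by
  rw [← neg_mul, ← Complex.ofReal_neg, Complex.norm_exp_ofReal_mul_I]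

lemma norm_kick_le (J : Finset (ZMod q)) (ϑ : ℝ) : ‖kick J ϑ‖ ≤ q := by
  rw [kick, norm_mul, norm_div, Complex.norm_I]
  have h := norm_add_le (Complex.exp (ϑ * Complex.I) * charSum J)
    (Complex.exp (-(ϑ * Complex.I)) * charSumNeg J)
  rw [norm_mul, norm_mul, Complex.norm_exp_ofReal_mul_I, norm_exp_neg_ofReal_mul_I, one_mul,
    one_mul] at h
  have := norm_charSum_le J
  have := norm_charSumNeg_le J
  simp only [Complex.norm_ofNat]
  linarith

lemma norm_kickDeriv_le (J : Finset (ZMod q)) (ϑ : ℝ) : ‖kickDeriv J ϑ‖ ≤ q := by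
  rw [kickDeriv, norm_mul, norm_div, Complex.norm_I]
  have h := norm_sub_le (Complex.exp (ϑ * Complex.I) * Complex.I * charSum J)
    (Complex.exp (-(ϑ * Complex.I)) * Complex.I * charSumNeg J)
  rw [norm_mul, norm_mul, norm_mul, norm_mul, Complex.norm_exp_ofReal_mul_I,
    norm_exp_neg_ofReal_mul_I, Complex.norm_I, one_mul, one_mul, one_mul] at h
  have := norm_charSum_le J
  have := norm_charSumNeg_le J
  simp only [Complex.norm_ofNat]
  linarith

/-- Rotating `J` by one site multiplies the moment by `e(k - l)`, which differs from 1. -/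
lemma sum_charSum_mul_shift {g : Finset (ZMod q) → ℂ} (hg : IsDihedral g) {k l : ℕ}
    (h : (k : ZMod q) ≠ (l : ZMod q)) : ∑ J, g J * (charSum J ^ k * charSumNeg J ^ l) = 0 := by
  have h1 : ∑ J, g J * (charSum J ^ k * charSumNeg J ^ l) =
      stdAddChar ((k : ZMod q) - (l : ZMod q)) * ∑ J, g J * (charSum J ^ k * charSumNeg J ^ l) := by
    conv_lhs => rw [← Equiv.sum_comp (Equiv.addRight (1 : ZMod q)).finsetCongr]
    rw [mul_sum]
    refine sum_congr rfl fun J _ => ?_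
    rw [hg.shift, charSum_shift, charSumNeg_shift, mul_pow, mul_pow, ← stdAddChar_eq_pow,
      ← stdAddChar_eq_pow, sub_eq_add_neg, AddChar.map_add_eq_mul, one_mul, neg_one_mul]
    ring
  have h2 : (stdAddChar ((k : ZMod q) - (l : ZMod q)) - 1) *
      ∑ J, g J * (charSum J ^ k * charSumNeg J ^ l) = 0 := by
    rw [sub_mul, ← h1, one_mul, sub_self]
  exact (mul_eq_zero.mp h2).resolve_left (sub_ne_zero.mpr (stdAddChar_ne_one (sub_ne_zero.mpr h)))

lemma sum_charSumNeg_pow {g : Finset (ZMod q) → ℂ} (hg : IsDihedral g) (k : ℕ) :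
    ∑ J, g J * charSumNeg J ^ k = ∑ J, g J * charSum J ^ k := by
  rw [← Equiv.sum_comp (Equiv.neg (ZMod q)).finsetCongr]
  exact sum_congr rfl fun J _ => by rw [hg.neg, charSumNeg_neg]

lemma sum_mul_kick_pow (g : Finset (ZMod q) → ℂ) (n : ℕ) (ϑ : ℝ) :
    ∑ J, g J * kick J ϑ ^ n = (Complex.I / 2) ^ n * ∑ k ∈ range (n + 1),
      Complex.exp (ϑ * Complex.I) ^ k * Complex.exp (-(ϑ * Complex.I)) ^ (n - k) * n.choose k *
        ∑ J, g J * (charSum J ^ k * charSumNeg J ^ (n - k)) := by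
  simp only [mul_sum]
  rw [sum_comm]
  refine sum_congr rfl fun J _ => ?_
  rw [kick, mul_pow, add_pow, mul_sum, mul_sum]
  refine sum_congr rfl fun k _ => ?_
  rw [mul_pow, mul_pow]
  ring

/-- Below order `q`, the moments of the kick do not depend on the quasi-position. -/
lemma sum_mul_kick_pow_of_lt {g : Finset (ZMod q) → ℂ} (hg : IsDihedral g) {n : ℕ}
    (hn : n < q) (ϑ : ℝ) : ∑ J, g J * kick J ϑ ^ n = ∑ J, g J * kick J 0 ^ n := by
  rw [sum_mul_kick_pow, sum_mul_kick_pow]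
  congr 1
  refine sum_congr rfl fun k hk => ?_
  have hk := mem_range.mp hk
  -- Below order `q`, the congruence `k ≡ n - k` is an equality, and then the factors `e^(±iϑ)`
  -- cancel.
  by_cases h : (k : ZMod q) = ((n - k : ℕ) : ZMod q)
  · have h1 : k = n - k := by
      have := congrArg ZMod.val h
      rwa [ZMod.val_natCast_of_lt (by omega), ZMod.val_natCast_of_lt (by omega)] at this
    rw [← h1, ← mul_pow, ← mul_pow, ← Complex.exp_add, ← Complex.exp_add]
    simp
  · rw [sum_charSum_mul_shift hg h, mul_zero, mul_zero]

/-- At order `q`, the quasi-position enters through one harmonic. -/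
lemma sum_mul_kick_pow_self {g : Finset (ZMod q) → ℂ} (hg : IsDihedral g) (hq : 2 < q) (ϑ : ℝ) :
    ∑ J, g J * kick J ϑ ^ q =
      2 * (Complex.I / 2) ^ q * Real.cos (q * ϑ) * ∑ J, g J * charSum J ^ q := by
  -- Since `q` is odd, `k ≡ q - k` modulo `q` leaves only `k = 0` and `k = q`.
  have hmid : ∀ k ∈ range (q + 1), k ≠ 0 ∧ k ≠ q → Complex.exp (ϑ * Complex.I) ^ k *
      Complex.exp (-(ϑ * Complex.I)) ^ (q - k) * q.choose k *
        ∑ J, g J * (charSum J ^ k * charSumNeg J ^ (q - k)) = 0 := by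
    intro k hk hk'
    have hk := mem_range.mp hk
    rw [sum_charSum_mul_shift hg, mul_zero]
    intro h
    have h1 := congrArg ZMod.val h
    rw [ZMod.val_natCast_of_lt (by omega), ZMod.val_natCast_of_lt (by omega)] at h1
    obtain ⟨r, hr⟩ := (Fact.out : q.Prime).odd_of_ne_two (by omega)
    omega
  rw [sum_mul_kick_pow, sum_eq_add_of_mem 0 q (by simp) (by simp) (by omega) hmid]
  simp only [pow_zero, one_mul, Nat.sub_zero, Nat.choose_zero_right, Nat.choose_self,
    Nat.sub_self, mul_one, Nat.cast_one, sum_charSumNeg_pow hg]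
  rw [Complex.ofReal_cos, Complex.cos, ← Complex.exp_nat_mul, ← Complex.exp_nat_mul]
  push_cast
  rw [show (q : ℂ) * (ϑ * Complex.I) = q * ϑ * Complex.I by ring,
    show (q : ℂ) * -(ϑ * Complex.I) = -(q * ϑ) * Complex.I by ring]
  ring

/-- The coefficient of the leading harmonic of a dihedral sum. -/
noncomputable def harmonicCoeff (g : Finset (ZMod q) → ℂ) : ℂ :=
  (∑ J, g J * charSum J ^ q) / (q.factorial : ℂ)

/-- The derivative of `kickSum g` with respect to `ϑ`. -/
noncomputable def kickSumDeriv (g : Finset (ZMod q) → ℂ) (ϑ μ : ℝ) : ℂ :=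
  ∑ J, g J * (Complex.exp (μ * kick J ϑ) * (μ * kickDeriv J ϑ))

lemma hasDerivAt_kickSum (g : Finset (ZMod q) → ℂ) (ϑ μ : ℝ) :
    HasDerivAt (fun t => kickSum g t μ) (kickSumDeriv g ϑ μ) ϑ :=
  HasDerivAt.fun_sum fun J _ => (((hasDerivAt_kick J ϑ).const_mul (μ : ℂ)).cexp).const_mul (g J)

lemma continuous_kickSum (g : Finset (ZMod q) → ℂ) :
    Continuous fun x : ℝ × ℝ => kickSum g x.1 x.2 := by
  refine continuous_finsetSum _ fun J _ => continuous_const.mul (Complex.continuous_exp.comp ?_)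
  exact (Complex.continuous_ofReal.comp continuous_snd).mul ((continuous_kick J).comp continuous_fst)

lemma norm_exp_kick_sub_le (J : Finset (ZMod q)) (ϑ : ℝ) {μ : ℝ} (hμ : |μ| ≤ 1) (n : ℕ) :
    ‖Complex.exp (μ * kick J ϑ) - ∑ m ∈ range n, (μ * kick J ϑ) ^ m / m.factorial‖ ≤
      |μ| ^ n * (q ^ n * Real.exp q) := by
  refine (Complex.norm_exp_sub_sum_le_norm_mul_exp _ n).trans ?_
  have h1 := norm_kick_le J ϑ
  rw [norm_mul, Complex.norm_real, Real.norm_eq_abs, mul_pow, mul_assoc]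
  gcongr
  calc |μ| * ‖kick J ϑ‖ ≤ 1 * q := by gcongr
    _ = q := one_mul _

/-- The Taylor polynomial in `μ` of degree `q - 1` is independent of `ϑ`, and the remainder is
uniform in `ϑ`. -/
lemma norm_kickSum_sub_le {g : Finset (ZMod q) → ℂ} (hg : IsDihedral g) :
    ∃ C : ℝ, ∀ ϑ μ : ℝ, |μ| ≤ 1 → ‖kickSum g ϑ μ - kickSum g 0 μ‖ ≤ C * |μ| ^ q := by
  refine ⟨2 * ∑ J, ‖g J‖ * (q ^ q * Real.exp q), fun ϑ μ hμ => ?_⟩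
  have h1 : ∀ t : ℝ, ‖kickSum g t μ -
      ∑ m ∈ range q, (μ : ℂ) ^ m / m.factorial * ∑ J, g J * kick J t ^ m‖ ≤
      (∑ J, ‖g J‖ * (q ^ q * Real.exp q)) * |μ| ^ q := by
    intro t
    have h2 : kickSum g t μ - ∑ m ∈ range q, (μ : ℂ) ^ m / m.factorial * ∑ J, g J * kick J t ^ m =
        ∑ J, g J * (Complex.exp (μ * kick J t) -
          ∑ m ∈ range q, (μ * kick J t) ^ m / m.factorial) := by
      simp only [mul_sub, sum_sub_distrib, kickSum, mul_sum]
      rw [sum_comm (s := range q)]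
      congr 1
      refine sum_congr rfl fun J _ => sum_congr rfl fun m _ => ?_
      rw [mul_pow]; ring
    rw [h2, sum_mul]
    refine (norm_sum_le _ _).trans (sum_le_sum fun J _ => ?_)
    rw [norm_mul, mul_assoc]
    refine mul_le_mul_of_nonneg_left ?_ (norm_nonneg _)
    rw [mul_comm (_ * _)]
    exact norm_exp_kick_sub_le J t hμ q
  have h3 : ∑ m ∈ range q, (μ : ℂ) ^ m / m.factorial * ∑ J, g J * kick J ϑ ^ m =
      ∑ m ∈ range q, (μ : ℂ) ^ m / m.factorial * ∑ J, g J * kick J 0 ^ m :=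
    sum_congr rfl fun m hm => by rw [sum_mul_kick_pow_of_lt hg (mem_range.mp hm)]
  have h4 := h1 ϑ
  have h5 := h1 0
  rw [h3] at h4
  rw [norm_sub_rev] at h5
  refine (norm_sub_le_norm_sub_add_norm_sub _ _ _).trans ((add_le_add h4 h5).trans (le_of_eq ?_))
  ring

/-- In the Taylor expansion of the derivative, the terms below order `q` are derivatives of
constants, and the term of order `q` is the derivative of the harmonic `cos(qϑ)`. -/
lemma norm_kickSumDeriv_sub_le {g : Finset (ZMod q) → ℂ} (hg : IsDihedral g) (hq : 2 < q) :
    ∃ C : ℝ, ∀ ϑ μ : ℝ, |μ| ≤ 1 → ‖kickSumDeriv g ϑ μ +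
      2 * q * (Complex.I / 2) ^ q * (μ : ℂ) ^ q * Real.sin (q * ϑ) * harmonicCoeff g‖ ≤
        C * |μ| ^ (q + 1) := by
  refine ⟨∑ J, ‖g J‖ * (q ^ q * Real.exp q * q), fun ϑ μ hμ => ?_⟩
  have hpow : ∀ n : ℕ, HasDerivAt (fun t => ∑ J, g J * kick J t ^ n)
      (∑ J, g J * (n * kick J ϑ ^ (n - 1) * kickDeriv J ϑ)) ϑ := fun n =>
    HasDerivAt.fun_sum fun J _ => ((hasDerivAt_kick J ϑ).pow n).const_mul (g J)
  have hlow : ∀ n < q, ∑ J, g J * (n * kick J ϑ ^ (n - 1) * kickDeriv J ϑ) = 0 := by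
    intro n hn
    have h1 := hpow n
    simp only [sum_mul_kick_pow_of_lt hg hn] at h1
    exact h1.unique (hasDerivAt_const ϑ _)
  have htop : ∑ J, g J * (q * kick J ϑ ^ (q - 1) * kickDeriv J ϑ) =
      -(2 * q * (Complex.I / 2) ^ q * Real.sin (q * ϑ)) * ∑ J, g J * charSum J ^ q := by
    have h1 := hpow q
    simp only [sum_mul_kick_pow_self hg hq] at h1
    have h2 : HasDerivAt (fun t : ℝ => ((Real.cos (q * t) : ℝ) : ℂ))
        ((-Real.sin (q * ϑ) * q : ℝ) : ℂ) ϑ := by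
      have h3 : HasDerivAt (fun t : ℝ => (q : ℝ) * t) q ϑ := by
        simpa using (hasDerivAt_id ϑ).const_mul (q : ℝ)
      exact h3.cos.ofReal_comp
    rw [h1.unique ((h2.const_mul _).mul_const _)]
    push_cast; ring
  have hsum : ∑ m ∈ range q, ∑ J, g J * ((μ * kick J ϑ) ^ m / m.factorial * (μ * kickDeriv J ϑ)) =
      -(2 * q * (Complex.I / 2) ^ q * (μ : ℂ) ^ q * Real.sin (q * ϑ) * harmonicCoeff g) := by
    have h1 : ∀ m ∈ range q,
        ∑ J, g J * ((μ * kick J ϑ) ^ m / m.factorial * (μ * kickDeriv J ϑ)) =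
        (μ : ℂ) ^ (m + 1) / (m + 1).factorial *
          ∑ J, g J * ((m + 1 : ℕ) * kick J ϑ ^ (m + 1 - 1) * kickDeriv J ϑ) := by
      intro m _
      rw [mul_sum]
      refine sum_congr rfl fun J _ => ?_
      rw [Nat.add_sub_cancel, Nat.factorial_succ]
      have : (m.factorial : ℂ) ≠ 0 := Nat.cast_ne_zero.mpr m.factorial_ne_zero
      have : ((m + 1 : ℕ) : ℂ) ≠ 0 := Nat.cast_ne_zero.mpr m.succ_ne_zero
      push_cast at this ⊢
      rw [mul_pow, pow_succ]
      field_simp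
    rw [sum_congr rfl h1]
    have h2 : ∀ m ∈ range q, m ≠ q - 1 → (μ : ℂ) ^ (m + 1) / (m + 1).factorial *
          ∑ J, g J * ((m + 1 : ℕ) * kick J ϑ ^ (m + 1 - 1) * kickDeriv J ϑ) = 0 := by
      intro m hm hm'
      have := mem_range.mp hm
      rw [hlow (m + 1) (by omega), mul_zero]
    rw [sum_eq_single_of_mem (q - 1) (by simp; omega) h2, show q - 1 + 1 = q by omega, htop,
      harmonicCoeff]
    ring
  have h2 : kickSumDeriv g ϑ μ +
      2 * q * (Complex.I / 2) ^ q * (μ : ℂ) ^ q * Real.sin (q * ϑ) * harmonicCoeff g =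
      ∑ J, g J * ((Complex.exp (μ * kick J ϑ) -
          ∑ m ∈ range q, (μ * kick J ϑ) ^ m / m.factorial) * (μ * kickDeriv J ϑ)) := by
    rw [← sub_neg_eq_add, ← hsum, kickSumDeriv, sum_comm, ← sum_sub_distrib]
    refine sum_congr rfl fun J _ => ?_
    rw [sub_mul, mul_sub, sum_mul, mul_sum]
  rw [h2, sum_mul]
  refine (norm_sum_le _ _).trans (sum_le_sum fun J _ => ?_)
  rw [norm_mul, norm_mul, norm_mul, Complex.norm_real, Real.norm_eq_abs, mul_assoc]
  refine mul_le_mul_of_nonneg_left ?_ (norm_nonneg _)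
  calc _ ≤ |μ| ^ q * (q ^ q * Real.exp q) * (|μ| * q) := by
        gcongr
        · exact norm_exp_kick_sub_le J ϑ hμ q
        · exact norm_kickDeriv_le J ϑ
    _ = _ := by ring

lemma kick_add (J : Finset (ZMod q)) (ϑ : ℝ) :
    kick J (ϑ + 2 * Real.pi / q) = kick ((Equiv.addRight (1 : ZMod q)).finsetCongr J) ϑ := by
  have h1 := stdAddChar_coe (N := q) 1
  have h2 := stdAddChar_coe (N := q) (-1)
  rw [Int.cast_one, Int.cast_one] at h1
  rw [Int.cast_neg, Int.cast_neg, Int.cast_one, Int.cast_one] at h2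
  rw [kick, kick, charSum_shift, charSumNeg_shift, h1, h2, ← mul_assoc, ← mul_assoc,
    ← Complex.exp_add, ← Complex.exp_add]
  congr 4
  · push_cast; ring_nf
  · push_cast; ring_nf

lemma kick_neg (J : Finset (ZMod q)) (ϑ : ℝ) :
    kick J (-ϑ) = kick ((Equiv.neg (ZMod q)).finsetCongr J) ϑ := by
  rw [kick, kick, charSum_neg, charSumNeg_neg]
  push_cast
  rw [neg_mul, neg_neg, add_comm]

lemma kickSum_neg {g : Finset (ZMod q) → ℂ} (hg : IsDihedral g) (ϑ μ : ℝ) :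
    kickSum g (-ϑ) μ = kickSum g ϑ μ := by
  rw [kickSum, kickSum, ← Equiv.sum_comp (Equiv.neg (ZMod q)).finsetCongr
    (fun J => g J * Complex.exp (μ * kick J ϑ))]
  exact sum_congr rfl fun J _ => by rw [hg.neg, kick_neg]

lemma kickSum_periodic {g : Finset (ZMod q) → ℂ} (hg : IsDihedral g) (μ : ℝ) :
    Function.Periodic (fun ϑ => kickSum g ϑ μ) (2 * Real.pi / q) := by
  intro ϑ
  simp only
  rw [kickSum, kickSum,
    ← Equiv.sum_comp (Equiv.addRight (1 : ZMod q)).finsetCongr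
      (fun J => g J * Complex.exp (μ * kick J ϑ))]
  exact sum_congr rfl fun J _ => by rw [hg.shift, kick_add]

/-- Where the sine vanishes, asymptotic equivalence demands exact vanishing. Evenness and the period
`2π/q` combine to a reflection about such a `ϑ`, so the derivative equals its own negative. -/
lemma kickSumDeriv_eq_zero {g : Finset (ZMod q) → ℂ} (hg : IsDihedral g) {ϑ : ℝ}
    (h : Real.sin (q * ϑ) = 0) (μ : ℝ) : kickSumDeriv g ϑ μ = 0 := by
  have hq : (q : ℝ) ≠ 0 := Nat.cast_ne_zero.mpr (Fact.out : q.Prime).ne_zero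
  obtain ⟨n, hn⟩ := Real.sin_eq_zero_iff.mp h
  have h1 : ∀ t : ℝ, kickSum g (2 * ϑ - t) μ = kickSum g t μ := by
    intro t
    have h2 := (kickSum_periodic hg μ).int_mul n (-t)
    rw [← kickSum_neg hg t, ← h2]
    congr 1
    field_simp
    linear_combination 2 * (-hn)
  have h3 := hasDerivAt_kickSum g ϑ μ
  have h4 : HasDerivAt (fun t => kickSum g (2 * ϑ - t) μ) (-kickSumDeriv g ϑ μ) ϑ := by
    have h5 : HasDerivAt (fun t => 2 * ϑ - t) (-1) ϑ := (hasDerivAt_id ϑ).const_sub _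
    have h6 : HasDerivAt (fun t => kickSum g t μ) (kickSumDeriv g ϑ μ) (2 * ϑ - ϑ) := by
      rw [show 2 * ϑ - ϑ = ϑ by ring]; exact h3
    exact (h6.scomp ϑ h5).congr_deriv (by simp)
  simp only [h1] at h4
  have h5 := h3.unique h4
  linear_combination h5 / 2

end ExpSums

end KickedRotor

/-! ### The characteristic polynomial as a dihedral sum and as a determinant in momentum space. -/

namespace KickedRotor

open Finset ZMod

/-- Multilinearity in the rows: `J` collects the rows from which the diagonal part is taken. -/
lemma det_diagonal_sub {ι R : Type*} [Fintype ι] [DecidableEq ι] [CommRing R] (d : ι → R)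
    (B : Matrix ι ι R) :
    (Matrix.diagonal d - B).det = ∑ J : Finset ι, (∏ j ∈ J, d j) *
      (Matrix.of fun i => if i ∈ J then (1 : Matrix ι ι R) i else (-B) i).det := by
  have h1 : Matrix.diagonal d - B =
      (fun i => d i • (1 : Matrix ι ι R) i) + (fun i => (-B) i) := by
    ext i j
    by_cases h : i = j
    · subst h; simp [sub_eq_add_neg]
    · simp [sub_eq_add_neg, h]
  have h2 := (Matrix.detRowAlternating (n := ι) (R := R)).toMultilinearMap.map_add_univ
    (fun i => d i • (1 : Matrix ι ι R) i) (fun i => (-B) i)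
  rw [h1]
  refine h2.trans (sum_congr rfl fun J _ => ?_)
  have h3 := (Matrix.detRowAlternating (n := ι) (R := R)).toMultilinearMap.map_piecewise_smul
    d (fun i => if i ∈ J then (1 : Matrix ι ι R) i else (-B) i) J
  rw [smul_eq_mul] at h3
  refine Eq.trans ?_ h3
  congr 1
  funext i
  by_cases h : i ∈ J
  · simp only [piecewise_eq_of_mem _ _ _ h, if_pos h]
  · simp only [piecewise_eq_of_notMem _ _ _ h, if_neg h]

section Fourier

variable {q : ℕ} [Fact q.Prime]

/-- The circulant matrix with eigenvalues `a`. -/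
noncomputable def circulantOf (a : ZMod q → ℂ) : Matrix (ZMod q) (ZMod q) ℂ :=
  Matrix.of fun j k => (q : ℂ)⁻¹ * ∑ t, stdAddChar (t * (j - k)) * a t

/-- The Fourier coefficients of a diagonal matrix. -/
noncomputable def fourierCoeff (E : ZMod q → ℂ) (l : ZMod q) : ℂ :=
  (q : ℂ)⁻¹ * ∑ j, E j * stdAddChar (-(l * j))

/-- The matrix `z E - G` in the basis of eigenvectors of `G`. -/
noncomputable def momentumMatrix (a : ZMod q → ℂ) (v : ZMod q → ℂ) (z : ℂ) :
    Matrix (ZMod q) (ZMod q) ℂ :=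
  Matrix.of fun m n => z * v (m - n) - if m = n then a m else 0

/-- The weight of the diagonal entries with indices in `J` in the expansion of a determinant. -/
noncomputable def minorWeight (a : ZMod q → ℂ) (J : Finset (ZMod q)) : ℂ :=
  (Matrix.of fun i => if i ∈ J then (1 : Matrix (ZMod q) (ZMod q) ℂ) i
    else (-circulantOf a) i).det

lemma sum_stdAddChar_mul (x : ZMod q) :
    ∑ t : ZMod q, stdAddChar (t * x) = if x = 0 then (q : ℂ) else 0 := by
  have h := AddChar.sum_mulShift x (isPrimitive_stdAddChar q)
  rw [h, ZMod.card]
  split_ifs <;> simp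

lemma natCast_prime_ne_zero : (q : ℂ) ≠ 0 := Nat.cast_ne_zero.mpr (Fact.out : q.Prime).ne_zero

/-- The discrete Fourier transform diagonalizes the circulant and turns the diagonal kick into a
convolution. -/
lemma det_diagonal_sub_circulantOf (a E : ZMod q → ℂ) (z : ℂ) :
    (Matrix.diagonal (fun j => z * E j) - circulantOf a).det =
      (momentumMatrix a (fourierCoeff E) z).det := by
  set F : Matrix (ZMod q) (ZMod q) ℂ := Matrix.of fun j t => stdAddChar (j * t) with hF
  set F' : Matrix (ZMod q) (ZMod q) ℂ :=
    Matrix.of fun t j => (q : ℂ)⁻¹ * stdAddChar (-(t * j)) with hF'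
  have hFF : F' * F = 1 := by
    ext s t
    simp only [hF, hF', Matrix.mul_apply, Matrix.of_apply, mul_assoc, ← mul_sum,
      ← AddChar.map_add_eq_mul]
    have h1 : ∀ j : ZMod q, -(s * j) + j * t = j * (t - s) := fun j => by ring
    simp only [h1, sum_stdAddChar_mul, Matrix.one_apply, sub_eq_zero, eq_comm (a := t)]
    split_ifs
    · exact inv_mul_cancel₀ natCast_prime_ne_zero
    · exact mul_zero _
  have h1 : momentumMatrix a (fourierCoeff E) z =
      F' * (Matrix.diagonal (fun j => z * E j) - circulantOf a) * F := by
    rw [Matrix.mul_sub, Matrix.sub_mul]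
    have hG : circulantOf a = F * Matrix.diagonal a * F' := by
      ext j k
      rw [Matrix.mul_apply]
      simp only [Matrix.mul_diagonal, hF, hF', circulantOf, Matrix.of_apply, mul_sum]
      refine sum_congr rfl fun t _ => ?_
      rw [show t * (j - k) = j * t + -(t * k) by ring, AddChar.map_add_eq_mul]
      ring
    rw [hG, show F' * (F * Matrix.diagonal a * F') * F = (F' * F) * Matrix.diagonal a * (F' * F) by
      simp only [Matrix.mul_assoc], hFF, Matrix.one_mul, Matrix.mul_one]
    ext m n
    rw [Matrix.sub_apply, Matrix.mul_apply]
    simp only [Matrix.mul_diagonal, hF, hF', Matrix.of_apply, momentumMatrix, fourierCoeff,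
      Matrix.diagonal_apply]
    congr 1
    rw [mul_sum, mul_sum]
    refine sum_congr rfl fun j _ => ?_
    rw [show -((m - n) * j) = -(m * j) + j * n by ring, AddChar.map_add_eq_mul]
    ring
  have h2 : F'.det * F.det = 1 := by rw [← Matrix.det_mul, hFF, Matrix.det_one]
  rw [h1, Matrix.det_mul, Matrix.det_mul]
  linear_combination (-(Matrix.diagonal (fun j => z * E j) - circulantOf a).det) * h2

lemma det_diagonal_sub_circulantOf_eq_sum (a E : ZMod q → ℂ) (z : ℂ) :
    (Matrix.diagonal (fun j => z * E j) - circulantOf a).det =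
      ∑ J, z ^ #J * (minorWeight a J * ∏ j ∈ J, E j) := by
  rw [det_diagonal_sub]
  refine sum_congr rfl fun J _ => ?_
  rw [prod_mul_distrib, prod_const, minorWeight]
  ring

lemma circulantOf_add (a : ZMod q → ℂ) (j k c : ZMod q) :
    circulantOf a (j + c) (k + c) = circulantOf a j k := by
  simp [circulantOf]

lemma circulantOf_neg {a : ZMod q → ℂ} (ha : ∀ t, a (-t) = a t) (j k : ZMod q) :
    circulantOf a (-j) (-k) = circulantOf a j k := by
  simp only [circulantOf, Matrix.of_apply]
  rw [← Equiv.sum_comp (Equiv.neg (ZMod q))]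
  congr 1
  refine sum_congr rfl fun t _ => ?_
  rw [Equiv.neg_apply, ha]
  congr 2
  ring

lemma minorWeight_equiv {a : ZMod q → ℂ} (σ : Equiv.Perm (ZMod q))
    (h : ∀ j k, circulantOf a (σ j) (σ k) = circulantOf a j k) (J : Finset (ZMod q)) :
    minorWeight a (σ.finsetCongr J) = minorWeight a J := by
  rw [minorWeight, ← Matrix.det_submatrix_equiv_self σ, minorWeight]
  congr 1
  ext j k
  have hmem : σ j ∈ σ.finsetCongr J ↔ j ∈ J := by simp [Equiv.finsetCongr_apply]
  by_cases hj : j ∈ J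
  · simp only [Matrix.submatrix_apply, Matrix.of_apply, if_pos (hmem.mpr hj), if_pos hj,
      Matrix.one_apply, σ.injective.eq_iff]
  · simp only [Matrix.submatrix_apply, Matrix.of_apply, if_neg (mt hmem.mp hj), if_neg hj,
      Matrix.neg_apply, h]

/-- The weights that produce the coefficient of `z ^ n` in the characteristic polynomial. -/
noncomputable def coeffWeight (a : ZMod q → ℂ) (n : ℕ) (J : Finset (ZMod q)) : ℂ :=
  if #J = n then minorWeight a J else 0

/-- A circulant matrix is invariant under simultaneous translation of rows and columns, and under
reflection if its eigenvalues are even in the momentum. -/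
lemma isDihedral_coeffWeight {a : ZMod q → ℂ} (ha : ∀ t, a (-t) = a t) (n : ℕ) :
    IsDihedral (coeffWeight a n) where
  shift J := by
    rw [coeffWeight, coeffWeight, minorWeight_equiv (Equiv.addRight (1 : ZMod q))
      (fun j k => circulantOf_add a j k 1), Equiv.finsetCongr_apply, card_map]
  neg J := by
    rw [coeffWeight, coeffWeight, minorWeight_equiv (Equiv.neg (ZMod q))
      (fun j k => circulantOf_neg ha j k), Equiv.finsetCongr_apply, card_map]

lemma sum_pow_card_mul (a : ZMod q → ℂ) (z : ℂ) (f : Finset (ZMod q) → ℂ) :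
    ∑ J, z ^ #J * (minorWeight a J * f J) =
      ∑ n ∈ range (q + 1), (∑ J, coeffWeight a n J * f J) * z ^ n := by
  simp only [sum_mul]
  rw [sum_comm]
  refine sum_congr rfl fun J _ => ?_
  have h : #J ∈ range (q + 1) := by
    have := card_le_univ J
    rw [ZMod.card] at this
    exact mem_range.mpr (by omega)
  rw [sum_eq_single_of_mem _ h]
  · rw [coeffWeight, if_pos rfl]; ring
  · intro n _ hn
    rw [coeffWeight, if_neg hn.symm, zero_mul, zero_mul]

/-- The characteristic polynomial of the Bloch fibre with eigenvalues `a` at `μ = 0`. -/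
noncomputable def blochPoly (a : ZMod q → ℂ) (ϑ μ : ℝ) : Polynomial ℂ :=
  ∑ n ∈ range (q + 1), Polynomial.C (kickSum (coeffWeight a n) ϑ μ) * Polynomial.X ^ n

lemma eval_blochPoly (a : ZMod q → ℂ) (ϑ μ : ℝ) (z : ℂ) :
    (blochPoly a ϑ μ).eval z =
      ∑ n ∈ range (q + 1), kickSum (coeffWeight a n) ϑ μ * z ^ n := by
  simp [blochPoly, Polynomial.eval_finsetSum]

lemma kick_eq_sum (J : Finset (ZMod q)) (ϑ : ℝ) : kick J ϑ = ∑ j ∈ J, kick {j} ϑ := by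
  simp only [kick, charSum, charSumNeg, sum_singleton, mul_sum, ← sum_add_distrib]

lemma eval_blochPoly_eq_det (a : ZMod q → ℂ) (ϑ μ : ℝ) (z : ℂ) :
    (blochPoly a ϑ μ).eval z = (Matrix.diagonal (fun j => z * Complex.exp (μ * kick {j} ϑ)) -
      circulantOf a).det := by
  rw [eval_blochPoly, det_diagonal_sub_circulantOf_eq_sum, sum_pow_card_mul]
  refine sum_congr rfl fun n _ => ?_
  congr 1
  refine sum_congr rfl fun J _ => ?_
  rw [← Complex.exp_sum, ← mul_sum, ← kick_eq_sum]

/-- All kicks together cancel. This makes the characteristic polynomial monic and the determinant of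
the kick equal to 1. -/
lemma kick_univ (ϑ : ℝ) : kick (univ : Finset (ZMod q)) ϑ = 0 := by
  have h1 : charSum (univ : Finset (ZMod q)) = 0 := by
    simpa [charSum] using sum_stdAddChar_mul (1 : ZMod q)
  have h2 : charSumNeg (univ : Finset (ZMod q)) = 0 := by
    simpa [charSumNeg] using sum_stdAddChar_mul (-1 : ZMod q)
  rw [kick, h1, h2]
  simp

lemma kick_singleton (j : ZMod q) (ϑ : ℝ) :
    kick {j} ϑ = Complex.I * (Real.cos (ϑ + 2 * Real.pi * (j.val : ℝ) / q) : ℂ) := by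
  have h1 := stdAddChar_coe (N := q) j.val
  have h2 := stdAddChar_coe (N := q) (-j.val)
  rw [Int.cast_natCast, ZMod.natCast_zmod_val] at h1
  rw [Int.cast_neg, Int.cast_natCast, ZMod.natCast_zmod_val] at h2
  rw [kick, charSum, charSumNeg, sum_singleton, sum_singleton, h1, h2, ← Complex.exp_add,
    ← Complex.exp_add, Complex.ofReal_cos, Complex.cos]
  push_cast
  rw [div_mul_eq_mul_div, ← mul_div_assoc]
  congr 4 <;> ring_nf

/-- The identification of the row indices `0, …, q - 1` with `ZMod q`. -/
def indexEquiv (q : ℕ) [NeZero q] : Fin q ≃ ZMod q where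
  toFun j := ((j : ℕ) : ZMod q)
  invFun x := ⟨x.val, x.val_lt⟩
  left_inv j := Fin.ext (ZMod.val_natCast_of_lt j.isLt)
  right_inv x := ZMod.natCast_zmod_val x

lemma sum_range_natCast_zmod (f : ZMod q → ℂ) : ∑ s ∈ range q, f (s : ZMod q) = ∑ t, f t := by
  rw [Finset.sum_range, ← Equiv.sum_comp (indexEquiv q)]
  rfl

/-- Recentring the momenta at `h = 1/2` makes the eigenvalues even; the price is a conjugation by a
diagonal matrix of characters. -/
lemma freeMatrix_eq {p : ℤ} {a : ZMod q → ℂ} {h : ZMod q} (hh : 2 * h = 1)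
    (ha : ∀ r : ℕ, phase q p (1 / 2) r = a ((r : ZMod q) - h)) (j k : Fin q) :
    freeMatrix q p (1 / 2) j k = stdAddChar (-(h * ((j : ℕ) : ZMod q))) *
      circulantOf a ((j : ℕ) : ZMod q) ((k : ℕ) : ZMod q) *
        stdAddChar (h * ((k : ℕ) : ZMod q)) := by
  simp only [freeMatrix, circulantOf, Matrix.of_apply]
  rw [one_div, ← Equiv.sum_comp (Equiv.addRight h) (fun t => stdAddChar (t * _) * a t),
    show ∀ x y w : ℂ, x * ((q : ℂ)⁻¹ * w) * y = (q : ℂ)⁻¹ * (x * w * y) from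
      fun x y w => by ring]
  congr 1
  rw [mul_sum, sum_mul, ← sum_range_natCast_zmod]
  refine sum_congr rfl fun s _ => ?_
  have h1 := stdAddChar_coe (N := q) ((s : ℤ) * ((j : ℕ) - (k : ℕ)))
  have h2 : Complex.exp (2 * Real.pi * Complex.I * (s : ℂ) * (((j : ℕ) : ℂ) - ((k : ℕ) : ℂ)) / q) =
      stdAddChar ((s : ZMod q) * (((j : ℕ) : ZMod q) - ((k : ℕ) : ZMod q))) := by
    push_cast at h1
    rw [h1]
    congr 1
    ring
  rw [h2, ha, Equiv.coe_addRight]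
  -- The index `r = s + 1` and the shift by `h` meet here: `s + 1 - h = s + h` because `2h = 1`.
  have h3 : (((s + 1 : ℕ) : ZMod q) - h) = (s : ZMod q) + h := by
    push_cast; linear_combination -hh
  rw [h3, mul_assoc, mul_assoc, mul_comm (a _), ← mul_assoc, ← mul_assoc,
    ← AddChar.map_add_eq_mul, ← AddChar.map_add_eq_mul]
  congr 2
  ring

/-- Moving the kick from `G` to the spectral parameter rescales the rows, and the recentring
rescales rows and columns. All these factors multiply to 1 by `kick_univ`. -/
lemma charpoly_blochMatrix {p : ℤ} {a : ZMod q → ℂ} {h : ZMod q} (hh : 2 * h = 1)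
    (ha : ∀ r : ℕ, phase q p (1 / 2) r = a ((r : ZMod q) - h)) (ϑ μ : ℝ) :
    (blochMatrix q p (1 / 2) ϑ μ).charpoly = blochPoly a ϑ μ := by
  refine Polynomial.funext fun z => ?_
  rw [Matrix.eval_charpoly, eval_blochPoly_eq_det,
    ← Matrix.det_submatrix_equiv_self (indexEquiv q)]
  set N := (Matrix.diagonal (fun j => z * Complex.exp (μ * kick {j} ϑ)) -
    circulantOf a).submatrix (indexEquiv q) (indexEquiv q) with hN
  set r : Fin q → ℂ := fun j => stdAddChar (-(h * ((j : ℕ) : ZMod q))) *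
    Complex.exp (-(μ * kick {((j : ℕ) : ZMod q)} ϑ)) with hr
  set c : Fin q → ℂ := fun k => stdAddChar (h * ((k : ℕ) : ZMod q)) with hc
  have h1 : Matrix.scalar (Fin q) z - blochMatrix q p (1 / 2) ϑ μ =
      Matrix.of fun j k => r j * (Matrix.of (fun j k => c k * N j k) j k) := by
    ext j k
    simp only [Matrix.sub_apply, Matrix.scalar_apply, blochMatrix, Matrix.of_apply, hN,
      Matrix.submatrix_apply, Matrix.diagonal_apply, hr, hc, freeMatrix_eq hh ha, indexEquiv,
      Equiv.coe_fn_mk]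
    have hinj : ((j : ℕ) : ZMod q) = ((k : ℕ) : ZMod q) ↔ j = k :=
      (indexEquiv q).injective.eq_iff (a := j) (b := k)
    have hk : Complex.exp (-(Complex.I * μ * (Real.cos (ϑ + 2 * Real.pi * ((j : ℕ) : ℝ) / q) : ℂ))) =
        Complex.exp (-(μ * kick {((j : ℕ) : ZMod q)} ϑ)) := by
      rw [kick_singleton, ZMod.val_natCast_of_lt j.isLt]
      congr 1; ring
    rw [hk]
    by_cases hjk : j = k
    · subst hjk
      have e1 : stdAddChar (-(h * ((j : ℕ) : ZMod q))) * stdAddChar (h * ((j : ℕ) : ZMod q)) = 1 := by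
        rw [← AddChar.map_add_eq_mul, neg_add_cancel, AddChar.map_zero_eq_one]
      have e2 : Complex.exp (-(μ * kick {((j : ℕ) : ZMod q)} ϑ)) *
          Complex.exp (μ * kick {((j : ℕ) : ZMod q)} ϑ) = 1 := by
        rw [← Complex.exp_add, neg_add_cancel, Complex.exp_zero]
      simp only [if_true]
      linear_combination (-z) * e1 * Complex.exp (-(μ * kick {((j : ℕ) : ZMod q)} ϑ)) *
          Complex.exp (μ * kick {((j : ℕ) : ZMod q)} ϑ) - z * e2
    · simp only [mt hinj.mp hjk, hjk, if_false]
      ring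
  have h2 : (∏ j, r j) * ∏ k, c k = 1 := by
    rw [← prod_mul_distrib]
    have h3 : ∀ j : Fin q, r j * c j = Complex.exp (-(μ * kick {((j : ℕ) : ZMod q)} ϑ)) := by
      intro j
      simp only [hr, hc]
      rw [mul_right_comm, ← AddChar.map_add_eq_mul, neg_add_cancel, AddChar.map_zero_eq_one,
        one_mul]
    simp only [h3]
    rw [← Complex.exp_sum, sum_neg_distrib, ← mul_sum]
    have h4 : ∑ j : Fin q, kick {((j : ℕ) : ZMod q)} ϑ = 0 := by
      rw [← kick_univ (q := q) ϑ, kick_eq_sum univ, ← Equiv.sum_comp (indexEquiv q)]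
      rfl
    rw [h4, mul_zero, neg_zero, Complex.exp_zero]
  rw [h1, Matrix.det_mul_column, Matrix.det_mul_row, ← mul_assoc, h2, one_mul]

end Fourier

end KickedRotor

/-! ### Hessenberg determinants. -/

namespace KickedRotor

open Finset ZMod Filter Topology

/-- The Hessenberg matrix that transports amplitudes upwards from site `0` to site `n`. -/
noncomputable def hessenberg (b : ℕ → ℂ) (n : ℕ) : Matrix (Fin n) (Fin n) ℂ :=
  Matrix.of fun i j => if (j : ℕ) ≤ i + 1 then
    b 0 / ((i + 1 - j : ℕ).factorial : ℂ) - (if (j : ℕ) = i + 1 then b j else 0) else 0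

/-- The ladder recursion is exactly the vanishing of every row but the last, where the transmission
is left over. -/
lemma hessenberg_mulVec_ladder {b : ℕ → ℂ} (hb : b 0 ≠ 0) {n : ℕ}
    (hne : ∀ l, 0 < l → l < n + 1 → b l ≠ b 0) (i : Fin (n + 1)) :
    ∑ j : Fin (n + 1), ladder (fun l => b l / b 0) j • hessenberg b (n + 1) i j =
      if i = Fin.last n then b 0 * transmission (fun l => b l / b 0) (n + 1) else 0 := by
  set R : ℕ → ℂ := fun l => b l / b 0 with hR
  have h1 : ∑ j : Fin (n + 1), ladder R j • hessenberg b (n + 1) i j =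
      ∑ j ∈ range (n + 1), ladder R j * (if j ≤ (i : ℕ) + 1 then
        b 0 / (((i : ℕ) + 1 - j).factorial : ℂ) - (if j = (i : ℕ) + 1 then b j else 0) else 0) := by
    rw [Finset.sum_range]
    rfl
  have h2 : ∀ j ∈ range (i + 1), ladder R j * (if j ≤ (i : ℕ) + 1 then
        b 0 / (((i : ℕ) + 1 - j).factorial : ℂ) - (if j = (i : ℕ) + 1 then b j else 0) else 0) =
      b 0 * (ladder R j / (((i : ℕ) + 1 - j).factorial : ℂ)) := by
    intro j hj
    have hj := mem_range.mp hj
    rw [if_pos (by omega), if_neg (by omega), sub_zero]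
    ring
  have hsum := sum_congr rfl h2
  rw [← mul_sum] at hsum
  have hlast : i = Fin.last n ↔ (i : ℕ) = n := by rw [Fin.ext_iff, Fin.val_last]
  by_cases hi : (i : ℕ) = n
  · rw [if_pos (hlast.mpr hi), h1]
    rw [hi] at hsum ⊢
    exact hsum
  · have hi' : (i : ℕ) < n := by omega
    rw [if_neg (mt hlast.mp hi), h1, ← sum_subset (s₁ := range ((i : ℕ) + 1 + 1))
      (fun j hj => mem_range.mpr (by have := mem_range.mp hj; omega))
      (fun j _ hj => by rw [mem_range] at hj; rw [if_neg (by omega), mul_zero]),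
      sum_range_succ, hsum, ladder_of_pos R (Nat.succ_pos i), transmission]
    simp only [le_refl, if_true, Nat.sub_self, Nat.factorial_zero, Nat.cast_one, div_one]
    have h3 : b ((i : ℕ) + 1) - b 0 ≠ 0 := sub_ne_zero.mpr (hne _ (by omega) (by omega))
    have h4 : R ((i : ℕ) + 1) - 1 = (b ((i : ℕ) + 1) - b 0) / b 0 := by
      rw [hR]; field_simp
    rw [Nat.succ_eq_add_one, h4, inv_div]
    field_simp
    ring

/-- As the ladder starts with 1, adding multiples of the other columns replaces column 0 by the
image of the ladder. Only its last entry is nonzero, and the complementary minor is lower triangular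
with diagonal `b 0 - b (l + 1)`. -/
lemma norm_det_hessenberg {b : ℕ → ℂ} (hb : b 0 ≠ 0) {n : ℕ} (h0 : 0 < n)
    (hne : ∀ l, 0 < l → l < n → b l ≠ b 0) :
    ‖(hessenberg b n).det‖ = ‖b 0‖ * ‖transmission (fun l => b l / b 0) n‖ *
      ∏ l ∈ range (n - 1), ‖b 0 - b (l + 1)‖ := by
  obtain ⟨n, rfl⟩ : ∃ k, n = k + 1 := ⟨n - 1, by omega⟩
  have h1 := Matrix.det_updateCol_sum (hessenberg b (n + 1)) 0
    (fun j => ladder (fun l => b l / b 0) j)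
  simp only [hessenberg_mulVec_ladder hb hne, Fin.val_zero, ladder_zero, one_smul] at h1
  rw [← h1, Matrix.det_succ_column_zero, sum_eq_single_of_mem (Fin.last n) (mem_univ _)]
  · rw [norm_mul, norm_mul, norm_pow, norm_neg, norm_one, one_pow, one_mul, Matrix.updateCol_self,
      if_pos rfl, norm_mul]
    congr 1
    rw [Matrix.det_of_isLowerTriangular]
    · rw [Finset.prod_range, norm_prod]
      refine prod_congr rfl fun i _ => ?_
      simp [hessenberg]
    · intro i j hij
      have hij' : (i : ℕ) < j := hij
      have : ¬ (j : ℕ) ≤ i := by omega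
      simp [hessenberg, this]
  · intro i _ hi
    rw [Matrix.updateCol_self, if_neg hi, mul_zero, zero_mul]

/-- At a second degenerate site `d` the superdiagonal entry `b 0 - b d` vanishes, so the matrix
becomes block triangular. -/
lemma det_hessenberg_add {b : ℕ → ℂ} {d e : ℕ} (hd : b d = b 0) :
    (hessenberg b (d + e)).det =
      (hessenberg b d).det * (hessenberg (fun l => b (d + l)) e).det := by
  rw [← Matrix.det_submatrix_equiv_self finSumFinEquiv, ← Matrix.det_fromBlocks_zero₁₂ _
    (Matrix.of fun (i : Fin e) (j : Fin d) =>
      hessenberg b (d + e) (Fin.natAdd d i) (Fin.castAdd e j))]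
  congr 1
  ext i j
  rcases i with i | i <;> rcases j with j | j
  · simp [hessenberg]
  · simp only [Matrix.submatrix_apply, finSumFinEquiv_apply_left, finSumFinEquiv_apply_right,
      Matrix.fromBlocks_apply₁₂, Matrix.zero_apply, hessenberg, Matrix.of_apply, Fin.val_castAdd,
      Fin.val_natAdd]
    have := i.isLt
    split_ifs with h1 h2
    · have hj : (j : ℕ) = 0 := by omega
      rw [hj, show (i : ℕ) + 1 - (d + 0) = 0 by omega, Nat.add_zero, hd]
      simp
    · omega
    · rfl
  · simp
  · simp only [Matrix.submatrix_apply, finSumFinEquiv_apply_right, Matrix.fromBlocks_apply₂₂,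
      hessenberg, Matrix.of_apply, Fin.val_natAdd, Nat.add_zero, hd]
    have h1 : d + (j : ℕ) ≤ d + i + 1 ↔ (j : ℕ) ≤ i + 1 := by omega
    have h2 : d + (j : ℕ) = d + i + 1 ↔ (j : ℕ) = i + 1 := by omega
    have h3 : d + (i : ℕ) + 1 - (d + j) = i + 1 - j := by omega
    simp only [h1, h2, h3]

lemma tendsto_exp_sub_sum_div_pow (y : ℂ) (k : ℕ) :
    Tendsto (fun x : ℂ => (Complex.exp (x * y) - ∑ m ∈ range k, (x * y) ^ m / m.factorial) / x ^ k)
      (𝓝[≠] 0) (𝓝 (y ^ k / k.factorial)) := by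
  rw [tendsto_iff_norm_sub_tendsto_zero]
  have hlim : Tendsto (fun x : ℂ => ‖x‖ * (‖y‖ ^ (k + 1) * Real.exp ‖x * y‖)) (𝓝[≠] 0) (𝓝 0) := by
    have hc : Continuous fun x : ℂ => ‖x‖ * (‖y‖ ^ (k + 1) * Real.exp ‖x * y‖) := by fun_prop
    have := (hc.tendsto 0).mono_left (nhdsWithin_le_nhds (s := {0}ᶜ))
    simpa using this
  refine squeeze_zero' (Eventually.of_forall fun _ => norm_nonneg _) ?_ hlim
  filter_upwards [self_mem_nhdsWithin] with x hx
  have hx : x ≠ 0 := hx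
  have h1 := Complex.norm_exp_sub_sum_le_norm_mul_exp (x * y) (k + 1)
  have h2 : (Complex.exp (x * y) - ∑ m ∈ range k, (x * y) ^ m / m.factorial) / x ^ k -
      y ^ k / k.factorial =
      (Complex.exp (x * y) - ∑ m ∈ range (k + 1), (x * y) ^ m / m.factorial) / x ^ k := by
    rw [sum_range_succ, mul_pow x y k]
    field_simp
    ring
  rw [h2, norm_div, norm_pow, div_le_iff₀ (by positivity)]
  refine h1.trans (le_of_eq ?_)
  rw [norm_mul]
  ring

/-! ### The leading harmonic as a Hessenberg determinant. -/

section Momentum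

variable {q : ℕ} [Fact q.Prime]

/-- The harmonic coefficient involves only powers of `charSum`, so it can also be read off from the
upward half of the kick. There all moments of order `0 < m < q` vanish by rotation invariance. -/
lemma tendsto_sum_mul_exp_div_pow {g : Finset (ZMod q) → ℂ} (hg : IsDihedral g) :
    Tendsto (fun x : ℂ => (∑ J, g J * Complex.exp (x * charSum J) - ∑ J, g J) / x ^ q)
      (𝓝[≠] 0) (𝓝 (harmonicCoeff g)) := by
  have hq : 0 < q := (Fact.out : q.Prime).pos
  have h1 : ∀ x : ℂ, (∑ J, g J * Complex.exp (x * charSum J) - ∑ J, g J) / x ^ q =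
      ∑ J, g J * ((Complex.exp (x * charSum J) -
        ∑ m ∈ range q, (x * charSum J) ^ m / m.factorial) / x ^ q) := by
    intro x
    have h2 : ∑ J, g J * ∑ m ∈ range q, (x * charSum J) ^ m / m.factorial = ∑ J, g J := by
      simp only [mul_sum]
      rw [sum_comm, sum_eq_single_of_mem 0 (mem_range.mpr hq)]
      · simp
      · intro m hm hm0
        have hm := mem_range.mp hm
        have h3 := sum_charSum_mul_shift hg (k := m) (l := 0)
          (by simpa using natCast_ne_zero_zmod (q := q) (k := m) (by omega) hm)
        simp only [pow_zero, mul_one] at h3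
        rw [← mul_zero (x ^ m / m.factorial), ← h3, mul_sum]
        refine sum_congr rfl fun J _ => ?_
        rw [mul_pow]; ring
    rw [← h2, ← sum_sub_distrib, sum_div]
    refine sum_congr rfl fun J _ => ?_
    rw [← mul_sub, mul_div_assoc]
  simp only [h1]
  rw [harmonicCoeff, sum_div]
  refine tendsto_finsetSum _ fun J _ => ?_
  rw [mul_div_assoc]
  exact (tendsto_exp_sub_sum_div_pow _ _).const_mul _

lemma tendsto_fourierCoeff_exp (y : ZMod q → ℂ) (l : ZMod q) (k : ℕ) :
    Tendsto (fun x : ℂ => (fourierCoeff (fun j => Complex.exp (x * y j)) l -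
      ∑ m ∈ range k, x ^ m / m.factorial * fourierCoeff (fun j => y j ^ m) l) / x ^ k)
      (𝓝[≠] 0) (𝓝 (fourierCoeff (fun j => y j ^ k) l / k.factorial)) := by
  have h1 : ∀ x : ℂ, (fourierCoeff (fun j => Complex.exp (x * y j)) l -
      ∑ m ∈ range k, x ^ m / m.factorial * fourierCoeff (fun j => y j ^ m) l) / x ^ k =
      (q : ℂ)⁻¹ * ∑ j, ((Complex.exp (x * y j) - ∑ m ∈ range k, (x * y j) ^ m / m.factorial) /
        x ^ k) * stdAddChar (-(l * j)) := by
    intro x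
    have h2 : ∑ m ∈ range k, x ^ m / m.factorial * fourierCoeff (fun j => y j ^ m) l =
        (q : ℂ)⁻¹ * ∑ j, (∑ m ∈ range k, (x * y j) ^ m / m.factorial) * stdAddChar (-(l * j)) := by
      simp only [fourierCoeff, mul_sum, sum_mul]
      rw [sum_comm]
      refine sum_congr rfl fun j _ => sum_congr rfl fun m _ => ?_
      rw [mul_pow]; ring
    rw [h2, fourierCoeff, ← mul_sub, ← sum_sub_distrib, mul_div_assoc, sum_div]
    congr 1
    refine sum_congr rfl fun j _ => ?_
    rw [← sub_mul]; ring
  simp only [h1]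
  rw [fourierCoeff, mul_div_assoc, sum_div]
  refine (tendsto_finsetSum _ fun j _ => ?_).const_mul _
  rw [mul_div_right_comm]
  exact (tendsto_exp_sub_sum_div_pow _ _).mul_const _

lemma fourierCoeff_stdAddChar_pow (m : ℕ) (l : ZMod q) :
    fourierCoeff (fun j => stdAddChar j ^ m) l = if (m : ZMod q) = l then 1 else 0 := by
  have h1 : ∀ j : ZMod q, stdAddChar j ^ m * stdAddChar (-(l * j)) =
      stdAddChar (j * ((m : ZMod q) - l)) := by
    intro j
    rw [← stdAddChar_eq_pow, ← AddChar.map_add_eq_mul]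
    congr 1; ring
  simp only [fourierCoeff, h1, sum_stdAddChar_mul, sub_eq_zero]
  split_ifs
  · exact inv_mul_cancel₀ natCast_prime_ne_zero
  · exact mul_zero _

/-- The symbol of the upward half of the kick. -/
noncomputable def upCoeff (x : ℂ) (l : ZMod q) : ℂ :=
  fourierCoeff (fun j => Complex.exp (x * stdAddChar j)) l

lemma natCast_eq_natCast_zmod_iff {m k : ℕ} (hm : m < q) (hk : k < q) :
    (m : ZMod q) = k ↔ m = k := by
  constructor
  · intro h
    have := congrArg ZMod.val h
    rwa [ZMod.val_natCast_of_lt hm, ZMod.val_natCast_of_lt hk] at this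
  · rintro rfl; rfl

lemma tendsto_upCoeff_div_pow {k : ℕ} (hk : k < q) :
    Tendsto (fun x : ℂ => upCoeff x (k : ZMod q) / x ^ k) (𝓝[≠] 0) (𝓝 (1 / k.factorial)) := by
  have h1 := tendsto_fourierCoeff_exp (fun j => stdAddChar j) (k : ZMod q) k
  simp only [fourierCoeff_stdAddChar_pow, if_true] at h1
  refine h1.congr fun x => ?_
  rw [sum_eq_zero, sub_zero, upCoeff]
  intro m hm
  have hm := mem_range.mp hm
  rw [if_neg, mul_zero]
  rw [natCast_eq_natCast_zmod_iff (by omega) hk]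
  omega

lemma tendsto_upCoeff_zero_sub_one_div_pow :
    Tendsto (fun x : ℂ => (upCoeff x (0 : ZMod q) - 1) / x ^ q) (𝓝[≠] 0)
      (𝓝 (1 / q.factorial)) := by
  have h1 := tendsto_fourierCoeff_exp (fun j => stdAddChar j) (0 : ZMod q) q
  simp only [fourierCoeff_stdAddChar_pow, ZMod.natCast_self, if_true] at h1
  refine h1.congr fun x => ?_
  rw [sum_eq_single_of_mem 0 (mem_range.mpr (Fact.out : q.Prime).pos), upCoeff]
  · simp
  · intro m hm hm0
    have hm := mem_range.mp hm
    rw [if_neg (natCast_ne_zero_zmod (by omega) hm), mul_zero]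

lemma tendsto_upCoeff (l : ZMod q) :
    Tendsto (fun x : ℂ => upCoeff x l) (𝓝[≠] 0) (𝓝 (if 0 = l then 1 else 0)) := by
  have h1 := tendsto_fourierCoeff_exp (fun j => stdAddChar j) l 0
  rw [fourierCoeff_stdAddChar_pow, Nat.cast_zero, Nat.factorial_zero, Nat.cast_one, div_one] at h1
  refine h1.congr fun x => ?_
  rw [range_zero, sum_empty, sub_zero, pow_zero, div_one, upCoeff]

/-- The coefficient of the leading `ϑ`-dependent harmonic of the characteristic polynomial. -/
noncomputable def leadingHarmonic (a : ZMod q → ℂ) (z : ℂ) : ℂ :=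
  ∑ n ∈ range (q + 1), harmonicCoeff (coeffWeight a n) * z ^ n

/-- With upward hops only, the determinant has no terms of order strictly between 0 and `q`. Its
term of order 0 vanishes because `a s` is an eigenvalue of the unkicked circulant. -/
lemma tendsto_det_momentumMatrix_upCoeff {a : ZMod q → ℂ} (ha : ∀ t, a (-t) = a t) (s : ZMod q) :
    Tendsto (fun x : ℂ => (momentumMatrix a (upCoeff x) (a s)).det / x ^ q) (𝓝[≠] 0)
      (𝓝 (leadingHarmonic a (a s))) := by
  have h1 : ∀ x : ℂ, (momentumMatrix a (upCoeff x) (a s)).det =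
      ∑ n ∈ range (q + 1), (∑ J, coeffWeight a n J * Complex.exp (x * charSum J)) * a s ^ n := by
    intro x
    rw [← sum_pow_card_mul, show upCoeff x = fourierCoeff
      (fun j : ZMod q => Complex.exp (x * stdAddChar j)) from rfl, ← det_diagonal_sub_circulantOf,
      det_diagonal_sub_circulantOf_eq_sum]
    refine sum_congr rfl fun J _ => ?_
    rw [← Complex.exp_sum, ← mul_sum, charSum]
  have h2 : ∑ n ∈ range (q + 1), (∑ J, coeffWeight a n J) * a s ^ n = 0 := by
    have h3 := h1 0
    simp only [zero_mul, Complex.exp_zero, mul_one] at h3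
    rw [← h3]
    refine Matrix.det_eq_zero_of_row_eq_zero s fun n => ?_
    have h4 := fourierCoeff_stdAddChar_pow 0 (s - n)
    simp only [pow_zero, Nat.cast_zero] at h4
    simp only [momentumMatrix, Matrix.of_apply, upCoeff, zero_mul, Complex.exp_zero, h4,
      eq_comm (a := (0 : ZMod q)), sub_eq_zero]
    split_ifs <;> simp
  have h5 : ∀ x : ℂ, (momentumMatrix a (upCoeff x) (a s)).det / x ^ q =
      ∑ n ∈ range (q + 1), ((∑ J, coeffWeight a n J * Complex.exp (x * charSum J) -
        ∑ J, coeffWeight a n J) / x ^ q) * a s ^ n := by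
    intro x
    rw [h1, ← sub_zero (∑ n ∈ range (q + 1), _), ← h2, ← sum_sub_distrib, sum_div]
    refine sum_congr rfl fun n _ => ?_
    ring
  simp only [h5]
  exact tendsto_finsetSum _ fun n _ =>
    (tendsto_sum_mul_exp_div_pow (isDihedral_coeffWeight ha n)).mul_const _

lemma det_momentumMatrix_shift (a v : ZMod q → ℂ) (z : ℂ) (s : ZMod q) :
    (momentumMatrix (fun l => a (l + s)) v z).det = (momentumMatrix a v z).det := by
  rw [← Matrix.det_submatrix_equiv_self (Equiv.addRight s) (momentumMatrix a v z)]
  congr 1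
  ext m n
  simp [momentumMatrix]

/-- The rows are shifted cyclically by one, then row `i` is scaled by `x^(-(i+1))` and column `j` by
`x^j`. The determinant is thereby divided by `x^q`, up to a sign, and the entries converge to those
of the Hessenberg matrix. -/
lemma norm_leadingHarmonic {a : ZMod q → ℂ} (ha : ∀ t, a (-t) = a t) (s : ZMod q) :
    ‖leadingHarmonic a (a s)‖ = ‖(hessenberg (fun l : ℕ => a ((l : ZMod q) + s)) q).det‖ := by
  have hq : 0 < q := (Fact.out : q.Prime).pos
  set b : ZMod q → ℂ := fun l => a (l + s) with hb
  have hb0 : b 0 = a s := by simp [hb]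
  set N : ℂ → Matrix (Fin q) (Fin q) ℂ := fun x =>
    (momentumMatrix b (upCoeff x) (a s)).submatrix
      ((indexEquiv q).trans (Equiv.addRight 1)) (indexEquiv q) with hN
  have hnorm : ∀ x, ‖(N x).det‖ = ‖(momentumMatrix a (upCoeff x) (a s)).det‖ := by
    intro x
    have h1 : N x = ((momentumMatrix b (upCoeff x) (a s)).submatrix
        (Equiv.addRight 1) id).submatrix (indexEquiv q) (indexEquiv q) := rfl
    rw [h1, Matrix.det_submatrix_equiv_self, Matrix.det_permute, norm_mul,
      det_momentumMatrix_shift]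
    rcases Int.units_eq_one_or (Equiv.Perm.sign (Equiv.addRight (1 : ZMod q))) with h | h <;>
      simp [h]
  have hscale : ∀ x : ℂ, x ≠ 0 → (Matrix.of fun i j : Fin q =>
      ((x ^ ((i : ℕ) + 1))⁻¹) * (Matrix.of (fun i j : Fin q => x ^ (j : ℕ) * N x i j) i j)).det =
      (N x).det / x ^ q := by
    intro x hx
    rw [Matrix.det_mul_column, Matrix.det_mul_row, ← mul_assoc, ← prod_mul_distrib]
    have h1 : ∀ i : Fin q, (x ^ ((i : ℕ) + 1))⁻¹ * x ^ (i : ℕ) = x⁻¹ := by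
      intro i; rw [pow_succ]; field_simp
    simp only [h1, prod_const, card_univ, Fintype.card_fin]
    rw [inv_pow]; ring
  have hNapp : ∀ x (i j : Fin q), N x i j =
      a s * upCoeff x (((i : ℕ) : ZMod q) + 1 - ((j : ℕ) : ZMod q)) -
        if ((i : ℕ) : ZMod q) + 1 = ((j : ℕ) : ZMod q) then b (((j : ℕ) : ZMod q)) else 0 := by
    intro x i j
    simp only [hN, momentumMatrix, Matrix.submatrix_apply, Matrix.of_apply, Equiv.trans_apply,
      Equiv.coe_addRight, indexEquiv, Equiv.coe_fn_mk]
    split_ifs with h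
    · rw [h]
    · rfl
  have hlim : Tendsto (fun x : ℂ => (Matrix.of fun i j : Fin q =>
      ((x ^ ((i : ℕ) + 1))⁻¹) * (Matrix.of (fun i j : Fin q => x ^ (j : ℕ) * N x i j) i j)).det)
      (𝓝[≠] 0) (𝓝 (hessenberg (fun l : ℕ => b l) q).det) := by
    refine ((Continuous.matrix_det continuous_id).tendsto _).comp ?_
    refine tendsto_pi_nhds.mpr fun i => tendsto_pi_nhds.mpr fun j => ?_
    change Tendsto _ _ (𝓝 (hessenberg (fun l : ℕ => b l) q i j))
    simp only [Matrix.of_apply, hNapp, hessenberg]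
    have hi := i.isLt
    have hj := j.isLt
    have hx0 : ∀ᶠ x : ℂ in 𝓝[≠] 0, x ≠ 0 := self_mem_nhdsWithin
    -- Above the superdiagonal a positive power of `x` is left over; on it, the diagonal entries of
    -- the unshifted matrix appear; below it, hops of length `i + 1 - j` have the limit `1 / (i + 1
    -- - j)!`.
    rcases lt_trichotomy ((i : ℕ) + 1) j with h | h | h
    · rw [if_neg (show ¬ (j : ℕ) ≤ i + 1 by omega)]
      have hne : ((i : ℕ) : ZMod q) + 1 ≠ ((j : ℕ) : ZMod q) := by
        rw [← Nat.cast_succ, Ne, natCast_eq_natCast_zmod_iff (by omega) hj]; omega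
      have h1 : Tendsto (fun x : ℂ => x ^ ((j : ℕ) - (i + 1)) * (a s *
          upCoeff x (((i : ℕ) : ZMod q) + 1 - ((j : ℕ) : ZMod q)))) (𝓝[≠] 0)
          (𝓝 (0 * (a s * (if 0 = ((i : ℕ) : ZMod q) + 1 - ((j : ℕ) : ZMod q) then 1 else 0)))) := by
        refine Tendsto.mul ?_ ((tendsto_upCoeff _).const_mul _)
        have h2 : Tendsto (fun x : ℂ => x ^ ((j : ℕ) - (i + 1))) (𝓝 0)
            (𝓝 (0 ^ ((j : ℕ) - (i + 1)))) := (continuous_pow _).tendsto 0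
        rw [zero_pow (by omega)] at h2
        exact h2.mono_left nhdsWithin_le_nhds
      rw [zero_mul] at h1
      refine h1.congr' (hx0.mono fun x hx => ?_)
      beta_reduce
      rw [if_neg hne, sub_zero, ← mul_assoc ((x ^ ((i : ℕ) + 1))⁻¹)]
      congr 1
      rw [eq_inv_mul_iff_mul_eq₀ (pow_ne_zero _ hx), ← pow_add]
      congr 1; omega
    · rw [if_pos (show (j : ℕ) ≤ i + 1 by omega), if_pos h.symm, ← h, Nat.sub_self, Nat.factorial_zero, Nat.cast_one,
        div_one, Nat.cast_zero, hb0, Nat.cast_succ, sub_self]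
      have h1 := ((tendsto_upCoeff (q := q) 0).const_mul (a s)).sub_const
        (b (((i : ℕ) : ZMod q) + 1))
      rw [if_pos rfl, mul_one] at h1
      refine h1.congr' (hx0.mono fun x hx => ?_)
      beta_reduce
      rw [if_pos rfl, inv_mul_cancel_left₀ (pow_ne_zero _ hx)]
    · rw [if_pos (show (j : ℕ) ≤ i + 1 by omega), if_neg (show ¬ (j : ℕ) = i + 1 by omega), sub_zero,
        Nat.cast_zero, hb0]
      have hk : ((i : ℕ) : ZMod q) + 1 - ((j : ℕ) : ZMod q) = (((i : ℕ) + 1 - j : ℕ) : ZMod q) := by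
        rw [Nat.cast_sub (by omega), Nat.cast_succ]
      have hpow : ∀ x : ℂ, x ≠ 0 → ∀ w : ℂ,
          (x ^ ((i : ℕ) + 1))⁻¹ * (x ^ (j : ℕ) * w) = w / x ^ ((i : ℕ) + 1 - j) := by
        intro x hx w
        have h2 : x ^ ((i : ℕ) + 1) = x ^ ((i : ℕ) + 1 - j) * x ^ (j : ℕ) := by
          rw [← pow_add]; congr 1; omega
        rw [h2]; field_simp
      rcases (show (i : ℕ) + 1 - j ≤ q by omega).lt_or_eq with hlt | heq
      · have hne : ((i : ℕ) : ZMod q) + 1 ≠ ((j : ℕ) : ZMod q) := by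
          rw [← sub_ne_zero, hk]; exact natCast_ne_zero_zmod (by omega) hlt
        rw [div_eq_mul_one_div]
        refine ((tendsto_upCoeff_div_pow hlt).const_mul (a s)).congr' (hx0.mono fun x hx => ?_)
        beta_reduce
        rw [if_neg hne, sub_zero, hpow x hx, hk, mul_div_assoc]
      -- In the corner the hop of length `q` returns to site 0. There the diagonal `a s` is
      -- subtracted, and `upCoeff x 0 - 1` supplies the limit `1 / q!`.
      · have heq' : ((i : ℕ) : ZMod q) + 1 = ((j : ℕ) : ZMod q) := by
          rw [← sub_eq_zero, hk, heq, ZMod.natCast_self]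
        have hj0 : (j : ℕ) = 0 := by omega
        rw [div_eq_mul_one_div, heq]
        refine ((tendsto_upCoeff_zero_sub_one_div_pow).const_mul (a s)).congr'
          (hx0.mono fun x hx => ?_)
        beta_reduce
        rw [if_pos heq', hpow x hx, hk, heq, ZMod.natCast_self, hj0, Nat.cast_zero, hb0]
        ring
  have hlim1 := (tendsto_det_momentumMatrix_upCoeff ha s).norm
  refine tendsto_nhds_unique hlim1 (hlim.norm.congr' ?_)
  filter_upwards [self_mem_nhdsWithin] with x hx
  rw [hscale x hx, norm_div, norm_div, hnorm]

end Momentum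

end KickedRotor

/-! ### Cyclic distance, the symbol of the kick at `ϑ = 0`, and persistence of zeros. -/

namespace KickedRotor

open Finset ZMod Filter Topology

section Distance

variable {q : ℕ} [Fact q.Prime]

/-- The distance of `l` to `0` on the cycle `ZMod q`. -/
def circDist (l : ZMod q) : ℕ := l.valMinAbs.natAbs

lemma circDist_zero : circDist (0 : ZMod q) = 0 := by simp [circDist]

lemma circDist_neg (l : ZMod q) : circDist (-l) = circDist l := ZMod.natAbs_valMinAbs_neg l

lemma circDist_pos {l : ZMod q} (hl : l ≠ 0) : 0 < circDist l := by
  rw [circDist, Nat.pos_iff_ne_zero, Ne, Int.natAbs_eq_zero, ZMod.valMinAbs_eq_zero]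
  exact hl

lemma circDist_natCast {k : ℕ} (hk : 2 * k < q) : circDist (k : ZMod q) = k := by
  rw [circDist, ZMod.valMinAbs_natCast_of_le_half (by omega), Int.natAbs_natCast]

lemma two_mul_circDist_lt (hq : 2 < q) (l : ZMod q) : 2 * circDist l < q := by
  have h1 : circDist l ≤ q / 2 := ZMod.natAbs_valMinAbs_le l
  obtain ⟨r, hr⟩ := (Fact.out : q.Prime).odd_of_ne_two (by omega)
  omega

lemma eq_or_eq_neg_circDist (l : ZMod q) :
    l = (circDist l : ZMod q) ∨ l = -(circDist l : ZMod q) := by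
  have h := ZMod.coe_valMinAbs l
  rcases Int.natAbs_eq l.valMinAbs with h1 | h1
  · left; rw [circDist, ← Int.cast_natCast, ← h1, h]
  · right; rw [circDist, ← Int.cast_natCast, ← Int.cast_neg, ← h1, h]

lemma circDist_le_add (m n : ZMod q) : circDist m ≤ circDist n + circDist (m - n) := by
  have h := ZMod.natAbs_valMinAbs_add_le n (m - n)
  rw [add_sub_cancel] at h
  exact h.trans (Int.natAbs_add_le _ _)

/-- The sites on a geodesic from `0` to `l`. -/
lemma sum_geodesic {l : ℕ} (hl : 2 * l < q) (F : ZMod q → ℂ) :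
    ∑ n, (if circDist n + circDist ((l : ZMod q) - n) = l then F n else 0) =
      ∑ k ∈ range (l + 1), F (k : ZMod q) := by
  rw [← sum_filter]
  symm
  refine sum_nbij (fun k : ℕ => (k : ZMod q)) ?_ ?_ ?_ fun _ _ => rfl
  · intro k hk
    have hk := mem_range.mp hk
    rw [mem_filter]
    refine ⟨mem_univ _, ?_⟩
    rw [← Nat.cast_sub (by omega), circDist_natCast (by omega), circDist_natCast (by omega)]
    omega
  · intro k hk k' hk' h
    have hk := mem_range.mp hk
    have hk' := mem_range.mp hk'
    exact (natCast_eq_natCast_zmod_iff (by omega) (by omega)).mp h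
  · intro n hn
    have hn := (mem_filter.mp hn).2
    simp only [circDist] at hn
    -- The signed distances add up to `l` modulo `q`, and the difference is too small to be a
    -- nonzero multiple of `q`. Hence they add up to `l` exactly.
    have h1 : (((n.valMinAbs + ((l : ZMod q) - n).valMinAbs - l : ℤ)) : ZMod q) = 0 := by
      push_cast
      ring
    rw [ZMod.intCast_zmod_eq_zero_iff_dvd] at h1
    have h2 := Int.eq_zero_of_abs_lt_dvd h1 (by rw [abs_lt]; omega)
    refine ⟨n.valMinAbs.toNat, ?_, ?_⟩
    · simp only [coe_range, Set.mem_Iio]; omega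
    · have h3 : ((n.valMinAbs.toNat : ℕ) : ℤ) = n.valMinAbs := by omega
      simp only
      rw [← Int.cast_natCast, h3, ZMod.coe_valMinAbs]

end Distance

section Symbol

variable {q : ℕ} [Fact q.Prime]

/-- The symbol of the kick at `ϑ = 0`. -/
noncomputable def kickCoeff (x : ℂ) (l : ZMod q) : ℂ :=
  fourierCoeff (fun j => Complex.exp (x * kick {j} 0)) l

lemma kick_singleton_zero (j : ZMod q) :
    kick {j} 0 = Complex.I / 2 * (stdAddChar j + stdAddChar (-j)) := by
  simp [kick, charSum, charSumNeg]

lemma fourierCoeff_neg (E : ZMod q → ℂ) (l : ZMod q) :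
    fourierCoeff E (-l) = fourierCoeff (fun j => E (-j)) l := by
  rw [fourierCoeff, fourierCoeff, ← Equiv.sum_comp (Equiv.neg (ZMod q))]
  simp

lemma kickCoeff_neg (x : ℂ) (l : ZMod q) : kickCoeff x (-l) = kickCoeff x l := by
  rw [kickCoeff, fourierCoeff_neg, kickCoeff]
  congr 1
  ext j
  rw [kick_singleton_zero, kick_singleton_zero, neg_neg, add_comm]

lemma fourierCoeff_kick_pow (m : ℕ) (l : ZMod q) :
    fourierCoeff (fun j => kick {j} 0 ^ m) l = (Complex.I / 2) ^ m *
      ∑ i ∈ range (m + 1), if (i : ZMod q) - ((m - i : ℕ) : ZMod q) = l then (m.choose i : ℂ)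
        else 0 := by
  have h1 : ∀ j : ZMod q, kick {j} 0 ^ m * stdAddChar (-(l * j)) = (Complex.I / 2) ^ m *
      ∑ i ∈ range (m + 1), (m.choose i : ℂ) *
        stdAddChar (j * ((i : ZMod q) - ((m - i : ℕ) : ZMod q) - l)) := by
    intro j
    rw [kick_singleton_zero, mul_pow, add_pow, mul_assoc, sum_mul]
    congr 1
    refine sum_congr rfl fun i _ => ?_
    rw [← stdAddChar_eq_pow, ← stdAddChar_eq_pow, ← AddChar.map_add_eq_mul, mul_right_comm,
      ← AddChar.map_add_eq_mul, mul_comm]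
    congr 2
    ring
  simp only [fourierCoeff, h1]
  rw [← mul_sum, sum_comm, mul_left_comm, mul_sum]
  congr 1
  refine sum_congr rfl fun i _ => ?_
  rw [← mul_sum, sum_stdAddChar_mul]
  simp only [sub_eq_zero]
  split_ifs
  · rw [mul_left_comm, inv_mul_cancel₀ natCast_prime_ne_zero, mul_one]
  · simp

/-- A walk of `m ≤ k < q/2` steps `±1` is too short to wrap around the cycle. It reaches `k` only if
`m = k` and all steps go up. -/
lemma fourierCoeff_kick_pow_natCast {m k : ℕ} (hmk : m ≤ k) (hk : 2 * k < q) :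
    fourierCoeff (fun j => kick {j} 0 ^ m) (k : ZMod q) =
      if m = k then (Complex.I / 2) ^ k else 0 := by
  rw [fourierCoeff_kick_pow]
  have h1 : ∀ i ∈ range (m + 1), ((i : ZMod q) - ((m - i : ℕ) : ZMod q) = (k : ZMod q) ↔
      i = m ∧ m = k) := by
    intro i hi
    have hi := mem_range.mp hi
    rw [sub_eq_iff_eq_add, ← Nat.cast_add, natCast_eq_natCast_zmod_iff (by omega) (by omega)]
    omega
  rw [sum_congr rfl fun i hi => if_congr (h1 i hi) rfl rfl]
  by_cases h : m = k
  · subst h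
    simp
  · simp [h]

lemma fourierCoeff_kick_pow_of_le (hq : 2 < q) (l : ZMod q) {m : ℕ} (hm : m ≤ circDist l) :
    fourierCoeff (fun j => kick {j} 0 ^ m) l =
      if m = circDist l then (Complex.I / 2) ^ circDist l else 0 := by
  rcases eq_or_eq_neg_circDist l with h | h
  · conv_lhs => rw [h]
    exact fourierCoeff_kick_pow_natCast hm (two_mul_circDist_lt hq l)
  · conv_lhs => rw [h]
    rw [fourierCoeff_neg, ← fourierCoeff_kick_pow_natCast hm (two_mul_circDist_lt hq l)]
    congr 1
    ext j
    rw [kick_singleton_zero, kick_singleton_zero, neg_neg, add_comm]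

lemma tendsto_kickCoeff_div_pow (hq : 2 < q) (l : ZMod q) :
    Tendsto (fun x : ℂ => kickCoeff x l / x ^ circDist l) (𝓝[≠] 0)
      (𝓝 ((Complex.I / 2) ^ circDist l / (circDist l).factorial)) := by
  have h1 := tendsto_fourierCoeff_exp (fun j => kick {j} 0) l (circDist l)
  rw [fourierCoeff_kick_pow_of_le hq l le_rfl, if_pos rfl] at h1
  refine h1.congr fun x => ?_
  rw [sum_eq_zero, sub_zero, kickCoeff]
  intro m hm
  have hm := mem_range.mp hm
  rw [fourierCoeff_kick_pow_of_le hq l hm.le, if_neg hm.ne, mul_zero]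

lemma continuous_kickCoeff (l : ZMod q) : Continuous fun x : ℂ => kickCoeff x l := by
  unfold kickCoeff fourierCoeff
  fun_prop

lemma kickCoeff_zero (l : ZMod q) : kickCoeff 0 l = if l = 0 then 1 else 0 := by
  have h1 := fourierCoeff_stdAddChar_pow 0 l
  simp only [pow_zero, Nat.cast_zero] at h1
  simp [kickCoeff, h1, eq_comm]

/-- The symbol of the kick divided by its leading power. -/
noncomputable def scaledCoeff (l : ZMod q) : ℂ → ℂ :=
  Function.update (fun x => kickCoeff x l / x ^ circDist l) 0
    ((Complex.I / 2) ^ circDist l / (circDist l).factorial)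

lemma scaledCoeff_zero (l : ZMod q) :
    scaledCoeff l 0 = (Complex.I / 2) ^ circDist l / (circDist l).factorial :=
  Function.update_self _ _ _

lemma pow_mul_scaledCoeff (l : ZMod q) (x : ℂ) :
    x ^ circDist l * scaledCoeff l x = kickCoeff x l := by
  by_cases hx : x = 0
  · subst hx
    rw [scaledCoeff_zero, kickCoeff_zero]
    by_cases hl : l = 0
    · subst hl; simp [circDist_zero]
    · rw [if_neg hl, zero_pow (circDist_pos hl).ne', zero_mul]
  · rw [scaledCoeff, Function.update_of_ne hx, mul_div_cancel₀ _ (pow_ne_zero _ hx)]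

lemma continuous_scaledCoeff (hq : 2 < q) (l : ZMod q) : Continuous (scaledCoeff l) := by
  rw [continuous_iff_continuousAt]
  intro x
  by_cases hx : x = 0
  · subst hx
    exact continuousAt_update_same.mpr (tendsto_kickCoeff_div_pow hq l)
  · rw [scaledCoeff, continuousAt_update_of_ne hx]
    exact (continuous_kickCoeff l).continuousAt.div (by fun_prop) (pow_ne_zero _ hx)

end Symbol

/-- Persistence of a zero for small perturbations of the identity. -/
lemma exists_continuousOn_zero {h : ℂ → ℂ → ℂ} {c : ℂ} {ρ δ : ℝ} (hρ : 0 < ρ)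
    (hlip : ∀ x ∈ Metric.ball (0 : ℂ) δ, ∀ z₁ ∈ Metric.closedBall c ρ,
      ∀ z₂ ∈ Metric.closedBall c ρ, ‖h z₁ x - h z₂ x - (z₁ - z₂)‖ ≤ 1 / 2 * ‖z₁ - z₂‖)
    (hc : ∀ x ∈ Metric.ball (0 : ℂ) δ, ‖h c x‖ ≤ ρ / 2)
    (hcont : ∀ z ∈ Metric.closedBall c ρ, ContinuousOn (h z) (Metric.ball 0 δ)) :
    ∃ u : ℂ → ℂ, ContinuousOn u (Metric.ball 0 δ) ∧ ∀ x ∈ Metric.ball (0 : ℂ) δ,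
      u x ∈ Metric.closedBall c ρ ∧ h (u x) x = 0 ∧ ‖u x - c‖ ≤ 2 * ‖h c x‖ := by
  have hmem : c ∈ Metric.closedBall c ρ := Metric.mem_closedBall_self hρ.le
  have hbound : ∀ x ∈ Metric.ball (0 : ℂ) δ, ∀ z₁ ∈ Metric.closedBall c ρ,
      ∀ z₂ ∈ Metric.closedBall c ρ, ‖z₁ - z₂‖ ≤ 2 * ‖h z₁ x - h z₂ x‖ := by
    intro x hx z₁ h₁ z₂ h₂
    have h1 := hlip x hx z₁ h₁ z₂ h₂
    have h2 := norm_sub_norm_le (z₁ - z₂) (h z₁ x - h z₂ x)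
    rw [norm_sub_rev (z₁ - z₂)] at h2
    linarith
  have hex : ∀ x ∈ Metric.ball (0 : ℂ) δ, ∃ z ∈ Metric.closedBall c ρ, h z x = 0 := by
    intro x hx
    -- Zeros of `h` are fixed points of `T`, a contraction of the closed ball with constant 1/2.
    set T : ℂ → ℂ := fun z => z - h z x with hT
    have hmaps : Set.MapsTo T (Metric.closedBall c ρ) (Metric.closedBall c ρ) := by
      intro z hz
      have h1 := hlip x hx z hz c hmem
      have h2 := hc x hx
      rw [mem_closedBall_iff_norm] at hz ⊢
      calc ‖T z - c‖ = ‖-(h z x - h c x - (z - c)) - h c x‖ := by rw [hT]; congr 1; ring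
        _ ≤ ‖h z x - h c x - (z - c)‖ + ‖h c x‖ := by
          rw [← norm_neg (h z x - h c x - (z - c))]; exact norm_sub_le _ _
        _ ≤ 1 / 2 * ‖z - c‖ + ρ / 2 := add_le_add h1 h2
        _ ≤ ρ := by linarith
    have hcontr : ContractingWith (1 / 2) (hmaps.restrict T _ _) := by
      refine ⟨by rw [← NNReal.coe_lt_coe]; norm_num, LipschitzWith.of_dist_le_mul ?_⟩
      rintro ⟨z₁, h₁⟩ ⟨z₂, h₂⟩
      rw [Subtype.dist_eq, Subtype.dist_eq, dist_eq_norm, dist_eq_norm]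
      have h1 := hlip x hx z₁ h₁ z₂ h₂
      rw [← norm_neg] at h1
      simp only [Set.MapsTo.val_restrict_apply, hT]
      rw [show z₁ - h z₁ x - (z₂ - h z₂ x) = -(h z₁ x - h z₂ x - (z₁ - z₂)) by ring]
      exact_mod_cast h1
    obtain ⟨z, hz, hfix, -⟩ := hcontr.exists_fixedPoint' Metric.isClosed_closedBall.isComplete
      hmaps hmem (edist_ne_top _ _)
    refine ⟨z, hz, ?_⟩
    have h3 : z - h z x = z := hfix
    linear_combination -h3
  choose! u hu using hex
  refine ⟨u, ?_, fun x hx => ⟨(hu x hx).1, (hu x hx).2, ?_⟩⟩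
  · intro x hx
    have h1 : Tendsto (fun y => 2 * ‖h (u x) y‖) (𝓝[Metric.ball 0 δ] x) (𝓝 0) := by
      have h2 := ((hcont (u x) (hu x hx).1 x hx).norm).const_mul 2
      simpa [ContinuousWithinAt, (hu x hx).2] using h2
    rw [ContinuousWithinAt, tendsto_iff_norm_sub_tendsto_zero]
    refine squeeze_zero' (Eventually.of_forall fun _ => norm_nonneg _) ?_ h1
    filter_upwards [self_mem_nhdsWithin] with y hy
    have h3 := hbound y hy (u y) (hu y hy).1 (u x) (hu x hx).1
    rwa [(hu y hy).2, zero_sub, norm_neg] at h3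
  · have h3 := hbound x hx (u x) (hu x hx).1 c hmem
    rwa [(hu x hx).2, zero_sub, norm_neg] at h3

end KickedRotor

/-! ### Splitting of a degenerate pair by a Schur-type reduction. -/

namespace KickedRotor

open Finset ZMod Filter Topology
open scoped Matrix

section Splitting

variable {q : ℕ} [Fact q.Prime]

/-- The momentum matrix after conjugation by the powers `x ^ circDist`. -/
noncomputable def rescaledMatrix (b : ZMod q → ℂ) (z x : ℂ) : Matrix (ZMod q) (ZMod q) ℂ :=
  Matrix.of fun m n => z * (x ^ (circDist n + circDist (m - n) - circDist m) *
    scaledCoeff (m - n) x) - if m = n then b m else 0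

/-- The rescaled matrix with the rows of the sites `0` and `d` replaced by unit rows. -/
noncomputable def pinnedMatrix (b : ZMod q → ℂ) (d : ℕ) (z x : ℂ) : Matrix (ZMod q) (ZMod q) ℂ :=
  Matrix.of fun m n => if m = 0 ∨ m = (d : ZMod q) then (if m = n then 1 else 0)
    else rescaledMatrix b z x m n

/-- The solution of the rescaled equations off `0` and `d` with values `1` and `0` there. -/
noncomputable def response (b : ZMod q → ℂ) (d : ℕ) (z x : ℂ) (n : ZMod q) : ℂ :=
  (pinnedMatrix b d z x).det⁻¹ * (pinnedMatrix b d z x).adjugate n 0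

/-- The solution of the equations off `0` and `d` with values `1` and `0` there. -/
noncomputable def wave (b : ZMod q → ℂ) (d : ℕ) (z x : ℂ) (n : ZMod q) : ℂ :=
  x ^ circDist n * response b d z x n

/-- The residual of `wave` at the site `0`. -/
noncomputable def directTerm (b : ZMod q → ℂ) (d : ℕ) (z x : ℂ) : ℂ :=
  (momentumMatrix b (kickCoeff x) z *ᵥ wave b d z x) 0

/-- The residual of `wave` at the site `d`. -/
noncomputable def transferTerm (b : ZMod q → ℂ) (d : ℕ) (z x : ℂ) : ℂ :=
  (momentumMatrix b (kickCoeff x) z *ᵥ wave b d z x) d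

/-- The triangle inequality for `circDist` rules out negative powers of `x` in the conjugated
matrix, and so makes it regular at `x = 0`. -/
lemma momentumMatrix_mulVec_wave (b : ZMod q → ℂ) (d : ℕ) (z x : ℂ) (m : ZMod q) :
    (momentumMatrix b (kickCoeff x) z *ᵥ wave b d z x) m =
      x ^ circDist m * (rescaledMatrix b z x *ᵥ response b d z x) m := by
  simp only [Matrix.mulVec, dotProduct, mul_sum]
  refine sum_congr rfl fun n _ => ?_
  have h1 : x ^ circDist n * kickCoeff x (m - n) = x ^ circDist m *
      (x ^ (circDist n + circDist (m - n) - circDist m) * scaledCoeff (m - n) x) := by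
    rw [← pow_mul_scaledCoeff, ← mul_assoc, ← mul_assoc, ← pow_add, ← pow_add,
      Nat.add_sub_cancel' (circDist_le_add m n)]
  simp only [momentumMatrix, rescaledMatrix, wave, Matrix.of_apply]
  by_cases h : m = n
  · subst h
    simp only [if_true]
    linear_combination z * response b d z x m * h1
  · simp only [h, if_false, sub_zero]
    linear_combination z * response b d z x n * h1

variable {b : ZMod q → ℂ} {d : ℕ} {z x : ℂ}

lemma pinnedMatrix_mulVec_response (h : (pinnedMatrix b d z x).det ≠ 0) (m : ZMod q) :
    (pinnedMatrix b d z x *ᵥ response b d z x) m = if m = 0 then 1 else 0 := by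
  have h1 := congrFun (congrFun (Matrix.mul_adjugate (pinnedMatrix b d z x)) m) 0
  rw [Matrix.mul_apply, Matrix.smul_apply, Matrix.one_apply] at h1
  simp only [Matrix.mulVec, dotProduct, response]
  simp only [mul_left_comm _ ((pinnedMatrix b d z x).det⁻¹)]
  rw [← mul_sum, h1]
  split_ifs <;> simp [h]

lemma response_zero (h : (pinnedMatrix b d z x).det ≠ 0) : response b d z x 0 = 1 := by
  have h1 := pinnedMatrix_mulVec_response h 0
  simpa [Matrix.mulVec, dotProduct, pinnedMatrix] using h1

lemma response_end (hd : (d : ZMod q) ≠ 0) (h : (pinnedMatrix b d z x).det ≠ 0) :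
    response b d z x d = 0 := by
  have h1 := pinnedMatrix_mulVec_response h d
  simpa [Matrix.mulVec, dotProduct, pinnedMatrix, hd] using h1

lemma rescaledMatrix_mulVec_response (h : (pinnedMatrix b d z x).det ≠ 0) {m : ZMod q}
    (h0 : m ≠ 0) (hd : m ≠ d) : (rescaledMatrix b z x *ᵥ response b d z x) m = 0 := by
  have h1 := pinnedMatrix_mulVec_response h m
  rw [if_neg h0] at h1
  rw [← h1]
  simp [Matrix.mulVec, dotProduct, pinnedMatrix, h0, hd]

lemma wave_zero (h : (pinnedMatrix b d z x).det ≠ 0) : wave b d z x 0 = 1 := by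
  rw [wave, response_zero h, circDist_zero, pow_zero, one_mul]

lemma wave_end (hd : (d : ZMod q) ≠ 0) (h : (pinnedMatrix b d z x).det ≠ 0) :
    wave b d z x d = 0 := by
  rw [wave, response_end hd h, mul_zero]

lemma momentumMatrix_mulVec_wave_eq (hd : (d : ZMod q) ≠ 0)
    (h : (pinnedMatrix b d z x).det ≠ 0) :
    momentumMatrix b (kickCoeff x) z *ᵥ wave b d z x =
      Pi.single 0 (directTerm b d z x) + Pi.single (d : ZMod q) (transferTerm b d z x) := by
  ext m
  by_cases h0 : m = 0
  · subst h0; simp [directTerm, hd.symm]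
  · by_cases h1 : m = d
    · subst h1; simp [transferTerm, hd]
    · rw [momentumMatrix_mulVec_wave, rescaledMatrix_mulVec_response h h0 h1, mul_zero]
      simp [h0, h1]

lemma isSymm_momentumMatrix (b : ZMod q → ℂ) (z x : ℂ) :
    (momentumMatrix b (kickCoeff x) z)ᵀ = momentumMatrix b (kickCoeff x) z := by
  ext m n
  simp only [momentumMatrix, Matrix.transpose_apply, Matrix.of_apply]
  rw [← neg_sub m n, kickCoeff_neg]
  by_cases h : m = n
  · subst h; rfl
  · rw [if_neg h, if_neg (Ne.symm h)]

lemma dotProduct_momentumMatrix_comm (v w : ZMod q → ℂ) :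
    v ⬝ᵥ momentumMatrix b (kickCoeff x) z *ᵥ w = w ⬝ᵥ momentumMatrix b (kickCoeff x) z *ᵥ v := by
  rw [Matrix.dotProduct_mulVec, dotProduct_comm, ← Matrix.mulVec_transpose, isSymm_momentumMatrix]

lemma momentumMatrix_mulVec_sub (z₁ z₂ : ℂ) (w : ZMod q → ℂ) :
    momentumMatrix b (kickCoeff x) z₁ *ᵥ w = momentumMatrix b (kickCoeff x) z₂ *ᵥ w +
      (z₁ - z₂) • (Matrix.of fun m n => kickCoeff x (m - n)) *ᵥ w := by
  ext m
  simp only [Matrix.mulVec, dotProduct, Pi.add_apply, Pi.smul_apply, smul_eq_mul, mul_sum,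
    ← sum_add_distrib, momentumMatrix, Matrix.of_apply]
  exact sum_congr rfl fun n _ => by ring

lemma momentumMatrix_mulVec_reflect (hsymm : ∀ l, b ((d : ZMod q) - l) = b l)
    (w : ZMod q → ℂ) (m : ZMod q) :
    (momentumMatrix b (kickCoeff x) z *ᵥ fun n => w ((d : ZMod q) - n)) m =
      (momentumMatrix b (kickCoeff x) z *ᵥ w) ((d : ZMod q) - m) := by
  simp only [Matrix.mulVec, dotProduct]
  rw [← Equiv.sum_comp (Equiv.subLeft (d : ZMod q))]
  refine sum_congr rfl fun n _ => ?_
  simp only [Equiv.subLeft_apply, sub_sub_cancel, momentumMatrix, Matrix.of_apply, hsymm]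
  rw [← kickCoeff_neg, show -(m - ((d : ZMod q) - n)) = (d : ZMod q) - m - n by ring]
  have : m = (d : ZMod q) - n ↔ (d : ZMod q) - m = n :=
    ⟨fun h => by rw [h]; ring, fun h => by rw [← h]; ring⟩
  simp only [this]

/-- The form that measures the variation of the residuals with `z`. -/
noncomputable def overlap (b : ZMod q → ℂ) (d : ℕ) (σ z₁ z₂ x : ℂ) : ℂ :=
  ∑ m, (wave b d z₂ x m + σ * wave b d z₂ x ((d : ZMod q) - m)) *
    ∑ n, kickCoeff x (m - n) * wave b d z₁ x n

/-- Changing `z` adds a multiple of the kick matrix. By symmetry of the momentum matrix, pairing the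
wave at `z₁` with a combination of the wave at `z₂` and its reflection gives an exact formula for
the increment, without differentiating in `z`. -/
lemma residual_sub (hd : (d : ZMod q) ≠ 0) (hsymm : ∀ l, b ((d : ZMod q) - l) = b l) (σ : ℂ)
    {z₁ z₂ x : ℂ} (h₁ : (pinnedMatrix b d z₁ x).det ≠ 0) (h₂ : (pinnedMatrix b d z₂ x).det ≠ 0) :
    directTerm b d z₁ x + σ * transferTerm b d z₁ x -
      (directTerm b d z₂ x + σ * transferTerm b d z₂ x) =
      (z₁ - z₂) * overlap b d σ z₁ z₂ x := by
  -- The test vector takes the values 1 at site 0 and `σ` at site `d`, so it reads off the residual.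
  set w : ZMod q → ℂ := fun m => wave b d z₂ x m + σ * wave b d z₂ x ((d : ZMod q) - m) with hw
  have hw0 : w 0 = 1 := by
    rw [hw]; simp only [sub_zero, wave_zero h₂, wave_end hd h₂, mul_zero, add_zero]
  have hwd : w d = σ := by
    rw [hw]; simp only [sub_self, wave_zero h₂, wave_end hd h₂, mul_one, zero_add]
  have e1 : w ⬝ᵥ momentumMatrix b (kickCoeff x) z₁ *ᵥ wave b d z₁ x =
      directTerm b d z₁ x + σ * transferTerm b d z₁ x := by
    rw [momentumMatrix_mulVec_wave_eq hd h₁, dotProduct_add, dotProduct_single, dotProduct_single,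
      hw0, hwd, one_mul]
  have e2 : w ⬝ᵥ momentumMatrix b (kickCoeff x) z₂ *ᵥ wave b d z₁ x =
      directTerm b d z₂ x + σ * transferTerm b d z₂ x := by
    have h3 : momentumMatrix b (kickCoeff x) z₂ *ᵥ w = fun m =>
        (momentumMatrix b (kickCoeff x) z₂ *ᵥ wave b d z₂ x) m +
        σ * (momentumMatrix b (kickCoeff x) z₂ *ᵥ wave b d z₂ x) ((d : ZMod q) - m) := by
      have h4 : w = wave b d z₂ x + σ • fun m => wave b d z₂ x ((d : ZMod q) - m) := rfl
      rw [h4, Matrix.mulVec_add, Matrix.mulVec_smul]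
      ext m
      simp only [Pi.add_apply, Pi.smul_apply, smul_eq_mul, momentumMatrix_mulVec_reflect hsymm]
    rw [dotProduct_momentumMatrix_comm, h3, momentumMatrix_mulVec_wave_eq hd h₂, dotProduct,
      sum_eq_add_of_mem 0 (d : ZMod q) (mem_univ _) (mem_univ _) hd.symm]
    · simp [wave_zero h₁, wave_end hd h₁, hd, hd.symm]
    · rintro m - ⟨hm0, hmd⟩
      have : (d : ZMod q) - m ≠ 0 := sub_ne_zero.mpr hmd.symm
      simp [hm0, hmd, this]
  rw [← e1, ← e2, momentumMatrix_mulVec_sub z₁ z₂, dotProduct_add, add_sub_cancel_left,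
    dotProduct_smul, smul_eq_mul]
  rfl

/-- The wave plus `σ` times its reflection is a null vector: its residuals at 0 and `d` are the
assumed combination and `σ` times it. It is nonzero because it equals 1 at site 0 up to the
reflected wave, which vanishes there. -/
lemma det_momentumMatrix_eq_zero (hd : (d : ZMod q) ≠ 0)
    (hsymm : ∀ l, b ((d : ZMod q) - l) = b l) {σ : ℂ} (hσ : σ * σ = 1)
    (h : (pinnedMatrix b d z x).det ≠ 0)
    (hz : directTerm b d z x + σ * transferTerm b d z x = 0) :
    (momentumMatrix b (kickCoeff x) z).det = 0 := by
  refine Matrix.exists_mulVec_eq_zero_iff.mp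
    ⟨wave b d z x + σ • fun m => wave b d z x ((d : ZMod q) - m), ?_, ?_⟩
  · intro h0
    have := congrFun h0 0
    simp [wave_zero h, wave_end hd h] at this
  · rw [Matrix.mulVec_add, Matrix.mulVec_smul]
    ext m
    simp only [Pi.add_apply, Pi.smul_apply, smul_eq_mul, momentumMatrix_mulVec_reflect hsymm,
      momentumMatrix_mulVec_wave_eq hd h, Pi.single_apply, Pi.zero_apply, sub_eq_zero,
      eq_comm (a := (d : ZMod q)) (b := m), sub_eq_self]
    by_cases h0 : m = 0
    · subst h0
      simp only [hd.symm, if_true, if_false]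
      linear_combination hz
    · by_cases h1 : m = d
      · subst h1
        simp only [hd, if_true, if_false]
        linear_combination σ * hz - transferTerm b d z x * hσ
      · simp [h0, h1]

lemma continuous_pinnedMatrix (hq : 2 < q) (b : ZMod q → ℂ) (d : ℕ) :
    Continuous fun p : ℂ × ℂ => pinnedMatrix b d p.1 p.2 := by
  refine continuous_matrix fun m n => ?_
  simp only [pinnedMatrix, rescaledMatrix, Matrix.of_apply]
  by_cases h : m = 0 ∨ m = (d : ZMod q)
  · simp only [h, if_true]; exact continuous_const
  · simp only [h, if_false]
    have := (continuous_scaledCoeff hq (m - n)).comp (continuous_snd (X := ℂ) (Y := ℂ))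
    exact (continuous_fst.mul ((continuous_snd.pow _).mul this)).sub continuous_const

lemma continuousAt_response (hq : 2 < q) {p : ℂ × ℂ} (h : (pinnedMatrix b d p.1 p.2).det ≠ 0)
    (n : ZMod q) : ContinuousAt (fun p : ℂ × ℂ => response b d p.1 p.2 n) p := by
  have h1 := continuous_pinnedMatrix hq b d
  refine ContinuousAt.mul (ContinuousAt.inv₀ h1.matrix_det.continuousAt h) ?_
  exact (h1.matrix_adjugate.matrix_elem n 0).continuousAt

lemma continuousAt_wave (hq : 2 < q) {p : ℂ × ℂ} (h : (pinnedMatrix b d p.1 p.2).det ≠ 0)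
    (n : ZMod q) : ContinuousAt (fun p : ℂ × ℂ => wave b d p.1 p.2 n) p :=
  (continuous_snd.pow _).continuousAt.mul (continuousAt_response hq h n)

lemma continuousAt_residual (hq : 2 < q) {p : ℂ × ℂ} (h : (pinnedMatrix b d p.1 p.2).det ≠ 0)
    (m : ZMod q) : ContinuousAt (fun p : ℂ × ℂ =>
      (momentumMatrix b (kickCoeff p.2) p.1 *ᵥ wave b d p.1 p.2) m) p := by
  simp only [Matrix.mulVec, dotProduct]
  refine tendsto_finsetSum _ fun n _ => ContinuousAt.mul ?_ (continuousAt_wave hq h n)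
  simp only [momentumMatrix, Matrix.of_apply]
  have h2 := (continuous_kickCoeff (m - n)).comp (continuous_snd (X := ℂ) (Y := ℂ))
  exact ((continuous_fst.mul h2).sub continuous_const).continuousAt

lemma continuousAt_rescaled_residual (hq : 2 < q) {p : ℂ × ℂ}
    (h : (pinnedMatrix b d p.1 p.2).det ≠ 0) (m : ZMod q) : ContinuousAt (fun p : ℂ × ℂ =>
      (rescaledMatrix b p.1 p.2 *ᵥ response b d p.1 p.2) m) p := by
  simp only [Matrix.mulVec, dotProduct]
  refine tendsto_finsetSum _ fun n _ => ContinuousAt.mul ?_ (continuousAt_response hq h n)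
  simp only [rescaledMatrix, Matrix.of_apply]
  have h2 := (continuous_scaledCoeff hq (m - n)).comp (continuous_snd (X := ℂ) (Y := ℂ))
  exact ((continuous_fst.mul ((continuous_snd.pow _).mul h2)).sub continuous_const).continuousAt

lemma rescaledMatrix_zero_apply (m n : ZMod q) : rescaledMatrix b z 0 m n =
    (if circDist n + circDist (m - n) = circDist m then
      z * ((Complex.I / 2) ^ circDist (m - n) / (circDist (m - n)).factorial) else 0) -
      if m = n then b m else 0 := by
  have h1 := circDist_le_add m n
  simp only [rescaledMatrix, Matrix.of_apply, zero_pow_eq, scaledCoeff_zero]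
  by_cases h : circDist n + circDist (m - n) = circDist m
  · rw [if_pos (by omega), if_pos h, one_mul]
  · rw [if_neg (by omega), if_neg h, zero_mul, mul_zero]

/-- At `x = 0` only hops along geodesics from 0 survive, so the matrix is triangular with respect to
`circDist`, with diagonal entries `b 0 - b m` or 1. -/
lemma det_pinnedMatrix_ne_zero (hne : ∀ l, l ≠ 0 → l ≠ (d : ZMod q) → b l ≠ b 0) :
    (pinnedMatrix b d (b 0) 0).det ≠ 0 := by
  intro hdet
  obtain ⟨w, hw, hw0⟩ := Matrix.exists_mulVec_eq_zero_iff.mpr hdet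
  refine hw (funext fun m => ?_)
  induction hk : circDist m using Nat.strong_induction_on generalizing m with
  | _ k ih =>
    have h1 := congrFun hw0 m
    simp only [Matrix.mulVec, dotProduct, Pi.zero_apply] at h1 ⊢
    rw [sum_eq_single_of_mem m (mem_univ _)] at h1
    · refine (mul_eq_zero.mp h1).resolve_left ?_
      simp only [pinnedMatrix, Matrix.of_apply]
      by_cases h : m = 0 ∨ m = (d : ZMod q)
      · simp [h]
      · rw [if_neg h, rescaledMatrix_zero_apply]
        push Not at h
        simpa [circDist_zero, sub_eq_zero] using (hne m h.1 h.2).symm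
    · intro n _ hnm
      simp only [pinnedMatrix, Matrix.of_apply]
      by_cases h : m = 0 ∨ m = (d : ZMod q)
      · simp [h, Ne.symm hnm]
      · rw [if_neg h, rescaledMatrix_zero_apply, if_neg (Ne.symm hnm), sub_zero]
        split_ifs with h2
        · have h3 := circDist_pos (sub_ne_zero.mpr (Ne.symm hnm))
          rw [ih (circDist n) (by omega) n rfl, Pi.zero_apply, mul_zero]
        · rw [zero_mul]

lemma rescaledMatrix_zero_mulVec {l : ℕ} (hl : 2 * l < q) (w : ZMod q → ℂ) :
    (rescaledMatrix b z 0 *ᵥ w) l = ∑ k ∈ range (l + 1),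
      z * ((Complex.I / 2) ^ (l - k) / (l - k).factorial) * w (k : ZMod q) - b l * w l := by
  simp only [Matrix.mulVec, dotProduct, rescaledMatrix_zero_apply, sub_mul, sum_sub_distrib,
    ite_mul, zero_mul]
  congr 1
  · rw [circDist_natCast hl, sum_geodesic hl (fun n => z * ((Complex.I / 2) ^
      circDist ((l : ZMod q) - n) / (circDist ((l : ZMod q) - n)).factorial) * w n)]
    refine sum_congr rfl fun k hk => ?_
    have hk := mem_range.mp hk
    rw [← Nat.cast_sub (by omega), circDist_natCast (by omega)]
  · simp

/-- Along the geodesic from 0 to `d` the limiting equations are the ladder recursion, with a factor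
`i/2` for each unit of length. -/
lemma response_natCast (hb : b 0 ≠ 0) (hd : 2 * d < q)
    (hne : ∀ l, l ≠ 0 → l ≠ (d : ZMod q) → b l ≠ b 0) {l : ℕ} (hl : l < d) :
    response b d (b 0) 0 (l : ZMod q) =
      (Complex.I / 2) ^ l * ladder (fun k : ℕ => b k / b 0) l := by
  have hdet := det_pinnedMatrix_ne_zero hne
  induction l using Nat.strong_induction_on with
  | _ l ih =>
    rcases Nat.eq_zero_or_pos l with rfl | h0
    · rw [Nat.cast_zero, response_zero hdet, pow_zero, ladder_zero, one_mul]
    · have hl0 : (l : ZMod q) ≠ 0 := natCast_ne_zero_zmod h0 (by omega)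
      have hld : (l : ZMod q) ≠ d := by
        rw [Ne, natCast_eq_natCast_zmod_iff (by omega) (by omega)]; omega
      have h1 := rescaledMatrix_mulVec_response hdet hl0 hld
      rw [rescaledMatrix_zero_mulVec (by omega), sum_range_succ, Nat.sub_self, pow_zero,
        Nat.factorial_zero, Nat.cast_one, div_one, mul_one] at h1
      have h2 : ∑ k ∈ range l, b 0 * ((Complex.I / 2) ^ (l - k) / (l - k).factorial) *
          response b d (b 0) 0 (k : ZMod q) = b 0 * (Complex.I / 2) ^ l *
          transmission (fun k : ℕ => b k / b 0) l := by
        rw [transmission, mul_sum]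
        refine sum_congr rfl fun k hk => ?_
        have hk := mem_range.mp hk
        rw [ih k hk (by omega)]
        have h3 : (Complex.I / 2) ^ l = (Complex.I / 2) ^ (l - k) * (Complex.I / 2) ^ k := by
          rw [← pow_add]; congr 1; omega
        rw [h3]; ring
      rw [h2] at h1
      have h4 : b l - b 0 ≠ 0 := sub_ne_zero.mpr (hne _ hl0 hld)
      have h5 : b l / b 0 - 1 = (b l - b 0) / b 0 := by field_simp
      rw [ladder_of_pos _ h0, h5, inv_div]
      field_simp
      linear_combination -h1

lemma rescaled_transfer (hb : b 0 ≠ 0) (hd : 2 * d < q) (hd0 : (d : ZMod q) ≠ 0)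
    (hne : ∀ l, l ≠ 0 → l ≠ (d : ZMod q) → b l ≠ b 0) :
    (rescaledMatrix b (b 0) 0 *ᵥ response b d (b 0) 0) d =
      b 0 * (Complex.I / 2) ^ d * transmission (fun k : ℕ => b k / b 0) d := by
  have hdet := det_pinnedMatrix_ne_zero hne
  rw [rescaledMatrix_zero_mulVec hd, sum_range_succ, response_end hd0 hdet, mul_zero, mul_zero,
    add_zero, sub_zero, transmission, mul_sum]
  refine sum_congr rfl fun k hk => ?_
  have hk := mem_range.mp hk
  rw [response_natCast hb hd hne hk]
  have h3 : (Complex.I / 2) ^ d = (Complex.I / 2) ^ (d - k) * (Complex.I / 2) ^ k := by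
    rw [← pow_add]; congr 1; omega
  rw [h3]; ring

lemma wave_at_zero (hdet : (pinnedMatrix b d z 0).det ≠ 0) (n : ZMod q) :
    wave b d z 0 n = if n = 0 then 1 else 0 := by
  by_cases h : n = 0
  · rw [if_pos h, h, wave_zero hdet]
  · rw [if_neg h, wave, zero_pow (circDist_pos h).ne', zero_mul]

lemma residual_at_zero (hdet : (pinnedMatrix b d (b 0) 0).det ≠ 0) (m : ZMod q) :
    (momentumMatrix b (kickCoeff 0) (b 0) *ᵥ wave b d (b 0) 0) m = 0 := by
  simp only [Matrix.mulVec, dotProduct, wave_at_zero hdet, momentumMatrix, Matrix.of_apply,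
    kickCoeff_zero]
  by_cases h : m = 0
  · subst h; simp
  · simp [h]

lemma overlap_at_zero (hd : (d : ZMod q) ≠ 0) (hdet : (pinnedMatrix b d z 0).det ≠ 0) (σ : ℂ) :
    overlap b d σ z z 0 = 1 := by
  simp only [overlap, wave_at_zero hdet, kickCoeff_zero]
  simp [sub_eq_zero, hd]

lemma continuousAt_overlap (hq : 2 < q) (σ : ℂ) {p : ℂ × ℂ × ℂ}
    (h₁ : (pinnedMatrix b d p.1 p.2.2).det ≠ 0) (h₂ : (pinnedMatrix b d p.2.1 p.2.2).det ≠ 0) :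
    ContinuousAt (fun p : ℂ × ℂ × ℂ => overlap b d σ p.1 p.2.1 p.2.2) p := by
  have hw₁ : ∀ n, ContinuousAt (fun p : ℂ × ℂ × ℂ => wave b d p.1 p.2.2 n) p := fun n =>
    ContinuousAt.comp (f := fun p : ℂ × ℂ × ℂ => (p.1, p.2.2))
      (continuousAt_wave hq (p := (p.1, p.2.2)) h₁ n) (by fun_prop)
  have hw₂ : ∀ n, ContinuousAt (fun p : ℂ × ℂ × ℂ => wave b d p.2.1 p.2.2 n) p := fun n =>
    ContinuousAt.comp (f := fun p : ℂ × ℂ × ℂ => (p.2.1, p.2.2))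
      (continuousAt_wave hq (p := (p.2.1, p.2.2)) h₂ n) (by fun_prop)
  refine tendsto_finsetSum _ fun m _ => ContinuousAt.mul
    ((hw₂ m).add (continuousAt_const.mul (hw₂ _))) (tendsto_finsetSum _ fun n _ =>
      ContinuousAt.mul ?_ (hw₁ n))
  exact ((continuous_kickCoeff (m - n)).comp (continuous_snd.comp continuous_snd)).continuousAt

/-- An eigenvalue branch of definite parity. -/
lemma exists_branch (hq : 2 < q) (hd : (d : ZMod q) ≠ 0)
    (hsymm : ∀ l, b ((d : ZMod q) - l) = b l)
    (hne : ∀ l, l ≠ 0 → l ≠ (d : ZMod q) → b l ≠ b 0) {σ : ℂ} (hσ : σ * σ = 1) :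
    ∃ δ > 0, ∃ u : ℂ → ℂ, ContinuousOn u (Metric.ball 0 δ) ∧ u 0 = b 0 ∧
      ∀ x ∈ Metric.ball (0 : ℂ) δ, (momentumMatrix b (kickCoeff x) (u x)).det = 0 ∧
        directTerm b d (u x) x + σ * transferTerm b d (u x) x = 0 := by
  have hdet := det_pinnedMatrix_ne_zero hne
  have hopen : ∀ᶠ p : ℂ × ℂ × ℂ in 𝓝 (b 0, b 0, 0), (pinnedMatrix b d p.1 p.2.2).det ≠ 0 := by
    have h1 : Continuous fun p : ℂ × ℂ × ℂ => (pinnedMatrix b d p.1 p.2.2).det :=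
      ((continuous_pinnedMatrix hq b d).matrix_det).comp
        (f := fun p : ℂ × ℂ × ℂ => (p.1, p.2.2)) (by fun_prop)
    exact h1.continuousAt.eventually_ne hdet
  -- The overlap is the difference quotient of the residual in `z`. Keeping it near 1 makes the
  -- residual a small perturbation of the identity.
  have hover : ∀ᶠ p : ℂ × ℂ × ℂ in 𝓝 (b 0, b 0, 0),
      ‖overlap b d σ p.1 p.2.1 p.2.2 - 1‖ < 1 / 2 := by
    have h1 := continuousAt_overlap hq σ (p := (b 0, b 0, 0)) hdet hdet
    have h2 := Metric.continuousAt_iff'.mp h1 (1 / 2) (by norm_num)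
    simpa only [overlap_at_zero hd hdet, dist_eq_norm] using h2
  obtain ⟨ε, hε, hball⟩ := Metric.eventually_nhds_iff_ball.mp (hopen.and hover)
  set ρ := ε / 2 with hρ
  have hρ0 : 0 < ρ := half_pos hε
  have hmem : ∀ z₁ ∈ Metric.closedBall (b 0) ρ, ∀ z₂ ∈ Metric.closedBall (b 0) ρ,
      ∀ x ∈ Metric.ball (0 : ℂ) ρ, (z₁, z₂, x) ∈ Metric.ball (b 0, b 0, (0 : ℂ)) ε := by
    intro z₁ h₁ z₂ h₂ x hx
    rw [Metric.mem_closedBall] at h₁ h₂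
    rw [Metric.mem_ball] at hx ⊢
    rw [Prod.dist_eq, Prod.dist_eq]
    refine max_lt ?_ (max_lt ?_ ?_) <;> simp only <;> linarith
  have hres : ∀ p : ℂ × ℂ, (pinnedMatrix b d p.1 p.2).det ≠ 0 → ContinuousAt (fun p : ℂ × ℂ =>
      directTerm b d p.1 p.2 + σ * transferTerm b d p.1 p.2) p := fun p hp =>
    (continuousAt_residual hq hp 0).add (continuousAt_const.mul (continuousAt_residual hq hp d))
  have hres0 : directTerm b d (b 0) 0 + σ * transferTerm b d (b 0) 0 = 0 := by
    rw [directTerm, transferTerm, residual_at_zero hdet, residual_at_zero hdet, mul_zero, add_zero]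
  have hsmall : ∀ᶠ x : ℂ in 𝓝 0,
      ‖directTerm b d (b 0) x + σ * transferTerm b d (b 0) x‖ < ρ / 2 := by
    have h1 : ContinuousAt (fun x => directTerm b d (b 0) x + σ * transferTerm b d (b 0) x) 0 :=
      ContinuousAt.comp (f := fun x : ℂ => (b 0, x)) (hres (b 0, 0) hdet) (by fun_prop)
    have h2 := Metric.continuousAt_iff'.mp h1 (ρ / 2) (half_pos hρ0)
    simpa only [hres0, dist_zero_right] using h2
  obtain ⟨δ', hδ', hball'⟩ := Metric.eventually_nhds_iff_ball.mp hsmall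
  set δ := min ρ δ' with hδ
  have hsub : ∀ x ∈ Metric.ball (0 : ℂ) δ, x ∈ Metric.ball (0 : ℂ) ρ := fun x hx =>
    Metric.ball_subset_ball (min_le_left _ _) hx
  have hdet' : ∀ z ∈ Metric.closedBall (b 0) ρ, ∀ x ∈ Metric.ball (0 : ℂ) δ,
      (pinnedMatrix b d z x).det ≠ 0 := fun z hz x hx =>
    (hball (z, z, x) (hmem z hz z hz x (hsub x hx))).1
  obtain ⟨u, hu, hu'⟩ := exists_continuousOn_zero (c := b 0) (δ := δ)
    (h := fun z x => directTerm b d z x + σ * transferTerm b d z x) hρ0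
    (fun x hx z₁ h₁ z₂ h₂ => by
      rw [residual_sub hd hsymm σ (hdet' z₁ h₁ x hx) (hdet' z₂ h₂ x hx)]
      have h1 := (hball (z₁, z₂, x) (hmem z₁ h₁ z₂ h₂ x (hsub x hx))).2.le
      rw [show (z₁ - z₂) * overlap b d σ z₁ z₂ x - (z₁ - z₂) =
        (overlap b d σ z₁ z₂ x - 1) * (z₁ - z₂) by ring, norm_mul]
      gcongr)
    (fun x hx => (hball' x (Metric.ball_subset_ball (min_le_right _ _) hx)).le)
    (fun z hz x hx => (ContinuousAt.comp (f := fun x : ℂ => (z, x))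
      (hres (z, x) (hdet' z hz x hx)) (by fun_prop)).continuousWithinAt)
  have hδ0 : 0 < δ := lt_min hρ0 hδ'
  refine ⟨δ, hδ0, u, hu, ?_, fun x hx => ⟨?_, (hu' x hx).2.1⟩⟩
  · have h1 := (hu' 0 (Metric.mem_ball_self hδ0)).2.2
    simp only [hres0, norm_zero, mul_zero] at h1
    exact sub_eq_zero.mp (norm_le_zero_iff.mp h1)
  · exact det_momentumMatrix_eq_zero hd hsymm hσ (hdet' _ (hu' x hx).1 x hx) (hu' x hx).2.1

lemma transferTerm_eq (hd : 2 * d < q) (z x : ℂ) : transferTerm b d z x =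
    x ^ d * (rescaledMatrix b z x *ᵥ response b d z x) d := by
  rw [transferTerm, momentumMatrix_mulVec_wave, circDist_natCast hd]

/-- The two eigenvalues that emerge from a degenerate pair at distance `d` split at order `d`. -/
theorem exists_splitting (hq : 2 < q) (hd0 : 0 < d) (hd : 2 * d < q) (hb : b 0 ≠ 0)
    (hsymm : ∀ l, b ((d : ZMod q) - l) = b l)
    (hne : ∀ l, l ≠ 0 → l ≠ (d : ZMod q) → b l ≠ b 0) :
    ∃ δ > 0, ∃ u₁ u₂ : ℂ → ℂ, ContinuousOn u₁ (Metric.ball 0 δ) ∧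
      ContinuousOn u₂ (Metric.ball 0 δ) ∧ u₁ 0 = b 0 ∧ u₂ 0 = b 0 ∧
      (∀ x ∈ Metric.ball (0 : ℂ) δ, (momentumMatrix b (kickCoeff x) (u₁ x)).det = 0 ∧
        (momentumMatrix b (kickCoeff x) (u₂ x)).det = 0) ∧
      Tendsto (fun x => (u₁ x - u₂ x) / x ^ d) (𝓝[≠] 0)
        (𝓝 (-2 * (b 0 * (Complex.I / 2) ^ d * transmission (fun k : ℕ => b k / b 0) d))) := by
  have hd' : (d : ZMod q) ≠ 0 := natCast_ne_zero_zmod hd0 (by omega)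
  have hdet := det_pinnedMatrix_ne_zero hne
  -- The two branches are even (`σ = 1`) and odd (`σ = -1`) under the reflection `l ↦ d - l`.
  obtain ⟨δ₁, hδ₁, u₁, hu₁, hu₁0, h₁⟩ := exists_branch hq hd' hsymm hne (σ := 1) (by norm_num)
  obtain ⟨δ₂, hδ₂, u₂, hu₂, hu₂0, h₂⟩ := exists_branch hq hd' hsymm hne (σ := -1) (by norm_num)
  set δ := min δ₁ δ₂ with hδ
  have hδ0 : 0 < δ := lt_min hδ₁ hδ₂
  have hs₁ : Metric.ball (0 : ℂ) δ ⊆ Metric.ball 0 δ₁ := Metric.ball_subset_ball (min_le_left _ _)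
  have hs₂ : Metric.ball (0 : ℂ) δ ⊆ Metric.ball 0 δ₂ := Metric.ball_subset_ball (min_le_right _ _)
  refine ⟨δ, hδ0, u₁, u₂, hu₁.mono hs₁, hu₂.mono hs₂, hu₁0, hu₂0,
    fun x hx => ⟨(h₁ x (hs₁ hx)).1, (h₂ x (hs₂ hx)).1⟩, ?_⟩
  have hc₁ : ContinuousAt u₁ 0 := hu₁.continuousAt (Metric.ball_mem_nhds 0 hδ₁)
  have hc₂ : ContinuousAt u₂ 0 := hu₂.continuousAt (Metric.ball_mem_nhds 0 hδ₂)
  have hdet₁ : (pinnedMatrix b d (u₁ 0) 0).det ≠ 0 := by rw [hu₁0]; exact hdet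
  have hdet₂ : (pinnedMatrix b d (u₂ 0) 0).det ≠ 0 := by rw [hu₂0]; exact hdet
  have hp₁ : ContinuousAt (fun x => (u₁ x, x)) 0 := hc₁.prodMk continuousAt_id
  have hp₂ : ContinuousAt (fun x => (u₂ x, x)) 0 := hc₂.prodMk continuousAt_id
  have hF₁ : ContinuousAt (fun x => (rescaledMatrix b (u₁ x) x *ᵥ response b d (u₁ x) x) d) 0 :=
    ContinuousAt.comp (f := fun x => (u₁ x, x))
      (continuousAt_rescaled_residual hq (p := (u₁ 0, 0)) hdet₁ d) hp₁
  have hF₂ : ContinuousAt (fun x => (rescaledMatrix b (u₂ x) x *ᵥ response b d (u₂ x) x) d) 0 :=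
    ContinuousAt.comp (f := fun x => (u₂ x, x))
      (continuousAt_rescaled_residual hq (p := (u₂ 0, 0)) hdet₂ d) hp₂
  have hK : ContinuousAt (fun x => overlap b d 0 (u₁ x) (u₂ x) x) 0 :=
    ContinuousAt.comp (f := fun x => (u₁ x, u₂ x, x))
      (continuousAt_overlap hq 0 (p := (u₁ 0, u₂ 0, 0)) hdet₁ hdet₂)
      (hc₁.prodMk (hc₂.prodMk continuousAt_id))
  have hK0 : overlap b d 0 (u₁ 0) (u₂ 0) 0 = 1 := by
    rw [hu₁0, hu₂0]; exact overlap_at_zero hd' hdet 0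
  have hopen : ∀ᶠ x in 𝓝 (0 : ℂ), (pinnedMatrix b d (u₁ x) x).det ≠ 0 ∧
      (pinnedMatrix b d (u₂ x) x).det ≠ 0 ∧ overlap b d 0 (u₁ x) (u₂ x) x ≠ 0 := by
    have hcont := (continuous_pinnedMatrix hq b d).matrix_det
    refine ((hcont.continuousAt.comp (f := fun x => (u₁ x, x)) hp₁).eventually_ne hdet₁).and
      (((hcont.continuousAt.comp (f := fun x => (u₂ x, x)) hp₂).eventually_ne hdet₂).and
        (hK.eventually_ne ?_))
    rw [hK0]; exact one_ne_zero
  have hlim : Tendsto (fun x => -((rescaledMatrix b (u₁ x) x *ᵥ response b d (u₁ x) x) d +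
      (rescaledMatrix b (u₂ x) x *ᵥ response b d (u₂ x) x) d) / overlap b d 0 (u₁ x) (u₂ x) x)
      (𝓝[≠] 0) (𝓝 (-2 * (b 0 * (Complex.I / 2) ^ d *
        transmission (fun k : ℕ => b k / b 0) d))) := by
    have h3 := ((hF₁.add hF₂).neg.div hK (by rw [hK0]; exact one_ne_zero)).tendsto.mono_left
      (nhdsWithin_le_nhds (s := {0}ᶜ))
    simp only [Pi.add_apply, Pi.neg_apply, Pi.div_apply, hu₁0, hu₂0, overlap_at_zero hd' hdet] at h3
    rw [rescaled_transfer hb hd hd' hne, div_one] at h3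
    rw [show ∀ w : ℂ, -2 * w = -(w + w) from fun w => by ring]
    exact h3
  refine hlim.congr' ?_
  filter_upwards [self_mem_nhdsWithin, nhdsWithin_le_nhds hopen,
    nhdsWithin_le_nhds (Metric.ball_mem_nhds (0 : ℂ) hδ0)] with x hx0 hx hxδ
  have hx0 : x ≠ 0 := hx0
  -- With `σ = 0` this expresses the difference of the direct terms as `(u₁ - u₂)` times the
  -- overlap. The direct term is minus the transfer term on the first branch and plus it on the
  -- second, whence the factor `-2` in the limit.
  have e := residual_sub hd' hsymm 0 hx.1 hx.2.1
  have e₁ := (h₁ x (hs₁ hxδ)).2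
  have e₂ := (h₂ x (hs₂ hxδ)).2
  rw [transferTerm_eq hd] at e₁ e₂
  rw [div_eq_div_iff hx.2.2 (pow_ne_zero _ hx0)]
  linear_combination e - e₁ + e₂

end Splitting

end KickedRotor

/-! ### Roots of perturbed polynomials with known separation. -/

namespace KickedRotor

open Finset Filter Topology Polynomial

section Roots

/-- `P'/P` at `u` is the sum of `1 / (u - w)` over the roots. If every root were farther away, this
sum would be too small. -/
lemma exists_root_norm_sub_mul_le {P : ℂ[X]} (hP : P ≠ 0) {u : ℂ} (hd : P.derivative.eval u ≠ 0) :
    ∃ w, P.eval w = 0 ∧ ‖w - u‖ * ‖P.derivative.eval u‖ ≤ P.natDegree * ‖P.eval u‖ := by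
  by_cases h0 : P.eval u = 0
  · exact ⟨u, h0, by simp [h0]⟩
  have hs := IsAlgClosed.splits P
  have h1 := hs.eval_derivative_div_eval_of_ne_zero h0
  by_contra! hcon
  have hpos : 0 < ‖P.eval u‖ := norm_pos_iff.mpr h0
  have hroot : ∀ w ∈ P.roots, P.eval w = 0 := fun w hw => (mem_roots hP).mp hw
  have h2 : ∀ w ∈ P.roots, ‖1 / (u - w)‖ * (P.natDegree * ‖P.eval u‖) < ‖P.derivative.eval u‖ := by
    intro w hw
    have h3 := hcon w (hroot w hw)
    have h4 : 0 < ‖w - u‖ := by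
      rw [norm_pos_iff, sub_ne_zero]; rintro rfl; exact h0 (hroot w hw)
    rw [norm_div, norm_one, norm_sub_rev, one_div, inv_mul_lt_iff₀ h4]
    exact h3
  have h5 : ‖(P.roots.map fun z => 1 / (u - z)).sum‖ ≤ (P.roots.map fun z => ‖1 / (u - z)‖).sum := by
    have := Multiset.le_sum_of_subadditive (fun z : ℂ => ‖z‖) norm_zero.le norm_add_le
      (P.roots.map fun z => 1 / (u - z))
    simpa [Multiset.map_map] using this
  have hne : P.roots ≠ 0 := by
    intro h6
    rw [h6] at h1
    simp only [Multiset.map_zero, Multiset.sum_zero, div_eq_zero_iff] at h1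
    exact h1.elim hd h0
  have h7 : (P.roots.map fun z => ‖1 / (u - z)‖ * (P.natDegree * ‖P.eval u‖)).sum <
      (P.roots.map fun _ => ‖P.derivative.eval u‖).sum :=
    Multiset.sum_lt_sum_of_nonempty hne h2
  rw [Multiset.sum_map_mul_right, Multiset.map_const', Multiset.sum_replicate,
    ← hs.natDegree_eq_card_roots, nsmul_eq_mul] at h7
  rw [← h1, norm_div, div_le_iff₀ hpos] at h5
  have h8 : (P.natDegree : ℝ) * ‖P.derivative.eval u‖ ≤
      (P.roots.map fun z => ‖1 / (u - z)‖).sum * (P.natDegree * ‖P.eval u‖) := by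
    rw [mul_left_comm]
    exact mul_le_mul_of_nonneg_left h5 (Nat.cast_nonneg _)
  exact absurd h7 (not_lt.mpr h8)

lemma eq_prod_X_sub_C_of_injective {ι : Type*} [Fintype ι] {P : ℂ[X]} (hP : P.Monic)
    (hdeg : P.natDegree = Fintype.card ι) {w : ι → ℂ} (hw : Function.Injective w)
    (hroot : ∀ t, P.eval (w t) = 0) : P = ∏ t, (X - C (w t)) := by
  have h1 : ∏ t, (X - C (w t)) ∣ P := by
    refine Finset.prod_dvd_of_coprime ?_ fun t _ => dvd_iff_isRoot.mpr (hroot t)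
    exact fun s _ t _ hst => pairwise_coprime_X_sub_C hw hst
  have hm : (∏ t, (X - C (w t))).Monic := monic_prod_of_monic _ _ fun t _ => monic_X_sub_C _
  exact eq_of_monic_of_dvd_of_natDegree_le hm hP h1 (by simp [hdeg])

lemma eval_derivative_prod_X_sub_C {ι : Type*} [Fintype ι] [DecidableEq ι] (w : ι → ℂ) (t : ι) :
    (∏ s, (X - C (w s))).derivative.eval (w t) = ∏ s ∈ univ.erase t, (w t - w s) := by
  rw [derivative_prod_finset, eval_finsetSum, sum_eq_single t]
  · simp [eval_prod]
  · intro s _ hs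
    rw [eval_mul, eval_prod, prod_eq_zero (mem_erase.mpr ⟨hs.symm, mem_univ t⟩) (by simp), zero_mul]
  · simp

/-- The first factor vanishes at the point, so mere continuity of the second is enough. This allows
the other roots to enter before they are known to be differentiable. -/
lemma hasDerivAt_mul_of_continuousAt {g k : ℝ → ℂ} {g' : ℂ} {x : ℝ} (hg : HasDerivAt g g' x)
    (h0 : g x = 0) (hk : ContinuousAt k x) : HasDerivAt (fun y => g y * k y) (g' * k x) x := by
  rw [hasDerivAt_iff_tendsto_slope] at hg ⊢
  refine (hg.mul (hk.tendsto.mono_left nhdsWithin_le_nhds)).congr fun y => ?_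
  simp only [slope, h0, vsub_eq_sub, sub_zero, smul_mul_assoc, zero_mul]

lemma monic_sum_C_mul_X_pow {m : ℕ} {c : ℕ → ℂ} (hc : c m = 1) :
    (∑ n ∈ range (m + 1), C (c n) * X ^ n).Monic ∧
    (∑ n ∈ range (m + 1), C (c n) * X ^ n).natDegree = m := by
  rw [sum_range_succ, hc, C_1, one_mul, add_comm]
  have hlt : (∑ n ∈ range m, C (c n) * X ^ n).degree < (m : WithBot ℕ) := by
    refine (degree_sum_le _ _).trans_lt ((Finset.sup_lt_iff (WithBot.bot_lt_coe _)).mpr ?_)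
    intro n hn
    exact (degree_C_mul_X_pow_le n _).trans_lt (by exact_mod_cast mem_range.mp hn)
  refine ⟨monic_X_pow_add hlt, ?_⟩
  rw [natDegree_add_eq_left_of_degree_lt (by simpa using hlt), natDegree_X_pow]

lemma nextCoeff_sum_C_mul_X_pow {m : ℕ} {c : ℕ → ℂ} (hc : c m = 1) (hm : 0 < m) :
    (∑ n ∈ range (m + 1), C (c n) * X ^ n).nextCoeff = c (m - 1) := by
  have h := (monic_sum_C_mul_X_pow hc).2
  rw [nextCoeff_of_natDegree_pos (h.symm ▸ hm), h, finsetSum_coeff, sum_eq_single (m - 1)]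
  · simp
  · intro n _ hn
    rw [coeff_C_mul_X_pow, if_neg hn.symm]
  · intro hn
    exact absurd (mem_range.mpr (by omega)) hn

end Roots

/-- The data of a family of monic polynomials `∑ c n ϑ μ Xⁿ`, whose dependence on `ϑ` is of
order `μ ^ N`, with leading coefficient `f n * L ϑ` for the derivative, and whose roots
`u t μ` at `ϑ = 0` separate with the orders `D`. -/
structure SeparatedFamily {ι : Type*} [Fintype ι] [DecidableEq ι] (N : ℕ)
    (c c' : ℕ → ℝ → ℝ → ℂ) (u : ι → ℝ → ℂ) (D : ι → ι → ℕ) (κ : ι → ι → ℂ) (δ : ℝ) : Prop where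
  pos : 0 < δ
  continuous : ∀ n, Continuous fun x : ℝ × ℝ => c n x.1 x.2
  hasDerivAt : ∀ n ϑ μ, HasDerivAt (fun t => c n t μ) (c' n ϑ μ) ϑ
  norm_coeff_sub_le : ∀ n, ∃ C : ℝ, ∀ ϑ μ, |μ| ≤ 1 → ‖c n ϑ μ - c n 0 μ‖ ≤ C * |μ| ^ N
  top_coeff : ∀ ϑ μ, c (Fintype.card ι) ϑ μ = 1
  continuousOn : ∀ t, ContinuousOn (u t) (Set.Ioo (-δ) δ)
  factors : ∀ μ ∈ Set.Ioo (-δ) δ, ∑ n ∈ range (Fintype.card ι + 1), C (c n 0 μ) * X ^ n =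
    ∏ t, (X - C (u t μ))
  tendsto : ∀ s t, s ≠ t →
    Tendsto (fun μ : ℝ => (u s μ - u t μ) / (μ : ℂ) ^ D s t) (𝓝[≠] 0) (𝓝 (κ s t))
  ne_zero : ∀ s t, s ≠ t → κ s t ≠ 0
  lt_left : ∀ s t, s ≠ t → D s t + ∑ r ∈ univ.erase s, D s r < N
  lt_right : ∀ s t, s ≠ t → D s t + ∑ r ∈ univ.erase t, D t r < N
  lt : ∀ t, ∑ r ∈ univ.erase t, D t r < N

namespace SeparatedFamily

variable {ι : Type*} [Fintype ι] [DecidableEq ι] {N : ℕ} {c c' : ℕ → ℝ → ℝ → ℂ} {u : ι → ℝ → ℂ}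
  {D : ι → ι → ℕ} {κ : ι → ι → ℂ} {δ : ℝ}

lemma monic (h : SeparatedFamily N c c' u D κ δ) (ϑ μ : ℝ) :
    (∑ n ∈ range (Fintype.card ι + 1), C (c n ϑ μ) * X ^ n).Monic ∧
    (∑ n ∈ range (Fintype.card ι + 1), C (c n ϑ μ) * X ^ n).natDegree = Fintype.card ι :=
  monic_sum_C_mul_X_pow (h.top_coeff ϑ μ)

lemma eventually_mem (h : SeparatedFamily N c c' u D κ δ) :
    ∀ᶠ μ : ℝ in 𝓝 0, μ ∈ Set.Ioo (-δ) δ := Ioo_mem_nhds (by linarith [h.pos]) h.pos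

lemma eventually_le_sep (h : SeparatedFamily N c c' u D κ δ) {s t : ι} (hst : s ≠ t) :
    ∀ᶠ μ : ℝ in 𝓝[≠] 0, ‖κ s t‖ / 2 * |μ| ^ D s t ≤ ‖u s μ - u t μ‖ := by
  have h1 := (h.tendsto s t hst).norm
  have h2 : ‖κ s t‖ / 2 < ‖κ s t‖ := half_lt_self (norm_pos_iff.mpr (h.ne_zero s t hst))
  filter_upwards [h1.eventually_const_lt h2, self_mem_nhdsWithin] with μ hμ hμ0
  have hμ0 : μ ≠ 0 := hμ0
  rw [norm_div, norm_pow, Complex.norm_real, Real.norm_eq_abs,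
    lt_div_iff₀ (pow_pos (abs_pos.mpr hμ0) _)] at hμ
  exact hμ.le

lemma tendsto_const_mul_abs_pow (K : ℝ) {k : ℕ} (hk : 0 < k) :
    Tendsto (fun μ : ℝ => K * |μ| ^ k) (𝓝 0) (𝓝 0) := by
  have : Continuous fun μ : ℝ => K * |μ| ^ k := by fun_prop
  simpa [hk.ne'] using this.tendsto 0

/-- At `u t` the perturbed polynomial is `O(μ^N)`, while its derivative is a product of gaps, of
order `μ^d`. So there is a root within `O(μ^(N-d))`, uniformly in `ϑ`. -/
lemma exists_root_near (h : SeparatedFamily N c c' u D κ δ) (t : ι) :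
    ∃ K : ℝ, 0 ≤ K ∧ ∀ᶠ μ : ℝ in 𝓝[≠] 0, ∀ ϑ : ℝ, ∃ w : ℂ,
      (∑ n ∈ range (Fintype.card ι + 1), C (c n ϑ μ) * X ^ n).eval w = 0 ∧
      ‖w - u t μ‖ ≤ K * |μ| ^ (N - ∑ r ∈ univ.erase t, D t r) := by
  set d := ∑ r ∈ univ.erase t, D t r with hd
  have hdN : d < N := h.lt t
  set k : ℂ := ∏ r ∈ univ.erase t, κ t r with hk
  have hk0 : k ≠ 0 := prod_ne_zero_iff.mpr fun r hr => h.ne_zero t r (ne_of_mem_erase hr).symm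
  have hkpos : 0 < ‖k‖ := norm_pos_iff.mpr hk0
  choose B hB using h.norm_coeff_sub_le
  set m := Fintype.card ι
  have hB0 : ∀ n, 0 ≤ B n := fun n => by
    simpa using (norm_nonneg _).trans (hB n 0 1 (by simp))
  obtain ⟨R, hR⟩ : ∃ R : ℝ, ∀ᶠ μ : ℝ in 𝓝 0, ‖u t μ‖ ≤ R := by
    refine ⟨‖u t 0‖ + 1, ?_⟩
    have h1 := ((h.continuousOn t).continuousAt h.eventually_mem).norm
    exact (h1.eventually_lt_const (lt_add_one _)).mono fun μ hμ => hμ.le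
  set C₁ : ℝ := ∑ n ∈ range (m + 1), B n * R ^ n
  set C₂ : ℝ := ∑ n ∈ range (m + 1), B n * (n * R ^ (n - 1))
  have hprod : Tendsto (fun μ : ℝ => (∏ r ∈ univ.erase t, (u t μ - u r μ)) / (μ : ℂ) ^ d) (𝓝[≠] 0)
      (𝓝 k) := by
    have h1 := tendsto_finsetProd (univ.erase t) fun r hr =>
      h.tendsto t r (ne_of_mem_erase hr).symm
    refine h1.congr fun μ => ?_
    rw [prod_div_distrib, prod_pow_eq_pow_sum]
  refine ⟨m * |C₁| / (‖k‖ / 4), by positivity, ?_⟩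
  have h1 : ∀ᶠ μ : ℝ in 𝓝 0, C₂ * |μ| ^ (N - d) ≤ ‖k‖ / 4 :=
    ((tendsto_const_mul_abs_pow C₂ (by omega)).eventually_lt_const (by positivity)).mono
      fun μ hμ => hμ.le
  have h2 : ∀ᶠ μ : ℝ in 𝓝 0, |μ| ≤ 1 := by
    have : Tendsto (fun μ : ℝ => |μ|) (𝓝 0) (𝓝 0) := by simpa using (continuous_abs.tendsto (0 : ℝ))
    exact (this.eventually_lt_const one_pos).mono fun μ hμ => hμ.le
  filter_upwards [nhdsWithin_le_nhds h.eventually_mem, nhdsWithin_le_nhds hR, nhdsWithin_le_nhds h1,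
    nhdsWithin_le_nhds h2, self_mem_nhdsWithin,
    hprod.norm.eventually_const_lt (half_lt_self hkpos)] with μ hμδ hμR hμ1 hμ2 hμ0 hμk ϑ
  have hμ0 : μ ≠ 0 := hμ0
  have hμp : 0 < |μ| := abs_pos.mpr hμ0
  have hR0 : 0 ≤ R := (norm_nonneg _).trans hμR
  set P := ∑ n ∈ range (m + 1), C (c n ϑ μ) * X ^ n with hP
  have hev : ‖P.eval (u t μ)‖ ≤ C₁ * |μ| ^ N := by
    have e1 : P.eval (u t μ) = ∑ n ∈ range (m + 1), (c n ϑ μ - c n 0 μ) * u t μ ^ n := by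
      have e2 : (∏ t, (X - C (u t μ))).eval (u t μ) = 0 := by
        rw [eval_prod]; exact prod_eq_zero (mem_univ t) (by simp)
      rw [← h.factors μ hμδ] at e2
      rw [← sub_zero (P.eval _), ← e2, hP]
      simp only [eval_finsetSum, eval_mul, eval_C, eval_pow, eval_X, sub_mul, sum_sub_distrib]
      rfl
    rw [e1, sum_mul]
    refine (norm_sum_le _ _).trans (sum_le_sum fun n _ => ?_)
    rw [norm_mul, norm_pow, mul_right_comm]
    exact mul_le_mul (hB n ϑ μ hμ2) (pow_le_pow_left₀ (norm_nonneg _) hμR n) (by positivity)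
      (mul_nonneg (hB0 n) (by positivity))
  have hder : ‖P.derivative.eval (u t μ) - ∏ r ∈ univ.erase t, (u t μ - u r μ)‖ ≤ C₂ * |μ| ^ N := by
    rw [← eval_derivative_prod_X_sub_C (fun s => u s μ) t, ← h.factors μ hμδ, ← eval_sub,
      ← derivative_sub, hP, ← sum_sub_distrib, derivative_sum, eval_finsetSum, sum_mul]
    refine (norm_sum_le _ _).trans (sum_le_sum fun n _ => ?_)
    rw [← sub_mul, ← C_sub, derivative_C_mul_X_pow]
    simp only [eval_mul, eval_C, eval_pow, eval_X, norm_mul, norm_pow, Complex.norm_natCast]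
    rw [mul_right_comm (B n), mul_assoc]
    exact mul_le_mul (hB n ϑ μ hμ2) (mul_le_mul_of_nonneg_left
      (pow_le_pow_left₀ (norm_nonneg _) hμR _) (Nat.cast_nonneg _)) (by positivity)
      (mul_nonneg (hB0 n) (by positivity))
  rw [norm_div, norm_pow, Complex.norm_real, Real.norm_eq_abs, lt_div_iff₀ (pow_pos hμp _)] at hμk
  have hpow : |μ| ^ N = |μ| ^ (N - d) * |μ| ^ d := by rw [← pow_add, Nat.sub_add_cancel hdN.le]
  have hlow : ‖k‖ / 4 * |μ| ^ d ≤ ‖P.derivative.eval (u t μ)‖ := by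
    have e1 : C₂ * |μ| ^ N ≤ ‖k‖ / 4 * |μ| ^ d := by
      rw [hpow, ← mul_assoc]; exact mul_le_mul_of_nonneg_right hμ1 (by positivity)
    have e2 := norm_sub_norm_le (∏ r ∈ univ.erase t, (u t μ - u r μ)) (P.derivative.eval (u t μ))
    rw [norm_sub_rev] at e2
    linarith
  have hne : P.derivative.eval (u t μ) ≠ 0 :=
    norm_pos_iff.mp (lt_of_lt_of_le (by positivity) hlow)
  obtain ⟨w, hw, hw'⟩ := exists_root_norm_sub_mul_le (h.monic ϑ μ).1.ne_zero hne
  refine ⟨w, hw, ?_⟩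
  rw [(h.monic ϑ μ).2] at hw'
  rw [div_mul_eq_mul_div, le_div_iff₀ (by positivity)]
  refine le_of_mul_le_mul_right ?_ (pow_pos hμp d)
  calc ‖w - u t μ‖ * (‖k‖ / 4) * |μ| ^ d = ‖w - u t μ‖ * (‖k‖ / 4 * |μ| ^ d) := mul_assoc _ _ _
    _ ≤ ‖w - u t μ‖ * ‖P.derivative.eval (u t μ)‖ :=
        mul_le_mul_of_nonneg_left hlow (norm_nonneg _)
    _ ≤ m * ‖P.eval (u t μ)‖ := hw'
    _ ≤ m * (|C₁| * |μ| ^ N) := by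
        refine mul_le_mul_of_nonneg_left (hev.trans ?_) (Nat.cast_nonneg _)
        exact mul_le_mul_of_nonneg_right (le_abs_self _) (by positivity)
    _ = m * |C₁| * |μ| ^ (N - d) * |μ| ^ d := by rw [hpow]; ring

/-- Roots close to the `u t μ`, for all angles at once. -/
lemma exists_near_roots [Nonempty ι] (h : SeparatedFamily N c c' u D κ δ) :
    ∃ K : ℝ, 0 ≤ K ∧ ∃ δ' > 0, δ' ≤ δ ∧ ∃ w : ι → ℝ → ℝ → ℂ, ∀ μ ∈ Set.Ioo (-δ') δ',
      (∀ ϑ t, ‖w t ϑ μ - u t μ‖ ≤ K * |μ| ^ (N - ∑ r ∈ univ.erase t, D t r)) ∧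
      (∀ ϑ, ∑ n ∈ range (Fintype.card ι + 1), C (c n ϑ μ) * X ^ n = ∏ t, (X - C (w t ϑ μ))) ∧
      (μ ≠ 0 → ∀ s t, s ≠ t → 0 < ‖u s μ - u t μ‖ ∧
        K * |μ| ^ (N - ∑ r ∈ univ.erase s, D s r) + K * |μ| ^ (N - ∑ r ∈ univ.erase t, D t r) ≤
          ‖u s μ - u t μ‖ / 2) := by
  choose K₀ hK₀ hroot using h.exists_root_near
  set K := ∑ t, K₀ t
  have hK : 0 ≤ K := sum_nonneg fun t _ => hK₀ t
  have hKle : ∀ t, K₀ t ≤ K := fun t => single_le_sum (fun t _ => hK₀ t) (mem_univ t)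
  -- By `lt_left` and `lt_right` the displacements of both roots are of higher order than their gap,
  -- so nearby roots for different indices cannot coincide.
  have hsep : ∀ s t, s ≠ t → ∀ᶠ μ : ℝ in 𝓝[≠] 0, 0 < ‖u s μ - u t μ‖ ∧
        K * |μ| ^ (N - ∑ r ∈ univ.erase s, D s r) + K * |μ| ^ (N - ∑ r ∈ univ.erase t, D t r) ≤
          ‖u s μ - u t μ‖ / 2 := by
    intro s t hst
    have hκ : 0 < ‖κ s t‖ := norm_pos_iff.mpr (h.ne_zero s t hst)
    have hl := h.lt_left s t hst
    have hr := h.lt_right s t hst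
    have h1 := ((tendsto_const_mul_abs_pow K (k := N - ∑ r ∈ univ.erase s, D s r - D s t)
      (by omega)).add (tendsto_const_mul_abs_pow K (k := N - ∑ r ∈ univ.erase t, D t r - D s t)
      (by omega))).eventually_lt_const (show (0 : ℝ) + 0 < ‖κ s t‖ / 4 by linarith)
    filter_upwards [h.eventually_le_sep hst, nhdsWithin_le_nhds h1, self_mem_nhdsWithin]
      with μ h2 h3 hμ0
    have hμ0 : μ ≠ 0 := hμ0
    have hμp : 0 < |μ| ^ D s t := pow_pos (abs_pos.mpr hμ0) _
    have e : ∀ k, D s t ≤ k → |μ| ^ k = |μ| ^ (k - D s t) * |μ| ^ D s t := fun k hk => by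
      rw [← pow_add, Nat.sub_add_cancel hk]
    refine ⟨lt_of_lt_of_le (by positivity) h2, ?_⟩
    rw [e (N - ∑ r ∈ univ.erase s, D s r) (by omega), e (N - ∑ r ∈ univ.erase t, D t r) (by omega),
      ← mul_assoc, ← mul_assoc, ← add_mul]
    have := mul_le_mul_of_nonneg_right h3.le hμp.le
    linarith
  have hall : ∀ᶠ μ : ℝ in 𝓝[≠] 0, (∀ s t, s ≠ t → 0 < ‖u s μ - u t μ‖ ∧
        K * |μ| ^ (N - ∑ r ∈ univ.erase s, D s r) + K * |μ| ^ (N - ∑ r ∈ univ.erase t, D t r) ≤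
          ‖u s μ - u t μ‖ / 2) ∧ ∀ t, ∀ ϑ : ℝ, ∃ w : ℂ,
      (∑ n ∈ range (Fintype.card ι + 1), C (c n ϑ μ) * X ^ n).eval w = 0 ∧
      ‖w - u t μ‖ ≤ K₀ t * |μ| ^ (N - ∑ r ∈ univ.erase t, D t r) := by
    refine Filter.Eventually.and ?_ (eventually_all.mpr hroot)
    refine eventually_all.mpr fun s => eventually_all.mpr fun t => ?_
    by_cases hst : s = t
    · exact Eventually.of_forall fun _ h => absurd hst h
    · exact (hsep s t hst).mono fun _ h _ => h
  rw [eventually_nhdsWithin_iff, Metric.eventually_nhds_iff_ball] at hall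
  obtain ⟨ε, hε, hall⟩ := hall
  have hex : ∀ ϑ μ, ∃ w : ι → ℂ, μ ∈ Set.Ioo (-(min ε δ)) (min ε δ) →
      (∀ t, ‖w t - u t μ‖ ≤ K * |μ| ^ (N - ∑ r ∈ univ.erase t, D t r)) ∧
      (∑ n ∈ range (Fintype.card ι + 1), C (c n ϑ μ) * X ^ n = ∏ t, (X - C (w t))) := by
    intro ϑ μ
    -- At `μ = 0` the roots may collide, but there the polynomial does not depend on `ϑ` and the
    -- given roots serve.
    by_cases hμ0 : μ = 0
    · subst hμ0
      refine ⟨fun t => u t 0, fun _ => ⟨fun t => by simp; positivity, ?_⟩⟩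
      rw [← h.factors 0 ⟨neg_lt_zero.mpr h.pos, h.pos⟩]
      refine sum_congr rfl fun n _ => ?_
      obtain ⟨B, hB⟩ := h.norm_coeff_sub_le n
      have hN : N ≠ 0 := (Nat.zero_lt_of_lt (h.lt (Classical.arbitrary ι))).ne'
      have := hB ϑ 0 (by simp)
      rw [abs_zero, zero_pow hN, mul_zero, norm_le_zero_iff, sub_eq_zero] at this
      rw [this]
    by_cases hμ : μ ∈ Metric.ball (0 : ℝ) ε
    · obtain ⟨h1, h2⟩ := hall μ hμ hμ0
      choose w hw hw' using fun t => h2 t ϑ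
      have hw'' : ∀ t, ‖w t - u t μ‖ ≤ K * |μ| ^ (N - ∑ r ∈ univ.erase t, D t r) := fun t =>
        (hw' t).trans (mul_le_mul_of_nonneg_right (hKle t) (by positivity))
      refine ⟨w, fun _ => ⟨hw'', eq_prod_X_sub_C_of_injective (h.monic ϑ μ).1 (h.monic ϑ μ).2 ?_ hw⟩⟩
      intro s t hst
      by_contra hne
      obtain ⟨h3, h4⟩ := h1 s t hne
      have h5 : ‖u s μ - u t μ‖ ≤ ‖w s - u s μ‖ + ‖w t - u t μ‖ := by
        rw [show u s μ - u t μ = (w t - u t μ) - (w s - u s μ) by rw [hst]; ring, add_comm]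
        exact norm_sub_le _ _
      linarith [hw'' s, hw'' t]
    · refine ⟨0, fun h' => absurd ?_ hμ⟩
      rw [Metric.mem_ball, Real.dist_eq, sub_zero, abs_lt]
      exact ⟨by linarith [h'.1, min_le_left ε δ], h'.2.trans_le (min_le_left _ _)⟩
  choose w hw using hex
  refine ⟨K, hK, min ε δ, lt_min hε h.pos, min_le_right _ _, fun t ϑ μ => w ϑ μ t, fun μ hμ =>
    ⟨fun ϑ => (hw ϑ μ hμ).1, fun ϑ => (hw ϑ μ hμ).2, fun hμ0 => (hall μ ?_ hμ0).1⟩⟩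
  rw [Metric.mem_ball, Real.dist_eq, sub_zero, abs_lt]
  exact ⟨by linarith [hμ.1, min_le_left ε δ], hμ.2.trans_le (min_le_left _ _)⟩

end SeparatedFamily

end KickedRotor

/-! ### Implicit differentiation of the separated roots. -/

namespace KickedRotor

open Finset Filter Topology Polynomial

namespace SeparatedFamily

variable {ι : Type*} [Fintype ι] [DecidableEq ι] {N : ℕ} {c c' : ℕ → ℝ → ℝ → ℂ} {u : ι → ℝ → ℂ}
  {D : ι → ι → ℕ} {κ : ι → ι → ℂ} {δ : ℝ}

/-- The implicit function theorem for a root of a separated family which is near `u`. -/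
theorem exists_roots [Nonempty ι] (h : SeparatedFamily N c c' u D κ δ) {f : ℕ → ℂ} {L : ℝ → ℂ}
    (hlead : ∀ n ϑ, Tendsto (fun μ : ℝ => c' n ϑ μ / (μ : ℂ) ^ N) (𝓝[≠] 0) (𝓝 (L ϑ * f n))) :
    ∃ δ' > 0, ∃ w : ι → ℝ → ℝ → ℂ,
      (∀ t, ContinuousOn (fun x : ℝ × ℝ => w t x.1 x.2) (Set.univ ×ˢ Set.Ioo (-δ') δ')) ∧
      (∀ ϑ, ∀ μ ∈ Set.Ioo (-δ') δ', ∑ n ∈ range (Fintype.card ι + 1), C (c n ϑ μ) * X ^ n =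
        ∏ t, (X - C (w t ϑ μ))) ∧
      (∀ t ϑ, w t ϑ 0 = u t 0) ∧
      (∀ t, ∀ μ ∈ Set.Ioo (-δ') δ', Differentiable ℝ fun ϑ => w t ϑ μ) ∧
      (∀ t ϑ, Tendsto (fun μ : ℝ => deriv (fun ϑ => w t ϑ μ) ϑ /
          (μ : ℂ) ^ (N - ∑ r ∈ univ.erase t, D t r)) (𝓝[≠] 0)
        (𝓝 (-(L ϑ * ∑ n ∈ range (Fintype.card ι + 1), f n * u t 0 ^ n) /
          ∏ r ∈ univ.erase t, κ t r))) ∧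
      (∀ t ϑ, ∀ μ ∈ Set.Ioo (-δ') δ', μ ≠ 0 → (∀ n, c' n ϑ μ = 0) →
        deriv (fun ϑ => w t ϑ μ) ϑ = 0) := by
  obtain ⟨K, hK, δ', hδ', hδδ, w, hw⟩ := h.exists_near_roots
  set η : ι → ℝ → ℝ := fun t μ => K * |μ| ^ (N - ∑ r ∈ univ.erase t, D t r) with hη
  have hη0 : ∀ t, η t 0 = 0 := fun t => by
    have := h.lt t
    simp [hη, show N - ∑ r ∈ univ.erase t, D t r ≠ 0 by omega]
  have hηc : ∀ t, Continuous (η t) := fun t => by fun_prop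
  have hmem : ∀ μ ∈ Set.Ioo (-δ') δ', Set.Ioo (-δ') δ' ∈ 𝓝 μ := fun μ hμ => isOpen_Ioo.mem_nhds hμ
  have hu : ∀ t, ∀ μ ∈ Set.Ioo (-δ') δ', ContinuousAt (u t) μ := fun t μ hμ =>
    ((h.continuousOn t).mono (Set.Ioo_subset_Ioo (neg_le_neg hδδ) hδδ)).continuousAt (hmem μ hμ)
  have hnear : ∀ μ ∈ Set.Ioo (-δ') δ', ∀ ϑ t, ‖w t ϑ μ - u t μ‖ ≤ η t μ := fun μ hμ => (hw μ hμ).1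
  have h0mem : (0 : ℝ) ∈ Set.Ioo (-δ') δ' := ⟨neg_lt_zero.mpr hδ', hδ'⟩
  have hw0 : ∀ t ϑ, w t ϑ 0 = u t 0 := fun t ϑ => by
    have := hnear 0 h0mem ϑ t
    rwa [hη0, norm_le_zero_iff, sub_eq_zero] at this
  have heval : ∀ μ ∈ Set.Ioo (-δ') δ', ∀ ϑ z,
      ∑ n ∈ range (Fintype.card ι + 1), c n ϑ μ * z ^ n = ∏ t, (z - w t ϑ μ) := by
    intro μ hμ ϑ z
    have := congrArg (eval z) ((hw μ hμ).2.1 ϑ)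
    simpa [eval_finsetSum, eval_prod] using this
  have hne : ∀ μ ∈ Set.Ioo (-δ') δ', μ ≠ 0 → ∀ ϑ ϑ' s t, s ≠ t → w s ϑ μ ≠ w t ϑ' μ := by
    intro μ hμ hμ0 ϑ ϑ' s t hst heq
    obtain ⟨h1, h2⟩ := (hw μ hμ).2.2 hμ0 s t hst
    have h3 := hnear μ hμ ϑ s
    have h4 := hnear μ hμ ϑ' t
    have h5 : ‖u s μ - u t μ‖ ≤ ‖w t ϑ' μ - u t μ‖ + ‖w s ϑ μ - u s μ‖ := by
      rw [show u s μ - u t μ = (w t ϑ' μ - u t μ) - (w s ϑ μ - u s μ) by rw [heq]; ring]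
      exact norm_sub_le _ _
    simp only [hη] at h3 h4
    linarith
  -- At `μ₀ = 0` continuity comes from the distance bound to `u t`. Elsewhere the polynomial at `z =
  -- w t ϑ₀ μ₀` tends to 0 while the factors of the other roots stay bounded below.
  have hcont : ∀ t, ∀ ϑ₀ : ℝ, ∀ μ₀ ∈ Set.Ioo (-δ') δ',
      ContinuousAt (fun x : ℝ × ℝ => w t x.1 x.2) (ϑ₀, μ₀) := by
    intro t ϑ₀ μ₀ hμ₀
    have hsnd : Tendsto (fun x : ℝ × ℝ => x.2) (𝓝 (ϑ₀, μ₀)) (𝓝 μ₀) := continuous_snd.tendsto _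
    have hev : ∀ᶠ x : ℝ × ℝ in 𝓝 (ϑ₀, μ₀), x.2 ∈ Set.Ioo (-δ') δ' := hsnd (hmem μ₀ hμ₀)
    rw [ContinuousAt, tendsto_iff_norm_sub_tendsto_zero]
    by_cases hμ0 : μ₀ = 0
    · subst hμ0
      have h1 : Tendsto (fun x : ℝ × ℝ => η t x.2 + ‖u t x.2 - u t 0‖) (𝓝 (ϑ₀, 0)) (𝓝 0) := by
        have h2 : Tendsto (fun μ => η t μ + ‖u t μ - u t 0‖) (𝓝 0) (𝓝 (η t 0 + ‖u t 0 - u t 0‖)) :=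
          ((hηc t).tendsto 0).add (((hu t 0 h0mem).sub continuousAt_const).norm.tendsto)
        rw [hη0, sub_self, norm_zero, add_zero] at h2
        exact h2.comp hsnd
      refine squeeze_zero' (Eventually.of_forall fun _ => norm_nonneg _) ?_ h1
      filter_upwards [hev] with x hx
      rw [hw0]
      calc _ = ‖(w t x.1 x.2 - u t x.2) + (u t x.2 - u t 0)‖ := by congr 1; ring
        _ ≤ _ := (norm_add_le _ _).trans (add_le_add_left (hnear _ hx _ _) _)
    · set z := w t ϑ₀ μ₀ with hz
      have hG : Tendsto (fun x : ℝ × ℝ => ‖∑ n ∈ range (Fintype.card ι + 1), c n x.1 x.2 * z ^ n‖)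
          (𝓝 (ϑ₀, μ₀)) (𝓝 0) := by
        have h1 : Continuous fun x : ℝ × ℝ =>
            ‖∑ n ∈ range (Fintype.card ι + 1), c n x.1 x.2 * z ^ n‖ :=
          (continuous_finsetSum _ fun n _ => (h.continuous n).mul continuous_const).norm
        have h2 := h1.tendsto (ϑ₀, μ₀)
        rwa [heval μ₀ hμ₀, prod_eq_zero (mem_univ t) (sub_self _), norm_zero] at h2
      have hlow : ∀ᶠ x : ℝ × ℝ in 𝓝 (ϑ₀, μ₀), ∀ s ∈ univ.erase t,
          ‖u t μ₀ - u s μ₀‖ / 4 ≤ ‖z - w s x.1 x.2‖ := by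
        refine (eventually_all_finset _).mpr fun s hs => ?_
        have hst : t ≠ s := (ne_of_mem_erase hs).symm
        obtain ⟨h1, h2⟩ := (hw μ₀ hμ₀).2.2 hμ0 t s hst
        have h3 : Tendsto (fun μ => η t μ₀ + ‖u s μ₀ - u s μ‖ + η s μ) (𝓝 μ₀)
            (𝓝 (η t μ₀ + ‖u s μ₀ - u s μ₀‖ + η s μ₀)) :=
          (((continuousAt_const.sub (hu s μ₀ hμ₀)).norm.tendsto).const_add _).add
            ((hηc s).tendsto μ₀)
        rw [sub_self, norm_zero, add_zero] at h3
        have h4 := h3.eventually_lt_const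
          (show η t μ₀ + η s μ₀ < 3 / 4 * ‖u t μ₀ - u s μ₀‖ by simp only [hη]; linarith)
        filter_upwards [hsnd.eventually h4, hev] with x hx hx'
        have h5 := hnear μ₀ hμ₀ ϑ₀ t
        have h6 := hnear x.2 hx' x.1 s
        have h7 : ‖u t μ₀ - u s μ₀‖ ≤
            ‖z - w s x.1 x.2‖ + (‖z - u t μ₀‖ + (‖u s μ₀ - u s x.2‖ + ‖w s x.1 x.2 - u s x.2‖)) := by
          calc ‖u t μ₀ - u s μ₀‖ = ‖(z - w s x.1 x.2) -
                ((z - u t μ₀) + ((u s μ₀ - u s x.2) - (w s x.1 x.2 - u s x.2)))‖ := by congr 1; ring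
            _ ≤ _ := (norm_sub_le _ _).trans (add_le_add_right ((norm_add_le _ _).trans
                (add_le_add_right (norm_sub_le _ _) _)) _)
        linarith
      set p := ∏ s ∈ univ.erase t, (‖u t μ₀ - u s μ₀‖ / 4)
      have hp : 0 < p := prod_pos fun s hs => by
        have := ((hw μ₀ hμ₀).2.2 hμ0 t s (ne_of_mem_erase hs).symm).1
        positivity
      have hG' := hG.div_const p
      rw [zero_div] at hG'
      refine squeeze_zero' (Eventually.of_forall fun _ => norm_nonneg _) ?_ hG'
      filter_upwards [hlow, hev] with x hx hx'
      rw [le_div_iff₀ hp, heval x.2 hx', ← mul_prod_erase univ _ (mem_univ t), norm_mul, norm_prod,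
        norm_sub_rev]
      exact mul_le_mul_of_nonneg_left (prod_le_prod (fun s _ => by positivity) hx) (norm_nonneg _)
  have hderiv : ∀ t, ∀ ϑ₀ : ℝ, ∀ μ ∈ Set.Ioo (-δ') δ', μ ≠ 0 → HasDerivAt (fun ϑ => w t ϑ μ)
      (-(∑ n ∈ range (Fintype.card ι + 1), c' n ϑ₀ μ * w t ϑ₀ μ ^ n) /
        ∏ r ∈ univ.erase t, (w t ϑ₀ μ - w r ϑ₀ μ)) ϑ₀ := by
    intro t ϑ₀ μ hμ hμ0
    set z := w t ϑ₀ μ with hz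
    have h1 : HasDerivAt (fun ϑ => -∑ n ∈ range (Fintype.card ι + 1), c n ϑ μ * z ^ n)
        (-∑ n ∈ range (Fintype.card ι + 1), c' n ϑ₀ μ * z ^ n) ϑ₀ :=
      (HasDerivAt.fun_sum fun n _ => (h.hasDerivAt n ϑ₀ μ).mul_const _).neg
    have h2 : -∑ n ∈ range (Fintype.card ι + 1), c n ϑ₀ μ * z ^ n = 0 := by
      rw [heval μ hμ, prod_eq_zero (mem_univ t) (sub_self _), neg_zero]
    have hnz : ∀ ϑ, ∏ r ∈ univ.erase t, (z - w r ϑ μ) ≠ 0 := fun ϑ =>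
      prod_ne_zero_iff.mpr fun r hr =>
        sub_ne_zero.mpr (hne μ hμ hμ0 _ _ _ _ (ne_of_mem_erase hr).symm)
    have h3 : ContinuousAt (fun ϑ => (∏ r ∈ univ.erase t, (z - w r ϑ μ))⁻¹) ϑ₀ := by
      refine ContinuousAt.inv₀ (tendsto_finsetProd _ fun r _ => ?_) (hnz ϑ₀)
      refine tendsto_const_nhds.sub ?_
      exact ContinuousAt.comp (f := fun ϑ : ℝ => (ϑ, μ)) (hcont r ϑ₀ μ hμ)
        (continuousAt_id.prodMk continuousAt_const)
    -- Exact identity: for `z = w t ϑ₀ μ`, the root `w t ϑ μ` is `z - P_ϑ(z) / ∏ (z - w r ϑ μ)`, the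
    -- product being over `r ≠ t`.
    have h4 := (hasDerivAt_mul_of_continuousAt h1 h2 h3).const_add z
    rw [← div_eq_mul_inv] at h4
    refine h4.congr_of_eventuallyEq (Eventually.of_forall fun ϑ => ?_)
    beta_reduce
    rw [heval μ hμ, ← mul_prod_erase univ _ (mem_univ t), ← neg_mul, mul_assoc,
      mul_inv_cancel₀ (hnz ϑ)]
    ring
  refine ⟨δ', hδ', w, fun t x hx => (hcont t x.1 x.2 hx.2).continuousWithinAt,
    fun ϑ μ hμ => (hw μ hμ).2.1 ϑ, hw0, ?_, ?_, ?_⟩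
  · intro t μ hμ ϑ
    by_cases hμ0 : μ = 0
    · subst hμ0
      simp only [hw0]
      exact differentiableAt_const _
    · exact (hderiv t ϑ μ hμ hμ0).differentiableAt
  · intro t ϑ
    have hwt : Tendsto (fun μ => w t ϑ μ) (𝓝[≠] 0) (𝓝 (u t 0)) := by
      rw [← hw0 t ϑ]
      exact (ContinuousAt.comp (f := fun μ : ℝ => (ϑ, μ)) (hcont t ϑ 0 h0mem)
        (continuousAt_const.prodMk continuousAt_id)).tendsto.mono_left nhdsWithin_le_nhds
    have hnum : Tendsto (fun μ : ℝ => -∑ n ∈ range (Fintype.card ι + 1),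
        c' n ϑ μ / (μ : ℂ) ^ N * w t ϑ μ ^ n) (𝓝[≠] 0)
        (𝓝 (-(L ϑ * ∑ n ∈ range (Fintype.card ι + 1), f n * u t 0 ^ n))) := by
      simp only [mul_sum, ← mul_assoc]
      exact (tendsto_finsetSum _ fun n _ => (hlead n ϑ).mul (hwt.pow n)).neg
    have hmem0 : ∀ᶠ μ : ℝ in 𝓝[≠] 0, μ ∈ Set.Ioo (-δ') δ' := nhdsWithin_le_nhds (hmem 0 h0mem)
    -- The displacement of a root by the angle is negligible against the gap, so the limits `κ` hold
    -- for every `ϑ`.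
    have hsmall : ∀ s t', (D t t' + ∑ r ∈ univ.erase s, D s r < N) →
        Tendsto (fun μ : ℝ => (w s ϑ μ - u s μ) / (μ : ℂ) ^ D t t') (𝓝[≠] 0) (𝓝 0) := by
      intro s t' hlt
      rw [tendsto_zero_iff_norm_tendsto_zero]
      refine squeeze_zero' (Eventually.of_forall fun _ => norm_nonneg _) ?_
        ((tendsto_const_mul_abs_pow K (k := N - ∑ r ∈ univ.erase s, D s r - D t t')
          (by omega)).mono_left nhdsWithin_le_nhds)
      filter_upwards [hmem0, self_mem_nhdsWithin] with μ hμ hμ0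
      have hμ0 : μ ≠ 0 := hμ0
      rw [norm_div, norm_pow, Complex.norm_real, Real.norm_eq_abs,
        div_le_iff₀ (pow_pos (abs_pos.mpr hμ0) _), mul_assoc, ← pow_add, Nat.sub_add_cancel (by omega)]
      exact hnear μ hμ ϑ s
    have hden : Tendsto (fun μ : ℝ => ∏ r ∈ univ.erase t, (w t ϑ μ - w r ϑ μ) / (μ : ℂ) ^ D t r)
        (𝓝[≠] 0) (𝓝 (∏ r ∈ univ.erase t, κ t r)) := by
      refine tendsto_finsetProd _ fun r hr => ?_
      have htr := (ne_of_mem_erase hr).symm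
      have h1 := ((h.tendsto t r htr).add (hsmall t r (h.lt_left t r htr))).sub
        (hsmall r r (h.lt_right t r htr))
      rw [add_zero, sub_zero] at h1
      refine h1.congr fun μ => ?_
      ring
    have hκ : ∏ r ∈ univ.erase t, κ t r ≠ 0 :=
      prod_ne_zero_iff.mpr fun r hr => h.ne_zero t r (ne_of_mem_erase hr).symm
    refine (hnum.div hden hκ).congr' ?_
    filter_upwards [hmem0, self_mem_nhdsWithin] with μ hμ hμ0
    have hμ0 : μ ≠ 0 := hμ0
    have hμC : (μ : ℂ) ≠ 0 := by exact_mod_cast hμ0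
    rw [(hderiv t ϑ μ hμ hμ0).deriv, Pi.div_apply, prod_div_distrib, prod_pow_eq_pow_sum]
    have e1 : ∑ n ∈ range (Fintype.card ι + 1), c' n ϑ μ / (μ : ℂ) ^ N * w t ϑ μ ^ n =
        (∑ n ∈ range (Fintype.card ι + 1), c' n ϑ μ * w t ϑ μ ^ n) / (μ : ℂ) ^ N := by
      rw [sum_div]; exact sum_congr rfl fun n _ => by ring
    have e2 : (μ : ℂ) ^ N = (μ : ℂ) ^ (N - ∑ r ∈ univ.erase t, D t r) *
        (μ : ℂ) ^ (∑ r ∈ univ.erase t, D t r) := by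
      rw [← pow_add, Nat.sub_add_cancel (h.lt t).le]
    have hnz : ∏ r ∈ univ.erase t, (w t ϑ μ - w r ϑ μ) ≠ 0 :=
      prod_ne_zero_iff.mpr fun r hr =>
        sub_ne_zero.mpr (hne μ hμ hμ0 _ _ _ _ (ne_of_mem_erase hr).symm)
    rw [e1, e2]
    field_simp
  · intro t ϑ μ hμ hμ0 hz
    rw [(hderiv t ϑ μ hμ hμ0).deriv, sum_eq_zero fun n _ => by rw [hz, zero_mul], neg_zero, zero_div]

end SeparatedFamily

end KickedRotor

/-! ### Quadratic phases: branches at `ϑ = 0`. -/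

namespace KickedRotor

open Finset ZMod Filter Topology Polynomial

section Quadratic

variable {q : ℕ} [Fact q.Prime]

/-- The eigenvalue `θ e(u t²)` of the free propagator at the momentum `t`. -/
noncomputable def quadPhase (θ : ℂ) (u t : ZMod q) : ℂ := θ * stdAddChar (u * t ^ 2)

lemma quadPhase_neg (θ : ℂ) (u t : ZMod q) : quadPhase θ u (-t) = quadPhase θ u t := by
  simp [quadPhase]

lemma norm_quadPhase {θ : ℂ} (hθ : ‖θ‖ = 1) (u t : ZMod q) : ‖quadPhase θ u t‖ = 1 := by
  rw [quadPhase, norm_mul, hθ, norm_stdAddChar, one_mul]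

lemma quadPhase_ne_zero {θ : ℂ} (hθ : ‖θ‖ = 1) (u t : ZMod q) : quadPhase θ u t ≠ 0 := by
  rw [← norm_pos_iff, norm_quadPhase hθ]; exact one_pos

lemma quadPhase_div {θ : ℂ} (hθ : ‖θ‖ = 1) (u s t : ZMod q) :
    quadPhase θ u s / quadPhase θ u t = stdAddChar (u * (s ^ 2 - t ^ 2)) := by
  have hθ0 : θ ≠ 0 := norm_pos_iff.mp (hθ ▸ one_pos)
  rw [quadPhase, quadPhase, mul_div_mul_left _ _ hθ0, ← AddChar.map_sub_eq_div, mul_sub]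

lemma quadPhase_eq_iff {θ : ℂ} (hθ : ‖θ‖ = 1) {u : ZMod q} (hu : u ≠ 0) {s t : ZMod q} :
    quadPhase θ u s = quadPhase θ u t ↔ s = t ∨ s = -t := by
  rw [← div_eq_one_iff_eq (quadPhase_ne_zero hθ u t), quadPhase_div hθ]
  rw [← sq_eq_sq_iff_eq_or_eq_neg]
  refine ⟨fun h => ?_, fun h => by rw [h, sub_self, mul_zero, AddChar.map_zero_eq_one]⟩
  by_contra hne
  exact stdAddChar_ne_one (mul_ne_zero hu (sub_ne_zero.mpr hne)) h

lemma neg_ne_self_zmod (hq : 2 < q) {t : ZMod q} (ht : t ≠ 0) : -t ≠ t := by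
  intro h
  have h2 : (2 : ZMod q) ≠ 0 := by exact_mod_cast natCast_ne_zero_zmod (q := q) two_pos hq
  have : 2 * t = 0 := by linear_combination -h
  exact (mul_ne_zero h2 ht) this

/-- `t` and `-t` are joined by the path of length `circDist (2 * t)` which ends in `t`. -/
def IsRightEnd (t : ZMod q) : Prop := (circDist (2 * t) : ZMod q) = 2 * t

/-- Each degenerate pair is oriented exactly once along its shorter arc, which allows the two
branches to be distributed over `t` and `-t`. -/
lemma isRightEnd_neg_iff (hq : 2 < q) {t : ZMod q} (ht : t ≠ 0) : IsRightEnd (-t) ↔ ¬ IsRightEnd t := by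
  have h2 : (2 : ZMod q) ≠ 0 := by exact_mod_cast natCast_ne_zero_zmod (q := q) two_pos hq
  rw [IsRightEnd, IsRightEnd, mul_neg, circDist_neg]
  constructor
  · intro h h'
    exact neg_ne_self_zmod hq (mul_ne_zero h2 ht) (h.symm.trans h')
  · intro h
    rcases eq_or_eq_neg_circDist (2 * t) with h' | h'
    · exact absurd h'.symm h
    · rw [← neg_eq_iff_eq_neg] at h'; exact h'.symm

lemma circDist_two_mul_pos (hq : 2 < q) {t : ZMod q} (ht : t ≠ 0) : 0 < circDist (2 * t) := by
  have h2 : (2 : ZMod q) ≠ 0 := by exact_mod_cast natCast_ne_zero_zmod (q := q) two_pos hq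
  exact circDist_pos (mul_ne_zero h2 ht)

lemma eval_blochPoly_zero_left (a : ZMod q → ℂ) (μ : ℝ) (z : ℂ) (s : ZMod q) :
    (blochPoly a 0 μ).eval z = (momentumMatrix (fun l => a (l + s)) (kickCoeff μ) z).det := by
  rw [det_momentumMatrix_shift, eval_blochPoly_eq_det, det_diagonal_sub_circulantOf]
  rfl

lemma kickSum_coeffWeight_self (a : ZMod q → ℂ) (ϑ μ : ℝ) :
    kickSum (coeffWeight a q) ϑ μ = 1 := by
  rw [kickSum, sum_eq_single univ]
  · rw [kick_univ, mul_zero, Complex.exp_zero, mul_one, coeffWeight,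
      if_pos (by rw [card_univ, ZMod.card]), minorWeight]
    simp only [mem_univ, if_true]
    exact Matrix.det_one
  · intro J _ hJ
    rw [coeffWeight, if_neg, zero_mul]
    intro h
    exact hJ (card_eq_iff_eq_univ J |>.mp (h.trans (ZMod.card q).symm))
  · simp

lemma blochPoly_zero_right (a : ZMod q → ℂ) (ϑ : ℝ) : blochPoly a ϑ 0 = ∏ t, (X - C (a t)) := by
  refine Polynomial.funext fun z => ?_
  rw [eval_blochPoly_eq_det, det_diagonal_sub_circulantOf, eval_prod]
  have h1 : momentumMatrix a (fourierCoeff fun j => Complex.exp (((0 : ℝ) : ℂ) * kick {j} ϑ)) z =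
      Matrix.diagonal fun t => z - a t := by
    have h2 : (fourierCoeff fun j : ZMod q => Complex.exp (((0 : ℝ) : ℂ) * kick {j} ϑ)) =
        kickCoeff 0 := by
      unfold kickCoeff
      simp only [Complex.ofReal_zero, zero_mul]
    ext m n
    rw [h2, momentumMatrix, Matrix.of_apply, kickCoeff_zero]
    by_cases hmn : m = n
    · subst hmn; simp
    · simp [hmn, sub_eq_zero]
  rw [h1, Matrix.det_diagonal]
  simp

/-- Translation by `-t` places the pair at the sites 0 and `d = 2t`, so that `l ↦ d - l` is the
reflection of momenta and the ratios of phases are those of `ratio u d`. -/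
lemma exists_split_pair (hq : 2 < q) {θ : ℂ} (hθ : ‖θ‖ = 1) {u : ZMod q} (hu : u ≠ 0) {t : ZMod q}
    (ht : t ≠ 0) (hr : IsRightEnd t) :
    ∃ δ > (0 : ℝ), ∃ u₁ u₂ : ℝ → ℂ, ContinuousOn u₁ (Set.Ioo (-δ) δ) ∧
      ContinuousOn u₂ (Set.Ioo (-δ) δ) ∧ u₁ 0 = quadPhase θ u t ∧ u₂ 0 = quadPhase θ u t ∧
      (∀ μ ∈ Set.Ioo (-δ) δ, (blochPoly (quadPhase θ u) 0 μ).eval (u₁ μ) = 0 ∧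
        (blochPoly (quadPhase θ u) 0 μ).eval (u₂ μ) = 0) ∧
      Tendsto (fun μ : ℝ => (u₁ μ - u₂ μ) / (μ : ℂ) ^ circDist (2 * t)) (𝓝[≠] 0)
        (𝓝 (-2 * (quadPhase θ u t * (Complex.I / 2) ^ circDist (2 * t) *
          transmission (ratio u (circDist (2 * t))) (circDist (2 * t))))) := by
  set d := circDist (2 * t) with hd
  have hr : (d : ZMod q) = 2 * t := hr
  have hb0 : quadPhase θ u (0 + -t) = quadPhase θ u t := by rw [zero_add, quadPhase_neg]
  have hratio : (fun k : ℕ => quadPhase θ u ((k : ZMod q) + -t) / quadPhase θ u (0 + -t)) =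
      ratio u d := by
    funext k
    rw [quadPhase_div hθ, ratio]
    congr 1
    rw [hr]; ring
  obtain ⟨δ, hδ, u₁, u₂, h⟩ := exists_splitting (b := fun l => quadPhase θ u (l + -t)) hq
    (circDist_two_mul_pos hq ht) (two_mul_circDist_lt hq (2 * t)) (quadPhase_ne_zero hθ u _)
    (fun l => by
      rw [← hd, hr, ← quadPhase_neg]; congr 1; ring)
    (fun l hl hld h => by
      rcases (quadPhase_eq_iff hθ hu).mp h with h' | h'
      · exact hl (by linear_combination h')
      · rw [← hd, hr] at hld
        exact hld (by linear_combination h'))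
  obtain ⟨hc₁, hc₂, h₁, h₂, hroot, hlim⟩ := h
  rw [hratio] at hlim
  rw [hb0] at h₁ h₂ hlim
  have hball : ∀ μ ∈ Set.Ioo (-δ) δ, (μ : ℂ) ∈ Metric.ball (0 : ℂ) δ := fun μ hμ => by
    rw [Metric.mem_ball, dist_zero_right, Complex.norm_real, Real.norm_eq_abs, abs_lt]
    exact hμ
  refine ⟨δ, hδ, fun μ => u₁ μ, fun μ => u₂ μ,
    hc₁.comp Complex.continuous_ofReal.continuousOn hball,
    hc₂.comp Complex.continuous_ofReal.continuousOn hball, by simpa using h₁, by simpa using h₂,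
    fun μ hμ => ?_, hlim.comp ?_⟩
  · rw [eval_blochPoly_zero_left _ _ _ (-t), eval_blochPoly_zero_left _ _ _ (-t)]
    exact hroot μ (hball μ hμ)
  · refine tendsto_nhdsWithin_iff.mpr ⟨?_, ?_⟩
    · have := Complex.continuous_ofReal.tendsto (0 : ℝ)
      rw [Complex.ofReal_zero] at this
      exact this.mono_left nhdsWithin_le_nhds
    · filter_upwards [self_mem_nhdsWithin] with μ hμ
      simpa using hμ

/-- The right end of a pair receives the even branch and the left end the odd one. The splitting
constant is then antisymmetric in `t`. -/
lemma exists_branches (hq : 2 < q) {θ : ℂ} (hθ : ‖θ‖ = 1) {u : ZMod q} (hu : u ≠ 0) :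
    ∃ δ > (0 : ℝ), ∃ v : ZMod q → ℝ → ℂ, ∃ κ : ZMod q → ℂ, ∀ t, t ≠ 0 →
      ContinuousOn (v t) (Set.Ioo (-δ) δ) ∧ v t 0 = quadPhase θ u t ∧
      (∀ μ ∈ Set.Ioo (-δ) δ, (blochPoly (quadPhase θ u) 0 μ).eval (v t μ) = 0) ∧
      Tendsto (fun μ : ℝ => (v t μ - v (-t) μ) / (μ : ℂ) ^ circDist (2 * t)) (𝓝[≠] 0) (𝓝 (κ t)) ∧
      ‖κ t‖ = 2 * (1 / 2) ^ circDist (2 * t) *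
        ‖transmission (ratio u (circDist (2 * t))) (circDist (2 * t))‖ := by
  have hex : ∀ t : ZMod q, ∃ δ > (0 : ℝ), ∃ u₁ u₂ : ℝ → ℂ, t ≠ 0 → IsRightEnd t →
      ContinuousOn u₁ (Set.Ioo (-δ) δ) ∧
      ContinuousOn u₂ (Set.Ioo (-δ) δ) ∧ u₁ 0 = quadPhase θ u t ∧ u₂ 0 = quadPhase θ u t ∧
      (∀ μ ∈ Set.Ioo (-δ) δ, (blochPoly (quadPhase θ u) 0 μ).eval (u₁ μ) = 0 ∧
        (blochPoly (quadPhase θ u) 0 μ).eval (u₂ μ) = 0) ∧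
      Tendsto (fun μ : ℝ => (u₁ μ - u₂ μ) / (μ : ℂ) ^ circDist (2 * t)) (𝓝[≠] 0)
        (𝓝 (-2 * (quadPhase θ u t * (Complex.I / 2) ^ circDist (2 * t) *
          transmission (ratio u (circDist (2 * t))) (circDist (2 * t))))) := by
    intro t
    by_cases h : t ≠ 0 ∧ IsRightEnd t
    · obtain ⟨δ, hδ, u₁, u₂, h'⟩ := exists_split_pair hq hθ hu h.1 h.2
      exact ⟨δ, hδ, u₁, u₂, fun _ _ => h'⟩
    · exact ⟨1, one_pos, 0, 0, fun h1 h2 => absurd ⟨h1, h2⟩ h⟩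
  choose δ₀ hδ₀ v₁ v₂ hv using hex
  have hne : (univ : Finset (ZMod q)).Nonempty := ⟨0, mem_univ 0⟩
  set δ := univ.inf' hne δ₀ with hδ
  have hsub : ∀ t, Set.Ioo (-δ) δ ⊆ Set.Ioo (-δ₀ t) (δ₀ t) := fun t =>
    Set.Ioo_subset_Ioo (neg_le_neg (inf'_le _ (mem_univ t))) (inf'_le _ (mem_univ t))
  set k : ZMod q → ℂ := fun t => -2 * (quadPhase θ u t * (Complex.I / 2) ^ circDist (2 * t) *
          transmission (ratio u (circDist (2 * t))) (circDist (2 * t))) with hk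
  have hknorm : ∀ t, ‖k t‖ = 2 * (1 / 2) ^ circDist (2 * t) *
        ‖transmission (ratio u (circDist (2 * t))) (circDist (2 * t))‖ := fun t => by
    simp only [hk, norm_mul, norm_neg, norm_pow, norm_div, norm_quadPhase hθ, Complex.norm_I,
      Complex.norm_ofNat, one_mul, mul_assoc]
  classical
  refine ⟨δ, (lt_inf'_iff _).mpr fun t _ => hδ₀ t,
    fun t => if IsRightEnd t then v₁ t else v₂ (-t),
    fun t => if IsRightEnd t then k t else -k (-t), fun t ht => ?_⟩
  have hiff := isRightEnd_neg_iff hq ht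
  by_cases h : IsRightEnd t
  · obtain ⟨h1, -, h3, -, h5, h6⟩ := hv t ht h
    simp only [h, if_true, if_neg (show ¬ IsRightEnd (-t) from fun h' => hiff.mp h' h), neg_neg]
    exact ⟨h1.mono (hsub t), h3, fun μ hμ => (h5 μ (hsub t hμ)).1, h6, hknorm t⟩
  · obtain ⟨-, h2, -, h4, h5, h6⟩ := hv (-t) (neg_ne_zero.mpr ht) (hiff.mpr h)
    simp only [h, if_false, if_pos (hiff.mpr h)]
    rw [quadPhase_neg] at h4
    have hcd : circDist (2 * -t) = circDist (2 * t) := by rw [mul_neg, circDist_neg]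
    refine ⟨h2.mono (hsub _), h4, fun μ hμ => (h5 μ (hsub _ hμ)).2, ?_, ?_⟩
    · refine (h6.neg.congr fun μ => ?_)
      rw [hcd]; ring
    · rw [norm_neg, hknorm, hcd]

/-- The orders of the gaps between the eigenvalues at `ϑ = 0`. -/
def gapOrder (s t : ZMod q) : ℕ := if s = -t then circDist (2 * s) else 0

lemma sum_gapOrder (hq : 2 < q) (s : ZMod q) :
    ∑ r ∈ univ.erase s, gapOrder s r = circDist (2 * s) := by
  by_cases hs : s = 0
  · subst hs
    rw [mul_zero, circDist_zero]
    refine sum_eq_zero fun r hr => ?_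
    rw [gapOrder, mul_zero, circDist_zero, ite_self]
  · rw [sum_eq_single (-s)]
    · rw [gapOrder, neg_neg, if_pos rfl]
    · intro r _ hr
      rw [gapOrder, if_neg]
      rintro rfl
      exact hr (neg_neg r).symm
    · intro h
      exact absurd (mem_erase.mpr ⟨neg_ne_self_zmod hq hs, mem_univ _⟩) h

/-- Here `2d < q` enters: the angle moves a root at order `q - d`, beyond the splitting order `d`.
-/
lemma gapOrder_add_left_lt (hq : 2 < q) (s t : ZMod q) : gapOrder s t + circDist (2 * s) < q := by
  have := two_mul_circDist_lt hq (2 * s)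
  rw [gapOrder]; split_ifs <;> omega

lemma gapOrder_add_right_lt (hq : 2 < q) (s t : ZMod q) : gapOrder s t + circDist (2 * t) < q := by
  have h := two_mul_circDist_lt hq (2 * t)
  rw [gapOrder]
  split_ifs with hst
  · rw [hst, mul_neg, circDist_neg]; omega
  · omega

lemma exists_separatedFamily (hq : 2 < q) {θ : ℂ} (hθ : ‖θ‖ = 1) {u : ZMod q} (hu : u ≠ 0) :
    ∃ δ : ℝ, ∃ v : ZMod q → ℝ → ℂ, ∃ κ : ZMod q → ZMod q → ℂ,
      SeparatedFamily q (fun n => kickSum (coeffWeight (quadPhase θ u) n))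
        (fun n => kickSumDeriv (coeffWeight (quadPhase θ u) n)) v gapOrder κ δ ∧
      (∀ t, v t 0 = quadPhase θ u t) ∧
      (∀ s t, s ≠ -t → κ s t = quadPhase θ u s - quadPhase θ u t) ∧
      ∀ t, t ≠ 0 → ‖κ t (-t)‖ = 2 * (1 / 2) ^ circDist (2 * t) *
        ‖transmission (ratio u (circDist (2 * t))) (circDist (2 * t))‖ := by
  obtain ⟨δ, hδ, v, k, hv⟩ := exists_branches hq hθ hu
  set a := quadPhase θ u with ha
  set c : ℕ → ℝ → ℝ → ℂ := fun n => kickSum (coeffWeight a n)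
  have hcard : Fintype.card (ZMod q) = q := ZMod.card q
  have hpoly : ∀ ϑ μ, ∑ n ∈ range (Fintype.card (ZMod q) + 1), C (c n ϑ μ) * X ^ n =
      blochPoly a ϑ μ := fun ϑ μ => by rw [hcard]; rfl
  -- the remaining root is determined by the trace
  set w : ZMod q → ℝ → ℂ := fun t μ =>
    if t = 0 then -c (q - 1) 0 μ - ∑ s ∈ univ.erase 0, v s μ else v t μ with hw
  set κ : ZMod q → ZMod q → ℂ := fun s t => if s = -t then k s else a s - a t with hκ
  have hwv : ∀ t, t ≠ 0 → w t = v t := fun t ht => by funext μ; simp [hw, ht]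
  have hq0 : 0 < q := by omega
  have hnext : ∀ μ, (blochPoly a 0 μ).nextCoeff = c (q - 1) 0 μ := fun μ =>
    nextCoeff_sum_C_mul_X_pow (c := fun n => c n 0 μ) (kickSum_coeffWeight_self a 0 μ) hq0
  have hmonic : ∀ μ, (blochPoly a 0 μ).Monic ∧ (blochPoly a 0 μ).natDegree = q := fun μ =>
    monic_sum_C_mul_X_pow (c := fun n => c n 0 μ) (kickSum_coeffWeight_self a 0 μ)
  have hw0 : ∀ t, w t 0 = a t := by
    intro t
    by_cases ht : t = 0
    · have h1 := hnext 0
      rw [blochPoly_zero_right, prod_X_sub_C_nextCoeff, ← add_sum_erase univ _ (mem_univ 0)] at h1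
      have h2 : ∑ s ∈ univ.erase 0, v s 0 = ∑ s ∈ univ.erase 0, a s :=
        sum_congr rfl fun s hs => (hv s (ne_of_mem_erase hs)).2.1
      simp only [hw, ht, if_true]
      rw [h2, ← h1]; ring
    · rw [hwv t ht]; exact (hv t ht).2.1
  have hwc : ∀ t, ContinuousOn (w t) (Set.Ioo (-δ) δ) := by
    intro t
    by_cases ht : t = 0
    · simp only [hw, ht, if_true]
      refine ContinuousOn.sub (Continuous.continuousOn ?_)
        (continuousOn_finsetSum _ fun s hs => (hv s (ne_of_mem_erase hs)).1)
      exact ((continuous_kickSum _).comp (continuous_const.prodMk continuous_id)).neg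
    · rw [hwv t ht]; exact (hv t ht).1
  have hmem : Set.Ioo (-δ) δ ∈ 𝓝 (0 : ℝ) := Ioo_mem_nhds (neg_lt_zero.mpr hδ) hδ
  have hκ0 : ∀ s t, s ≠ t → κ s t ≠ 0 := by
    intro s t hst
    simp only [hκ]
    split_ifs with h
    · have hs : s ≠ 0 := by
        rintro rfl
        exact hst (by rw [zero_eq_neg] at h; exact h.symm)
      rw [← norm_pos_iff, (hv s hs).2.2.2.2]
      have h1 := transmission_ne_zero hu hq (circDist_two_mul_pos hq hs)
        (by have := two_mul_circDist_lt hq (2 * s); omega)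
      have := norm_pos_iff.mpr h1
      positivity
    · rw [sub_ne_zero, ha, Ne, quadPhase_eq_iff hθ hu]
      exact fun h' => h'.elim hst h
  have hlim : ∀ s t, s ≠ t → Tendsto (fun μ : ℝ => (w s μ - w t μ) / (μ : ℂ) ^ gapOrder s t) (𝓝[≠] 0)
      (𝓝 (κ s t)) := by
    intro s t hst
    simp only [hκ, gapOrder]
    split_ifs with h
    · have hs : s ≠ 0 := by
        rintro rfl
        exact hst (by rw [zero_eq_neg] at h; exact h.symm)
      have ht : t = -s := by rw [h, neg_neg]
      rw [ht, hwv s hs, hwv (-s) (neg_ne_zero.mpr hs)]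
      exact (hv s hs).2.2.2.1
    · simp only [pow_zero, div_one]
      rw [← hw0 s, ← hw0 t]
      exact (((hwc s).continuousAt hmem).sub ((hwc t).continuousAt hmem)).tendsto.mono_left
        nhdsWithin_le_nhds
  have hsep : ∀ᶠ μ : ℝ in 𝓝[≠] 0, ∀ s t, s ≠ t → w s μ ≠ w t μ := by
    refine eventually_all.mpr fun s => eventually_all.mpr fun t => ?_
    by_cases hst : s = t
    · exact Eventually.of_forall fun _ h => absurd hst h
    · filter_upwards [(hlim s t hst).eventually_ne (hκ0 s t hst)] with μ hμ _ h
      rw [h, sub_self, zero_div] at hμ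
      exact hμ rfl
  -- For `μ ≠ 0` the branches are distinct roots and their linear factors are coprime; `μ = 0` is
  -- treated by direct computation.
  have hfact : ∀ᶠ μ : ℝ in 𝓝 0, blochPoly a 0 μ = ∏ t, (X - C (w t μ)) := by
    have h1 : ∀ᶠ μ : ℝ in 𝓝[≠] 0, blochPoly a 0 μ = ∏ t, (X - C (w t μ)) := by
      filter_upwards [hsep, nhdsWithin_le_nhds hmem] with μ hμ hμδ
      have h2 : ∏ t ∈ univ.erase 0, (X - C (v t μ)) ∣ blochPoly a 0 μ := by
        refine Finset.prod_dvd_of_coprime ?_ fun t ht =>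
          dvd_iff_isRoot.mpr ((hv t (ne_of_mem_erase ht)).2.2.1 μ hμδ)
        intro s hs t ht hst
        have := hμ s t hst
        rw [hwv s (ne_of_mem_erase hs), hwv t (ne_of_mem_erase ht)] at this
        exact isCoprime_X_sub_C_of_isUnit_sub (sub_ne_zero.mpr this).isUnit
      obtain ⟨Q, hQ⟩ := h2
      have hS : (∏ t ∈ univ.erase 0, (X - C (v t μ))).Monic :=
        monic_prod_of_monic _ _ fun t _ => monic_X_sub_C _
      -- The cofactor is monic of degree 1, and comparison of the next coefficient identifies its
      -- root with the one defined by the trace.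
      have hQm : Q.Monic := hS.of_mul_monic_left (hQ ▸ (hmonic μ).1)
      have hQd : Q.natDegree = 1 := by
        have h3 := (hmonic μ).2
        rw [hQ, hS.natDegree_mul hQm, natDegree_finsetProd_X_sub_C_eq_card,
          card_erase_of_mem (mem_univ _), card_univ, hcard] at h3
        omega
      have hQX := hQm.eq_X_add_C hQd
      have h4 := hnext μ
      rw [hQ, hS.nextCoeff_mul hQm, prod_X_sub_C_nextCoeff, hQX, nextCoeff_X_add_C] at h4
      rw [hQ, ← prod_erase_mul univ _ (mem_univ (0 : ZMod q)), hQX]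
      congr 1
      · exact prod_congr rfl fun t ht => by rw [hwv t (ne_of_mem_erase ht)]
      · rw [sub_eq_add_neg, ← C_neg]
        congr 2
        simp only [hw, if_true]
        linear_combination h4
    rw [eventually_nhdsWithin_iff] at h1
    filter_upwards [h1] with μ hμ
    by_cases hμ0 : μ = 0
    · rw [hμ0, blochPoly_zero_right]
      exact prod_congr rfl fun t _ => by rw [hw0]
    · exact hμ hμ0
  obtain ⟨ε, hε, hball⟩ := Metric.eventually_nhds_iff_ball.mp hfact
  set δ' := min δ ε
  refine ⟨δ', w, κ, ?_, hw0, fun s t hst => if_neg hst, fun t ht => ?_⟩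
  · refine ⟨lt_min hδ hε, fun n => continuous_kickSum _, fun n => hasDerivAt_kickSum _,
      fun n => norm_kickSum_sub_le (isDihedral_coeffWeight (quadPhase_neg θ u) n), ?_, ?_, ?_, hlim,
      hκ0, ?_, ?_, ?_⟩
    · rw [hcard]; exact kickSum_coeffWeight_self a
    · exact fun t => (hwc t).mono
        (Set.Ioo_subset_Ioo (neg_le_neg (min_le_left _ _)) (min_le_left _ _))
    · intro μ hμ
      rw [hpoly, hball μ]
      rw [Metric.mem_ball, Real.dist_eq, sub_zero, abs_lt]
      exact ⟨by linarith [hμ.1, min_le_right δ ε], hμ.2.trans_le (min_le_right _ _)⟩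
    · intro s t _
      rw [sum_gapOrder hq]; exact gapOrder_add_left_lt hq s t
    · intro s t _
      rw [sum_gapOrder hq]; exact gapOrder_add_right_lt hq s t
    · intro t
      rw [sum_gapOrder hq]
      have := two_mul_circDist_lt hq (2 * t)
      omega
  · simp only [hκ, neg_neg, if_true]
    exact (hv t ht).2.2.2.2

end Quadratic

end KickedRotor

/-! ### Modulus of the leading coefficient. -/

namespace KickedRotor

open Finset ZMod Filter Topology Polynomial

section Quadratic

variable {q : ℕ} [Fact q.Prime]

/-- The distance of two free eigenvalues, or `1` if their momenta agree up to sign. -/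
noncomputable def gapFactor (θ : ℂ) (u t r : ZMod q) : ℝ :=
  if r = t ∨ r = -t then 1 else ‖quadPhase θ u t - quadPhase θ u r‖

lemma gapFactor_pos {θ : ℂ} (hθ : ‖θ‖ = 1) {u : ZMod q} (hu : u ≠ 0) (t r : ZMod q) :
    0 < gapFactor θ u t r := by
  rw [gapFactor]
  split_ifs with h
  · exact one_pos
  · rw [norm_pos_iff, sub_ne_zero, Ne, quadPhase_eq_iff hθ hu]
    rintro (h' | h')
    · exact h (Or.inl h'.symm)
    · exact h (Or.inr (neg_eq_iff_eq_neg.mpr h').symm)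

lemma gapFactor_neg (θ : ℂ) (u t r : ZMod q) : gapFactor θ u (-t) r = gapFactor θ u t r := by
  simp only [gapFactor, quadPhase_neg, neg_neg, or_comm]

lemma prod_range_natCast {M : Type*} [CommMonoid M] (f : ZMod q → M) :
    ∏ s ∈ range q, f (s : ZMod q) = ∏ t, f t := by
  rw [← Fin.prod_univ_eq_prod_range (fun s => f (s : ZMod q)) q]
  exact Fintype.prod_equiv (indexEquiv q) _ _ fun i => rfl

lemma prod_gapFactor_zero (θ : ℂ) (u : ZMod q) :
    ∏ l ∈ range (q - 1), ‖quadPhase θ u 0 - quadPhase θ u ((l + 1 : ℕ) : ZMod q)‖ =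
      ∏ r, gapFactor θ u 0 r := by
  have hq0 : 0 < q := (Fact.out : q.Prime).pos
  rw [← prod_range_natCast, show range q = range (q - 1 + 1) by rw [Nat.sub_add_cancel hq0],
    prod_range_succ', Nat.cast_zero, show gapFactor θ u 0 0 = 1 by simp [gapFactor], mul_one]
  refine prod_congr rfl fun l hl => ?_
  have h := natCast_ne_zero_zmod (q := q) (Nat.succ_pos l) (by have := mem_range.mp hl; omega)
  rw [gapFactor, if_neg (by rw [neg_zero, or_self]; exact h)]

/-- The arcs from `-t` to `t` and from `t` on to `-t` together visit every other momentum once. -/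
lemma prod_gapFactor {θ : ℂ} {u t : ZMod q} {d : ℕ} (hd0 : 0 < d) (hdq : d < q)
    (hd : (d : ZMod q) = 2 * t) :
    (∏ l ∈ range (d - 1), ‖quadPhase θ u t - quadPhase θ u (((l + 1 : ℕ) : ZMod q) + -t)‖) *
      ∏ l ∈ range (q - d - 1),
        ‖quadPhase θ u t - quadPhase θ u (((d + (l + 1) : ℕ) : ZMod q) + -t)‖ =
      ∏ r, gapFactor θ u t r := by
  have h0 : ∀ k : ℕ, k < q → k ≠ 0 → k ≠ d → gapFactor θ u t ((k : ZMod q) + -t) =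
      ‖quadPhase θ u t - quadPhase θ u ((k : ZMod q) + -t)‖ := by
    intro k hk hk0 hkd
    rw [gapFactor, if_neg]
    rintro (h | h)
    · refine hkd ((natCast_eq_natCast_zmod_iff hk hdq).mp ?_)
      rw [hd]; linear_combination h
    · exact natCast_ne_zero_zmod (Nat.pos_of_ne_zero hk0) hk (by linear_combination h)
  have h1 : ∏ r, gapFactor θ u t r = ∏ r, gapFactor θ u t (r + -t) :=
    (Fintype.prod_equiv (Equiv.addRight (-t)) _ _ fun r => rfl).symm
  rw [h1, ← prod_range_natCast (fun r => gapFactor θ u t (r + -t)),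
    show range q = range (d + (q - d)) by congr 1; omega, prod_range_add,
    show range d = range (d - 1 + 1) by congr 1; omega, prod_range_succ',
    show range (q - d) = range (q - d - 1 + 1) by congr 1; omega, prod_range_succ']
  have e1 : gapFactor θ u t (((0 : ℕ) : ZMod q) + -t) = 1 := by simp [gapFactor]
  have e2 : gapFactor θ u t (((d + 0 : ℕ) : ZMod q) + -t) = 1 := by
    rw [add_zero, hd, gapFactor, if_pos]
    left; ring
  rw [e1, e2, mul_one, mul_one]
  congr 1
  · refine prod_congr rfl fun l hl => ?_
    have := mem_range.mp hl
    rw [h0 (l + 1) (by omega) (by omega) (by omega)]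
  · refine prod_congr rfl fun l hl => ?_
    have := mem_range.mp hl
    rw [h0 (d + (l + 1)) (by omega) (by omega) (by omega)]

lemma norm_leadingHarmonic_quadPhase_zero {θ : ℂ} (hθ : ‖θ‖ = 1) {u : ZMod q} (hu : u ≠ 0) :
    ‖leadingHarmonic (quadPhase θ u) (quadPhase θ u 0)‖ =
      ‖transmission (ratio u q) q‖ * ∏ r, gapFactor θ u 0 r := by
  have hq0 : 0 < q := (Fact.out : q.Prime).pos
  rw [norm_leadingHarmonic (quadPhase_neg θ u) 0, ← prod_gapFactor_zero,
    norm_det_hessenberg (quadPhase_ne_zero hθ u _) hq0]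
  · simp only [add_zero, Nat.cast_zero, norm_quadPhase hθ, one_mul]
    congr 3
    funext l
    rw [quadPhase_div hθ, ratio]
    simp [sq]
  · intro l hl hlq h
    simp only [add_zero, Nat.cast_zero] at h
    rw [quadPhase_eq_iff hθ hu, neg_zero, or_self] at h
    exact natCast_ne_zero_zmod hl hlq h

/-- Started at `-t`, the cycle meets the degenerate site `t` after `d` steps, where the Hessenberg
determinant splits into the ladders of the two arcs. -/
lemma norm_leadingHarmonic_quadPhase_of_isRightEnd (hq : 2 < q) {θ : ℂ} (hθ : ‖θ‖ = 1) {u : ZMod q}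
    (hu : u ≠ 0) {t : ZMod q} (ht : t ≠ 0) (hr : IsRightEnd t) :
    ‖leadingHarmonic (quadPhase θ u) (quadPhase θ u t)‖ =
      ‖transmission (ratio u (circDist (2 * t))) (circDist (2 * t))‖ *
      ‖transmission (ratio u (q - circDist (2 * t))) (q - circDist (2 * t))‖ *
        ∏ r, gapFactor θ u t r := by
  set d := circDist (2 * t) with hd
  have hr : (d : ZMod q) = 2 * t := hr
  have hd0 : 0 < d := circDist_two_mul_pos hq ht
  have hdq : 2 * d < q := two_mul_circDist_lt hq _
  have hb0 : quadPhase θ u (((0 : ℕ) : ZMod q) + -t) = quadPhase θ u t := by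
    rw [Nat.cast_zero, zero_add, quadPhase_neg]
  have hbd : quadPhase θ u ((d : ZMod q) + -t) = quadPhase θ u t := by
    rw [hr]; congr 1; ring
  have hne : ∀ k : ℕ, 0 < k → k < q → k ≠ d →
      quadPhase θ u ((k : ZMod q) + -t) ≠ quadPhase θ u t := by
    intro k hk hkq hkd h
    rcases (quadPhase_eq_iff hθ hu).mp h with h' | h'
    · refine hkd ((natCast_eq_natCast_zmod_iff hkq (by omega)).mp ?_)
      rw [hr]; linear_combination h'
    · exact natCast_ne_zero_zmod hk hkq (by linear_combination h')
  rw [← quadPhase_neg θ u t, norm_leadingHarmonic (quadPhase_neg θ u) (-t),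
    ← prod_gapFactor hd0 (by omega) hr]
  obtain ⟨e, he⟩ : ∃ e, q = d + e := ⟨q - d, by omega⟩
  have he' : q - d = e := by omega
  have hdet : (hessenberg (fun l : ℕ => quadPhase θ u ((l : ZMod q) + -t)) q).det =
      (hessenberg (fun l : ℕ => quadPhase θ u ((l : ZMod q) + -t)) d).det *
      (hessenberg (fun l : ℕ => quadPhase θ u (((d + l : ℕ) : ZMod q) + -t)) e).det := by
    rw [← det_hessenberg_add (by rw [hb0, hbd])]
    congr! 2
  rw [hdet, norm_mul, norm_det_hessenberg (by rw [hb0]; exact quadPhase_ne_zero hθ u _) hd0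
    (fun l hl hld => by rw [hb0]; exact hne l hl (by omega) (by omega)),
    norm_det_hessenberg (by rw [add_zero, hbd]; exact quadPhase_ne_zero hθ u _) (by omega)
    (fun l hl hld => by rw [add_zero, hbd]; exact hne _ (by omega) (by omega) (by omega))]
  simp only [add_zero, hb0, hbd, norm_quadPhase hθ, one_mul, he']
  have e1 : (fun l : ℕ => quadPhase θ u ((l : ZMod q) + -t) / quadPhase θ u t) = ratio u d := by
    funext l
    rw [quadPhase_div hθ, ratio, hr]; congr 1; ring
  have e2 : (fun l : ℕ => quadPhase θ u (((d + l : ℕ) : ZMod q) + -t) / quadPhase θ u t) =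
      ratio u e := by
    have he2 : (e : ZMod q) = -(2 * t) := by
      have : ((d + e : ℕ) : ZMod q) = 0 := by rw [← he, ZMod.natCast_self]
      rw [Nat.cast_add, hr] at this
      linear_combination this
    funext l
    rw [quadPhase_div hθ, ratio, Nat.cast_add, hr, he2]; congr 1; ring
  rw [e1, e2]
  ring

lemma norm_leadingHarmonic_quadPhase (hq : 2 < q) {θ : ℂ} (hθ : ‖θ‖ = 1) {u : ZMod q}
    (hu : u ≠ 0) {t : ZMod q} (ht : t ≠ 0) :
    ‖leadingHarmonic (quadPhase θ u) (quadPhase θ u t)‖ =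
      ‖transmission (ratio u (circDist (2 * t))) (circDist (2 * t))‖ *
      ‖transmission (ratio u (q - circDist (2 * t))) (q - circDist (2 * t))‖ *
        ∏ r, gapFactor θ u t r := by
  by_cases h : IsRightEnd t
  · exact norm_leadingHarmonic_quadPhase_of_isRightEnd hq hθ hu ht h
  · have h1 := norm_leadingHarmonic_quadPhase_of_isRightEnd hq hθ hu (neg_ne_zero.mpr ht)
      ((isRightEnd_neg_iff hq ht).mpr h)
    simpa only [quadPhase_neg, gapFactor_neg, mul_neg, circDist_neg] using h1

/-- The eigenvalues `θ e(u t²)` of the free propagator continue to eigenvalue functions of the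
kicked propagator, with an explicit modulus for the leading coefficient. -/
theorem exists_eigenvalues (hq : 2 < q) {θ : ℂ} (hθ : ‖θ‖ = 1) {u : ZMod q} (hu : u ≠ 0) :
    ∃ s : ZMod q → ℂ, (∀ t, ‖s t‖ ≤ 2 * (1 / 2) ^ (q - circDist (2 * t)) *
        ‖transmission (ratio u (q - circDist (2 * t))) (q - circDist (2 * t))‖) ∧
      ∃ δ > 0, ∃ w : ZMod q → ℝ → ℝ → ℂ,
      (∀ t, ContinuousOn (fun x : ℝ × ℝ => w t x.1 x.2) (Set.univ ×ˢ Set.Ioo (-δ) δ)) ∧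
      (∀ ϑ, ∀ μ ∈ Set.Ioo (-δ) δ, blochPoly (quadPhase θ u) ϑ μ = ∏ t, (X - C (w t ϑ μ))) ∧
      (∀ t ϑ, w t ϑ 0 = quadPhase θ u t) ∧
      (∀ t, ∀ μ ∈ Set.Ioo (-δ) δ, Differentiable ℝ fun ϑ => w t ϑ μ) ∧
      ∀ t, ∀ ϑ : ℝ, Asymptotics.IsEquivalent (𝓝[≠] 0)
        (fun μ : ℝ => deriv (fun x : ℝ => w t (x / q) μ) ϑ)
        (fun μ : ℝ => (μ : ℂ) ^ (q - circDist (2 * t)) * s t * (Real.sin ϑ : ℂ)) := by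
  obtain ⟨δ₀, v, κ, hfam, hv0, hκ, hκ'⟩ := exists_separatedFamily hq hθ hu
  set a := quadPhase θ u with ha
  have hcard : Fintype.card (ZMod q) = q := ZMod.card q
  have hqC : (q : ℂ) ≠ 0 := natCast_prime_ne_zero
  have hqR : (q : ℝ) ≠ 0 := by exact_mod_cast hqC
  have hlead : ∀ n (ϑ : ℝ), Tendsto (fun μ : ℝ => kickSumDeriv (coeffWeight a n) ϑ μ / (μ : ℂ) ^ q)
      (𝓝[≠] 0) (𝓝 (-(2 * q * (Complex.I / 2) ^ q * Real.sin (q * ϑ)) *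
        harmonicCoeff (coeffWeight a n))) := by
    intro n ϑ
    obtain ⟨B, hB⟩ := norm_kickSumDeriv_sub_le (isDihedral_coeffWeight (quadPhase_neg θ u) n) hq
    rw [tendsto_iff_norm_sub_tendsto_zero]
    have h1 : Tendsto (fun μ : ℝ => B * |μ| ^ 1) (𝓝[≠] 0) (𝓝 0) :=
      (SeparatedFamily.tendsto_const_mul_abs_pow B one_pos).mono_left nhdsWithin_le_nhds
    refine squeeze_zero' (Eventually.of_forall fun _ => norm_nonneg _) ?_ h1
    filter_upwards [nhdsWithin_le_nhds (Metric.ball_mem_nhds (0 : ℝ) one_pos), self_mem_nhdsWithin]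
      with μ hμ hμ0
    rw [Metric.mem_ball, Real.dist_eq, sub_zero] at hμ
    have hμ0 : μ ≠ 0 := hμ0
    have hμC : (μ : ℂ) ≠ 0 := by exact_mod_cast hμ0
    have e : kickSumDeriv (coeffWeight a n) ϑ μ / (μ : ℂ) ^ q -
        -(2 * q * (Complex.I / 2) ^ q * Real.sin (q * ϑ)) * harmonicCoeff (coeffWeight a n) =
        (kickSumDeriv (coeffWeight a n) ϑ μ + 2 * q * (Complex.I / 2) ^ q * (μ : ℂ) ^ q *
          Real.sin (q * ϑ) * harmonicCoeff (coeffWeight a n)) / (μ : ℂ) ^ q := by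
      field_simp
      ring
    rw [e, norm_div, norm_pow, Complex.norm_real, Real.norm_eq_abs,
      div_le_iff₀ (pow_pos (abs_pos.mpr hμ0) _), mul_assoc B, ← pow_add, add_comm 1 q]
    exact hB ϑ μ hμ.le
  obtain ⟨δ, hδ, w, hc, hfac, hw0, hdiff, hlim, hzero⟩ := hfam.exists_roots hlead
  simp only [hcard, hv0, sum_gapOrder hq] at hfac hw0 hlim
  set k : ZMod q → ℂ := fun t => ∏ r ∈ univ.erase t, κ t r with hk
  have hk0 : ∀ t, k t ≠ 0 := fun t => prod_ne_zero_iff.mpr fun r hr =>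
    hfam.ne_zero t r (ne_of_mem_erase hr).symm
  -- Implicit differentiation gives `-∂P/∂ϑ` over the product of gaps. The factor `q` from
  -- differentiating `cos(qϑ)` cancels against the rescaling `ϑ / q`.
  set s : ZMod q → ℂ := fun t => 2 * (Complex.I / 2) ^ q * leadingHarmonic a (a t) / k t with hs
  have hsnorm : ∀ t, ‖s t‖ = 2 * (1 / 2) ^ q * ‖leadingHarmonic a (a t)‖ / ‖k t‖ := fun t => by
    simp only [hs, norm_div, norm_mul, norm_pow, Complex.norm_I, Complex.norm_ofNat]
  have hG : ∀ t, 0 < ∏ r, gapFactor θ u t r := fun t => prod_pos fun r _ => gapFactor_pos hθ hu t r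
  have hkappa : ∀ t r, r ≠ t → r ≠ -t → ‖κ t r‖ = gapFactor θ u t r := by
    intro t r h1 h2
    rw [hκ t r (fun h => h2 (by rw [h, neg_neg])), gapFactor, if_neg (not_or.mpr ⟨h1, h2⟩)]
  have hs0 : ‖s 0‖ = 2 * (1 / 2) ^ q * ‖transmission (ratio u q) q‖ := by
    have h1 : ‖k 0‖ = ∏ r, gapFactor θ u 0 r := by
      rw [hk, norm_prod, ← mul_prod_erase univ _ (mem_univ (0 : ZMod q)),
        show gapFactor θ u 0 0 = 1 by simp [gapFactor], one_mul]
      refine prod_congr rfl fun r hr => hkappa 0 r (ne_of_mem_erase hr) ?_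
      rw [neg_zero]; exact ne_of_mem_erase hr
    rw [hsnorm, norm_leadingHarmonic_quadPhase_zero hθ hu, h1]
    have := (hG 0).ne'
    field_simp
  -- The gap to `-t` contributes `2 · 2^(-d)` times the transmission of the short arc. This cancels
  -- the factor 2, part of the power of 1/2, and the short ladder in the leading harmonic.
  have hst : ∀ t, t ≠ 0 → ‖s t‖ = (1 / 2) ^ (q - circDist (2 * t)) *
      ‖transmission (ratio u (q - circDist (2 * t))) (q - circDist (2 * t))‖ := by
    intro t ht
    have hdq := two_mul_circDist_lt hq (2 * t)
    have h1 : ‖k t‖ = ‖κ t (-t)‖ * ∏ r, gapFactor θ u t r := by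
      have hmem : -t ∈ univ.erase t := mem_erase.mpr ⟨neg_ne_self_zmod hq ht, mem_univ _⟩
      rw [hk, norm_prod, ← mul_prod_erase univ _ (mem_univ t), ← mul_prod_erase _ _ hmem,
        ← mul_prod_erase (univ.erase t) (gapFactor θ u t) hmem,
        show gapFactor θ u t t = 1 by simp [gapFactor],
        show gapFactor θ u t (-t) = 1 by simp [gapFactor], one_mul, one_mul]
      congr 1
      refine prod_congr rfl fun r hr => hkappa t r ?_ (ne_of_mem_erase hr)
      exact ne_of_mem_erase (mem_of_mem_erase hr)
    have h2 := norm_pos_iff.mpr (transmission_ne_zero hu hq (circDist_two_mul_pos hq ht)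
        (show circDist (2 * t) ≤ q by omega))
    rw [hsnorm, norm_leadingHarmonic_quadPhase hq hθ hu ht, h1, hκ' t ht]
    have := (hG t).ne'
    have hp : ((1 : ℝ) / 2) ^ q = (1 / 2) ^ (q - circDist (2 * t)) * (1 / 2) ^ circDist (2 * t) := by
      rw [← pow_add, Nat.sub_add_cancel (by omega)]
    rw [hp, div_eq_iff (by positivity)]
    ring
  have hsne : ∀ t, s t ≠ 0 := by
    intro t
    rw [← norm_pos_iff]
    have hdq := two_mul_circDist_lt hq (2 * t)
    by_cases ht : t = 0
    · rw [ht, hs0]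
      have := norm_pos_iff.mpr (transmission_ne_zero hu hq (by omega) le_rfl)
      positivity
    · rw [hst t ht]
      have := norm_pos_iff.mpr (transmission_ne_zero hu hq
        (show 0 < q - circDist (2 * t) by omega) (Nat.sub_le _ _))
      positivity
  refine ⟨s, fun t => ?_, δ, hδ, w, hc, hfac, hw0, hdiff, fun t ϑ => ?_⟩
  -- Only `t = 0` keeps the factor 2, since it has no partner to cancel it.
  · by_cases ht : t = 0
    · rw [ht, hs0, mul_zero, circDist_zero, Nat.sub_zero]
    · rw [hst t ht, mul_assoc]
      refine le_mul_of_one_le_left (by positivity) one_le_two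
  have hmem : ∀ᶠ μ : ℝ in 𝓝[≠] 0, μ ∈ Set.Ioo (-δ) δ :=
    nhdsWithin_le_nhds (Ioo_mem_nhds (neg_lt_zero.mpr hδ) hδ)
  have hd : ∀ μ ∈ Set.Ioo (-δ) δ, deriv (fun x : ℝ => w t (x / q) μ) ϑ =
      (q : ℂ)⁻¹ * deriv (fun x => w t x μ) (ϑ / q) := by
    intro μ hμ
    have h1 := (hdiff t μ hμ (ϑ / q)).hasDerivAt
    have h2 : HasDerivAt (fun x : ℝ => x / q) ((1 : ℝ) / q) ϑ := (hasDerivAt_id ϑ).div_const _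
    refine (h1.scomp ϑ h2).deriv.trans ?_
    rw [one_div, Complex.real_smul, Complex.ofReal_inv, Complex.ofReal_natCast]
  have hqϑ : (q : ℝ) * (ϑ / q) = ϑ := mul_div_cancel₀ ϑ hqR
  -- If the sine vanishes, both sides are exactly zero for small `μ ≠ 0`.
  by_cases hsin : Real.sin ϑ = 0
  · refine Asymptotics.IsEquivalent.refl.congr_left ?_
    filter_upwards [hmem, self_mem_nhdsWithin] with μ hμ hμ0
    rw [hd μ hμ, hzero t (ϑ / q) μ hμ hμ0 fun n => kickSumDeriv_eq_zero
      (isDihedral_coeffWeight (quadPhase_neg θ u) n) (by rw [hqϑ, hsin]) μ, hsin]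
    simp
  · have hsinC : (Real.sin ϑ : ℂ) ≠ 0 := by exact_mod_cast hsin
    rw [Asymptotics.isEquivalent_iff_tendsto_one]
    · have h1 := (hlim t (ϑ / q)).const_mul ((q : ℂ)⁻¹ / (s t * Real.sin ϑ))
      have e : (q : ℂ)⁻¹ / (s t * Real.sin ϑ) *
          (-(-(2 * q * (Complex.I / 2) ^ q * Real.sin (q * (ϑ / q))) *
            ∑ n ∈ range (q + 1), harmonicCoeff (coeffWeight a n) * a t ^ n) / k t) = 1 := by
        have h2 : s t = 2 * (Complex.I / 2) ^ q * leadingHarmonic a (a t) / k t := rfl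
        have h3 : ∑ n ∈ range (q + 1), harmonicCoeff (coeffWeight a n) * a t ^ n =
          leadingHarmonic a (a t) := rfl
        have h4 : -(-(2 * q * (Complex.I / 2) ^ q * Real.sin ϑ) * leadingHarmonic a (a t)) / k t =
            q * (s t * Real.sin ϑ) := by rw [h2]; ring
        rw [hqϑ, h3, h4]
        have := hsne t
        field_simp
      rw [e] at h1
      refine h1.congr' ?_
      filter_upwards [hmem, self_mem_nhdsWithin] with μ hμ hμ0
      have hμ0 : μ ≠ 0 := hμ0
      have hμC : (μ : ℂ) ≠ 0 := by exact_mod_cast hμ0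
      have := hsne t
      rw [Pi.div_apply, hd μ hμ]
      field_simp
    · filter_upwards [self_mem_nhdsWithin] with μ hμ0 h0
      have hμ0 : μ ≠ 0 := hμ0
      have hμC : (μ : ℂ) ≠ 0 := by exact_mod_cast hμ0
      exact absurd h0 (mul_ne_zero (mul_ne_zero (pow_ne_zero _ hμC) (hsne t)) hsinC)

end Quadratic

end KickedRotor

/-! ### Translation to the indices `1, …, q`. -/

namespace KickedRotor

open Finset ZMod Filter Topology Polynomial

section Translation

variable {q : ℕ} [Fact q.Prime]

lemma circDist_natCast_eq_min {k : ℕ} (hk : k ≤ q) (hq : 2 < q) :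
    circDist (k : ZMod q) = min k (q - k) := by
  have hodd : q % 2 = 1 := (Fact.out : q.Prime).eq_two_or_odd.resolve_left (by omega)
  rcases lt_or_gt_of_ne (show 2 * k ≠ q by omega) with h | h
  · rw [circDist_natCast h]; omega
  · have e : (k : ZMod q) = -((q - k : ℕ) : ZMod q) := by
      rw [Nat.cast_sub hk, ZMod.natCast_self]; ring
    rw [e, circDist_neg, circDist_natCast (by omega)]; omega

lemma exponent_bounds {j : ℕ} (hq : 2 < q) (hj : j ∈ Icc 1 q) :
    q < 2 * exponent q j ∧ exponent q j ≤ q := by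
  have hodd : q % 2 = 1 := (Fact.out : q.Prime).eq_two_or_odd.resolve_left (by omega)
  have := mem_Icc.mp hj
  rw [exponent]
  omega

/-- The partners of index `j` are at distance `2(j - h) ≡ 2j - 1`. For `j` beyond the middle, the
reflected index `q + 1 - j` gives the same distance. -/
lemma exponent_eq {h : ZMod q} (hh : 2 * h = 1) {j : ℕ} (hq : 2 < q) (hj : j ∈ Icc 1 q) :
    exponent q j = q - circDist (2 * ((j : ZMod q) - h)) := by
  have hodd : q % 2 = 1 := (Fact.out : q.Prime).eq_two_or_odd.resolve_left (by omega)
  have hj' := mem_Icc.mp hj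
  rw [exponent]
  rcases le_or_gt (2 * j) (q + 1) with hle | hlt
  · have e : 2 * ((j : ZMod q) - h) = ((2 * j - 1 : ℕ) : ZMod q) := by
      rw [Nat.cast_sub (by omega)]; push_cast; linear_combination -hh
    rw [e, circDist_natCast_eq_min (by omega) hq]
    omega
  · have e : 2 * ((j : ZMod q) - h) = -((2 * (q + 1 - j) - 1 : ℕ) : ZMod q) := by
      rw [Nat.cast_sub (by omega), Nat.cast_mul, Nat.cast_sub (by omega)]
      push_cast
      rw [ZMod.natCast_self]
      linear_combination -hh
    rw [e, circDist_neg, circDist_natCast_eq_min (by omega) hq]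
    omega

lemma prod_Icc_natCast_sub {M : Type*} [CommMonoid M] (f : ZMod q → M) (h : ZMod q) :
    ∏ j ∈ Icc 1 q, f ((j : ZMod q) - h) = ∏ t, f t := by
  have h1 : ∏ j ∈ Icc 1 q, f ((j : ZMod q) - h) = ∏ j ∈ range q, f (((j + 1 : ℕ) : ZMod q) - h) := by
    rw [range_eq_Ico, prod_Ico_add' (fun j : ℕ => f ((j : ZMod q) - h)) 0 q 1]
    rfl
  have h2 := prod_range_natCast (q := q) (fun x => f (x + 1 - h))
  rw [h1]
  simp only [Nat.cast_succ]
  rw [h2]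
  exact Fintype.prod_equiv (Equiv.addRight (1 - h)) _ _ fun x => by
    rw [Equiv.coe_addRight, add_sub_assoc]

/-- Since `(r - 1/2)² = r(r - 1) + 1/4` and `r(r - 1) = 2m` is even, the half-integral phase is a
constant times `e(-pm)`. The square is then completed again modulo `q`. -/
lemma exists_quadPhase_eq_phase (hq : 2 < q) {p : ℤ} (hp : ¬ (q : ℤ) ∣ p) :
    ∃ θ : ℂ, ‖θ‖ = 1 ∧ ∃ u h : ZMod q, u ≠ 0 ∧ 2 * h = 1 ∧
      ∀ r : ℕ, phase q p (1 / 2) r = quadPhase θ u ((r : ZMod q) - h) := by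
  have h2 : (2 : ZMod q) ≠ 0 := by exact_mod_cast natCast_ne_zero_zmod (q := q) two_pos hq
  have hp' : (p : ZMod q) ≠ 0 := by rwa [Ne, ZMod.intCast_zmod_eq_zero_iff_dvd]
  have hq0 : (q : ℂ) ≠ 0 := natCast_prime_ne_zero
  have hh : (2 : ZMod q) * 2⁻¹ = 1 := mul_inv_cancel₀ h2
  set h : ZMod q := 2⁻¹ with hdef
  have hh0 : h ≠ 0 := inv_ne_zero h2
  refine ⟨Complex.exp ((-(Real.pi * p / (4 * q)) : ℝ) * Complex.I) * stdAddChar ((p : ZMod q) * h ^ 3), ?_,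
    -((p : ZMod q) * h), h, neg_ne_zero.mpr (mul_ne_zero hp' hh0), hh, fun r => ?_⟩
  · rw [norm_mul, norm_stdAddChar, Complex.norm_exp_ofReal_mul_I, one_mul]
  · obtain ⟨m, hm⟩ := Int.even_mul_pred_self (r : ℤ)
    have hmZ : (r : ZMod q) * (r - 1) = m + m := by exact_mod_cast congrArg (Int.cast : ℤ → ZMod q) hm
    have hmC : (r : ℂ) * (r - 1) = m + m := by exact_mod_cast congrArg (Int.cast : ℤ → ℂ) hm
    rw [quadPhase, mul_assoc, ← AddChar.map_add_eq_mul]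
    -- The constant `p h³` compensates the square of the shift: the left side is `-p h r(r - 1) =
    -- -pm`.
    have e : (p : ZMod q) * h ^ 3 + -(p * h) * ((r : ZMod q) - h) ^ 2 = ((-(p * m) : ℤ) : ZMod q) := by
      push_cast
      linear_combination (-(p : ZMod q) * h) * hmZ + (p * h * r - p * m) * hh
    rw [e, stdAddChar_coe, ← Complex.exp_add, phase]
    congr 1
    push_cast
    field_simp
    linear_combination (-16 * (p : ℂ)) * hmC

lemma rootMultiplicity_prod_quadPhase {θ : ℂ} (hθ : ‖θ‖ = 1) {u : ZMod q} (hu : u ≠ 0) (t : ZMod q) :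
    (∏ r, (X - C (quadPhase θ u r))).rootMultiplicity (quadPhase θ u t) =
      ({t, -t} : Finset (ZMod q)).card := by
  classical
  have h1 : (∏ r, (X - C (quadPhase θ u r))).roots = univ.val.map (quadPhase θ u) :=
    roots_multiset_prod_X_sub_C (univ.val.map (quadPhase θ u)) ▸ by
      rw [Multiset.map_map]; rfl
  rw [← count_roots, h1, Multiset.count_map, ← Finset.filter_val, Finset.card_val]
  congr 1
  ext r
  rw [mem_filter, quadPhase_eq_iff hθ hu, mem_insert, mem_singleton, ← neg_eq_iff_eq_neg (a := t),
    eq_comm (a := t), eq_comm (a := -t)]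
  exact and_iff_right (mem_univ r)

lemma charpoly_freeMatrix {p : ℤ} {a : ZMod q → ℂ} {h : ZMod q} (hh : 2 * h = 1)
    (ha : ∀ r : ℕ, phase q p (1 / 2) r = a ((r : ZMod q) - h)) :
    (freeMatrix q p (1 / 2)).charpoly = ∏ t, (X - C (a t)) := by
  rw [← blochPoly_zero_right a 0, ← charpoly_blochMatrix hh ha]
  congr 1
  ext j k
  simp [blochMatrix]

/-- The leading coefficients of the eigenvalues at one resonance. -/
theorem exists_leadingCoefficients (hq : 2 < q) {p : ℤ} (hp : ¬ (q : ℤ) ∣ p) :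
    (∀ r ∈ Icc 1 q, phase q p (1 / 2) r = phase q p (1 / 2) (q - r + 1)) ∧
    (freeMatrix q p (1 / 2)).charpoly.rootMultiplicity (phase q p (1 / 2) ((q + 1) / 2)) = 1 ∧
    (∀ z : ℂ, z ≠ phase q p (1 / 2) ((q + 1) / 2) → (freeMatrix q p (1 / 2)).charpoly.IsRoot z →
      (freeMatrix q p (1 / 2)).charpoly.rootMultiplicity z = 2) ∧
    ∃ s : ℕ → ℂ,
      (∀ j ∈ Icc 1 q, ‖s j‖ ≤ 2 * (1 / Real.log 3) ^ exponent q j *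
        Real.exp (9 * Real.sqrt (q * Real.log q ^ 3))) ∧
      ∃ δ > (0 : ℝ), ∃ w : ℕ → ℝ → ℝ → ℂ, IsEigenvalueNumbering q p (1 / 2) δ w ∧
        ∀ j ∈ Icc 1 q, (∀ μ ∈ Set.Ioo (-δ) δ, Differentiable ℝ (fun ϑ : ℝ => w j ϑ μ)) ∧
          ∀ ϑ : ℝ, Asymptotics.IsEquivalent (𝓝[≠] (0 : ℝ))
            (fun μ : ℝ => deriv (fun t : ℝ => w j (t / q) μ) ϑ)
            (fun μ : ℝ => (μ : ℂ) ^ exponent q j * s j * (Real.sin ϑ : ℂ)) := by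
  obtain ⟨θ, hθ, u, h, hu, hh, ha⟩ := exists_quadPhase_eq_phase hq hp
  have hodd : q % 2 = 1 := (Fact.out : q.Prime).eq_two_or_odd.resolve_left (by omega)
  have h2 : (2 : ZMod q) ≠ 0 := by exact_mod_cast natCast_ne_zero_zmod (q := q) two_pos hq
  have hmid : phase q p (1 / 2) ((q + 1) / 2) = quadPhase θ u 0 := by
    rw [ha]
    congr 1
    have e : (2 : ZMod q) * (((q + 1) / 2 : ℕ) : ZMod q) = 1 := by
      have : 2 * ((q + 1) / 2) = q + 1 := by omega
      have := congrArg (Nat.cast : ℕ → ZMod q) this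
      push_cast at this
      rwa [ZMod.natCast_self, zero_add] at this
    exact mul_left_cancel₀ h2 (by linear_combination e - hh)
  have hchar := charpoly_freeMatrix hh ha
  refine ⟨fun r hr => ?_, ?_, fun z hz hroot => ?_, ?_⟩
  · rw [ha, ha, ← quadPhase_neg]
    congr 1
    rw [Nat.cast_succ, Nat.cast_sub (mem_Icc.mp hr).2, ZMod.natCast_self]
    linear_combination hh
  · rw [hmid, hchar, rootMultiplicity_prod_quadPhase hθ hu]
    simp
  · rw [hchar, IsRoot.def, eval_prod, prod_eq_zero_iff] at hroot
    obtain ⟨t, -, ht⟩ := hroot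
    rw [eval_sub, eval_X, eval_C, sub_eq_zero] at ht
    subst ht
    have ht : t ≠ 0 := by
      rintro rfl
      exact hz hmid.symm
    rw [hchar, rootMultiplicity_prod_quadPhase hθ hu, card_pair (neg_ne_self_zmod hq ht).symm]
  obtain ⟨s, hs, δ, hδ, w, hc, hfac, hw0, hdiff, hequiv⟩ := exists_eigenvalues hq hθ hu
  refine ⟨fun j => s ((j : ZMod q) - h), fun j hj => ?_, δ, hδ,
    fun j => w ((j : ZMod q) - h), ⟨fun j _ => hc _, fun ϑ μ hμ => ?_, fun j _ ϑ => ?_⟩,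
    fun j hj => ⟨hdiff _, fun ϑ => ?_⟩⟩
  · have hb := exponent_bounds hq hj
    have h1 := hs ((j : ZMod q) - h)
    rw [← exponent_eq hh hq hj] at h1
    refine h1.trans ?_
    have h3 := norm_transmission_ratio_le hq hu (show 0 < exponent q j by omega) hb.2
    refine (mul_le_mul_of_nonneg_left h3 (by positivity)).trans (le_of_eq ?_)
    -- The bases combine to `(1/2) · (2 / log 3) = 1 / log 3`.
    rw [← mul_assoc, mul_assoc 2, ← mul_pow]
    congr 3
    ring
  · rw [charpoly_blochMatrix hh ha, hfac ϑ μ hμ]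
    exact (prod_Icc_natCast_sub (fun t => X - C (w t ϑ μ)) h).symm
  · rw [hw0, ha]
  · rw [exponent_eq hh hq hj]
    exact hequiv _ ϑ

end Translation

/-- Exponential decay rests on `log 3 > 1`, that is `e < 3`; since `n > q/2`, half of `log (log 3)`
is an admissible rate. -/
lemma pow_le_exp_of_lt {q n : ℕ} (hn : q < 2 * n) :
    (1 / Real.log 3) ^ n ≤ Real.exp (-(Real.log (Real.log 3) / 2) * q) := by
  have hlog : 1 < Real.log 3 := by
    rw [Real.lt_log_iff_exp_lt (by norm_num)]
    exact Real.exp_one_lt_d9.trans (by norm_num)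
  have hll : 0 < Real.log (Real.log 3) := Real.log_pos hlog
  have e : 1 / Real.log 3 = Real.exp (-Real.log (Real.log 3)) := by
    rw [Real.exp_neg, Real.exp_log (by linarith), one_div]
  rw [e, ← Real.exp_nat_mul]
  refine Real.exp_le_exp.mpr ?_
  have : (q : ℝ) ≤ 2 * n := by exact_mod_cast hn.le
  nlinarith

end KickedRotor

/-! ### The theorem. -/

theorem theorem2 :
    ∃ s : ℕ → ℤ → ℕ → ℂ,
      (∀ (q : ℕ) (p : ℤ), q.Prime → 2 < q → ¬ (q : ℤ) ∣ p →
        (∀ r ∈ Finset.Icc 1 q,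
          KickedRotor.phase q p (1 / 2) r = KickedRotor.phase q p (1 / 2) (q - r + 1)) ∧
        (KickedRotor.freeMatrix q p (1 / 2)).charpoly.rootMultiplicity
          (KickedRotor.phase q p (1 / 2) ((q + 1) / 2)) = 1 ∧
        (∀ z : ℂ, z ≠ KickedRotor.phase q p (1 / 2) ((q + 1) / 2) →
          (KickedRotor.freeMatrix q p (1 / 2)).charpoly.IsRoot z →
          (KickedRotor.freeMatrix q p (1 / 2)).charpoly.rootMultiplicity z = 2) ∧
        (∀ j ∈ Finset.Icc 1 q,
          (q : ℝ) / 2 < (KickedRotor.exponent q j : ℝ) ∧ KickedRotor.exponent q j ≤ q) ∧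
        ∃ δ > (0 : ℝ), ∃ w : ℕ → ℝ → ℝ → ℂ,
          KickedRotor.IsEigenvalueNumbering q p (1 / 2) δ w ∧
          ∀ j ∈ Finset.Icc 1 q,
            (∀ μ ∈ Set.Ioo (-δ) δ, Differentiable ℝ (fun ϑ : ℝ => w j ϑ μ)) ∧
            ∀ ϑ : ℝ, Asymptotics.IsEquivalent (nhdsWithin (0 : ℝ) {0}ᶜ)
              (fun μ : ℝ => deriv (fun t : ℝ => w j (t / q) μ) ϑ)
              (fun μ : ℝ => (μ : ℂ) ^ KickedRotor.exponent q j * s q p j * (Real.sin ϑ : ℂ))) ∧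
      ∃ C > (0 : ℝ), ∃ γ > (0 : ℝ), ∃ A : ℕ → ℕ → ℝ,
        (∃ K : ℝ, ∀ᶠ q : ℕ in Filter.atTop, ∀ j ∈ Finset.Icc 1 q,
          |A j q| ≤ K * Real.sqrt (q * Real.log q ^ 3)) ∧
        ∀ᶠ q : ℕ in Filter.atTop, q.Prime → ∀ p : ℤ, ¬ (q : ℤ) ∣ p →
          ∀ j ∈ Finset.Icc 1 q, ‖s q p j‖ ≤ C * Real.exp (-γ * q + A j q) := by
  classical
  have hex : ∀ (q : ℕ) (p : ℤ), ∃ s : ℕ → ℂ, q.Prime → 2 < q → ¬ (q : ℤ) ∣ p →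
      (∀ j ∈ Finset.Icc 1 q, ‖s j‖ ≤ 2 * (1 / Real.log 3) ^ KickedRotor.exponent q j *
        Real.exp (9 * Real.sqrt (q * Real.log q ^ 3))) ∧
      ∃ δ > (0 : ℝ), ∃ w : ℕ → ℝ → ℝ → ℂ, KickedRotor.IsEigenvalueNumbering q p (1 / 2) δ w ∧
        ∀ j ∈ Finset.Icc 1 q, (∀ μ ∈ Set.Ioo (-δ) δ, Differentiable ℝ (fun ϑ : ℝ => w j ϑ μ)) ∧
          ∀ ϑ : ℝ, Asymptotics.IsEquivalent (nhdsWithin (0 : ℝ) {0}ᶜ)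
            (fun μ : ℝ => deriv (fun t : ℝ => w j (t / q) μ) ϑ)
            (fun μ : ℝ => (μ : ℂ) ^ KickedRotor.exponent q j * s j * (Real.sin ϑ : ℂ)) := by
    intro q p
    by_cases h : q.Prime ∧ 2 < q ∧ ¬ (q : ℤ) ∣ p
    · obtain ⟨hpr, hq, hp⟩ := h
      have : Fact q.Prime := ⟨hpr⟩
      obtain ⟨-, -, -, s, hs⟩ := KickedRotor.exists_leadingCoefficients hq hp
      exact ⟨s, fun _ _ _ => hs⟩
    -- Outside the admissible `q, p` the coefficients are set to 0.
    · exact ⟨0, fun h1 h2 h3 => absurd ⟨h1, h2, h3⟩ h⟩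
  choose s hs using hex
  refine ⟨s, fun q p hpr hq hp => ?_, 2, two_pos, Real.log (Real.log 3) / 2, ?_,
    fun _ q => 9 * Real.sqrt (q * Real.log q ^ 3), ⟨9, ?_⟩, ?_⟩
  · have : Fact q.Prime := ⟨hpr⟩
    obtain ⟨h1, h2, h3, -⟩ := KickedRotor.exists_leadingCoefficients hq hp
    refine ⟨h1, h2, h3, fun j hj => ?_, (hs q p hpr hq hp).2⟩
    obtain ⟨h4, h5⟩ := KickedRotor.exponent_bounds hq hj
    refine ⟨?_, h5⟩
    rw [div_lt_iff₀ two_pos, mul_comm]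
    exact_mod_cast h4
  · refine half_pos (Real.log_pos ?_)
    rw [Real.lt_log_iff_exp_lt (by norm_num)]
    exact Real.exp_one_lt_d9.trans (by norm_num)
  · exact Filter.Eventually.of_forall fun q j _ => by
      rw [abs_of_nonneg (by positivity)]
  · filter_upwards [Filter.eventually_gt_atTop 2] with q hq hpr p hp j hj
    have : Fact q.Prime := ⟨hpr⟩
    refine ((hs q p hpr hq hp).1 j hj).trans ?_
    rw [Real.exp_add, ← mul_assoc]
    refine mul_le_mul_of_nonneg_right ?_ (Real.exp_nonneg _)
    exact mul_le_mul_of_nonneg_left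
      (KickedRotor.pow_le_exp_of_lt (KickedRotor.exponent_bounds hq hj).1) two_pos.le
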